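/- Work in homotopy type theory: Martin-Löf type theory with a cumulative hierarchy of univalent universes, propositional truncation ($\exists$ denotes truncated $\Sigma$), and the following quotient inductive-inductive type. The set $\mathsf{Brw}$ of Brouwer trees and the proposition-valued relation $\leq$ on it are generated simultaneously by: $\mathsf{zero}:\mathsf{Brw}$; $\mathsf{succ}:\mathsf{Brw}\to\mathsf{Brw}$; $\mathsf{limit}\,f:\mathsf{Brw}$ for every $f:\mathbb N\to\mathsf{Brw}$ that is increasing, i.e. $f(k)<f(k+1)$ for all $k$, where $x<y$ means $\mathsf{succ}\,x\leq y$; $\mathsf{limit}\,f=\mathsf{limit}\,g$ whenever $\forall k.\exists n.\, f(k)\leq g(n)$ and $\forall k.\exists n.\, g(k)\leq f(n)$; $\mathsf{zero}\leq x$; transitivity of $\leq$; $x\leq y\to\mathsf{succ}\,x\leq\mathsf{succ}\,y$; $x\leq f(k)\to x\leq\mathsf{limit}\,f$; $(\forall k.\, f(k)\leq x)\to\mathsf{limit}\,f\leq x$. An *addition* on $\mathsf{Brw}$ is a function $+:\mathsf{Brw}\to\mathsf{Brw}\to\mathsf{Brw}$ such that for all $a,b,c,d$: if $a$ is a least element of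 $\mathsf{Brw}$, then $c+a=c$; if $a$ is a least element strictly above $b$ and $d$ is a least element strictly above $c+b$, then $c+a=d$; if $a$ is the supremum of an increasing sequence $f$ and $b$ is the supremum of $\lambda i.\,c+f(i)$, then $c+a=b$. $\mathsf{Brw}$ *has subtraction* if it has an addition $+$ together with a function assigning to all $b,a:\mathsf{Brw}$ and $p:a\leq b$ an element $b-_pa$ with $a+(b-_pa)=b$. It *has unique subtraction* if there is exactly one addition and, for this addition, exactly one such function $-$. $\mathsf{LPO}$ is the statement that every $s:\mathbb N\to\mathbf 2$ satisfies $(\forall n.\,s_n=\mathsf{ff})\uplus(\exists n.\,s_n=\mathsf{tt})$. **Theorem.** The following are theorems of this type theory (the corresponding types are inhabited). If $\mathsf{Brw}$ has subtraction, then it has unique subtraction. Moreover, $\mathsf{Brw}$ has subtraction if and only if $\mathsf{LPO}$ holds. -/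

import Mathlib

/-!
The theorem is a statement of constructive mathematics inside homotopy type theory: "LPO holds" and
"the type of Brouwer trees has subtraction" are types, and the theorem asserts that certain types
are inhabited. In the classical metatheory LPO is a triviality, so the theorem is stated about
homotopy type theory itself. This file defines

* the terms, the conversion and the typing relation of homotopy type theory, that is of Martin-Löf
  type theory with a cumulative hierarchy of univalent universes, with propositional truncation and
  with the quotient inductive-inductive type of Brouwer trees;
* inside this theory, the types "has addition", "has subtraction", "has unique subtraction"
  and the type LPO.
-/

namespace HoTT

/-- The primitive constants. -/
inductive Cst : Type
  -- empty type, unit type, booleans, natural numbers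
  | empty | emptyInd
  | unit | star | unitInd
  | bool | ff | tt | boolInd
  | nat | zero | suc | natInd
  -- binary sums, dependent pairs, identity types
  | sum | inl | inr | sumInd
  | sig | pair | sigInd
  | eq | refl | eqInd
  -- function extensionality and univalence
  | funext | univalence
  -- propositional truncation
  | trunc | tr | squash | truncInd
  -- Brouwer trees and their order, as a quotient inductive-inductive type
  | brw | le
  | bzero | bsucc | blimit | bisim | brwSet
  | leZero | leTrans | leSuccMono | leCocone | leLimiting | leProp
  | brwInd | leInd

/-- Raw terms with de Bruijn indices; `pi` and `lam` bind one variable. -/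
inductive Tm : Type
  | var (n : ℕ)
  | cst (c : Cst)
  | univ (i : ℕ)
  | pi (A B : Tm)
  | lam (t : Tm)
  | app (f a : Tm)

namespace Tm

/-- Renaming under a binder. -/
def upRen (ξ : ℕ → ℕ) : ℕ → ℕ
  | 0 => 0
  | n + 1 => ξ n + 1

/-- Simultaneous renaming of the free variables. -/
def rename : (ℕ → ℕ) → Tm → Tm
  | ξ, var n => var (ξ n)
  | _, cst c => cst c
  | _, univ i => univ i
  | ξ, pi A B => pi (rename ξ A) (rename (upRen ξ) B)
  | ξ, lam t => lam (rename (upRen ξ) t)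
  | ξ, app f a => app (rename ξ f) (rename ξ a)

/-- Weakening by `n` variables. -/
def lift (n : ℕ) (t : Tm) : Tm := rename (fun m => m + n) t

/-- Substitution under a binder. -/
def upSub (σ : ℕ → Tm) : ℕ → Tm
  | 0 => var 0
  | n + 1 => lift 1 (σ n)

/-- Simultaneous capture-avoiding substitution. -/
def subst : (ℕ → Tm) → Tm → Tm
  | σ, var n => σ n
  | _, cst c => cst c
  | _, univ i => univ i
  | σ, pi A B => pi (subst σ A) (subst (upSub σ) B)
  | σ, lam t => lam (subst (upSub σ) t)
  | σ, app f a => app (subst σ f) (subst σ a)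

/-- The substitution that replaces the last variable by `a`. -/
def single (a : Tm) : ℕ → Tm
  | 0 => a
  | n + 1 => var n

/-- `inst t a` is `t` with its last variable replaced by `a`. -/
def inst (t a : Tm) : Tm := subst (single a) t

/-- Iterated application of a constant. -/
def ap (c : Cst) (as : List Tm) : Tm := as.foldl app (cst c)

end Tm

/-! ### Writing terms with named variables -/

/-- A term in an arbitrary extension of a base context: `form d` is its de Bruijn form after `d`
further variables have been bound. This allows one to write binders as Lean functions. -/
structure Term : Type where
  form : ℕ → Tm

namespace Term

/-- The variable bound at depth `d`, seen from depth `e > d`. -/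
def bound (d : ℕ) : Term := ⟨fun e => .var (e - (d + 1))⟩

/-- A given raw term over the base context. -/
def raw (t : Tm) : Term := ⟨fun d => t.lift d⟩

/-- The de Bruijn form over the base context. -/
def close (t : Term) : Tm := t.form 0

end Term

instance : CoeFun Term (fun _ => Term → Term) :=
  ⟨fun f a => ⟨fun d => .app (f.form d) (a.form d)⟩⟩

/-- A constant. -/
def K (c : Cst) : Term := ⟨fun _ => .cst c⟩

/-- The `i`-th universe. -/
def U (i : ℕ) : Term := ⟨fun _ => .univ i⟩

/-- Dependent function type. -/
def Pi (A : Term) (B : Term → Term) : Term :=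
  ⟨fun d => .pi (A.form d) ((B (.bound d)).form (d + 1))⟩

/-- Function abstraction. -/
def Lam (t : Term → Term) : Term := ⟨fun d => .lam ((t (.bound d)).form (d + 1))⟩

/-- Non-dependent function type. -/
def Arr (A B : Term) : Term := Pi A fun _ => B

/-- Identity type. -/
def Id (A x y : Term) : Term := K .eq A x y

/-- Binary sum type. -/
def Sum (A B : Term) : Term := K .sum A B

/-- Dependent pair type. -/
def Sig (A : Term) (B : Term → Term) : Term := K .sig A (Lam B)

/-- Binary product type. -/
def Prod (A B : Term) : Term := Sig A fun _ => B

/-- First projection from `Sig A B`. -/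
def fst (A : Term) (B : Term → Term) (p : Term) : Term :=
  K .sigInd A (Lam B) (Lam fun _ => A) (Lam fun a => Lam fun _ => a) p

/-- Second projection from `Sig A B`. -/
def snd (A : Term) (B : Term → Term) (p : Term) : Term :=
  K .sigInd A (Lam B) (Lam fun q => B (fst A B q)) (Lam fun _ => Lam fun b => b) p

/-- Propositional truncation. -/
def Trunc (A : Term) : Term := K .trunc A

/-- Mere existence. -/
def Ex (A : Term) (B : Term → Term) : Term := Trunc (Sig A B)

/-- `A` is a proposition. -/
def isProp (A : Term) : Term := Pi A fun x => Pi A fun y => Id A x y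

/-- `A` is a set. -/
def isSet (A : Term) : Term := Pi A fun x => Pi A fun y => isProp (Id A x y)

/-- `A` has exactly one element. -/
def isContr (A : Term) : Term := Sig A fun x => Pi A fun y => Id A x y

/-- The map `f` from `X` to `Y` has a left inverse and a right inverse. -/
def isEquiv (X Y : Term) (f : Term → Term) : Term :=
  Prod (Sig (Arr Y X) fun g => Pi X fun x => Id X (g (f x)) x)
    (Sig (Arr Y X) fun h => Pi Y fun y => Id Y (f (h y)) y)

/-- The type of equivalences. -/
def Equiv (X Y : Term) : Term := Sig (Arr X Y) fun f => isEquiv X Y fun x => f x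

/-- Transport of `u : P x` along `p : x = y` in `A`. -/
def transport (A : Term) (P : Term → Term) (x y p u : Term) : Term :=
  K .eqInd A (Lam fun x => Lam fun y => Lam fun _ => Arr (P x) (P y))
    (Lam fun _ => Lam fun u => u) x y p u

/-- The identity equivalence. -/
def idEquiv (A : Term) : Term :=
  let isId (k : Term) : Term := Pi A fun x => Id A (k x) x
  let inv : Term := K .pair (Arr A A) (Lam isId) (Lam fun x => x) (Lam fun x => K .refl A x)
  let idIsEquiv : Term := K .pair (Sig (Arr A A) isId) (Lam fun _ => Sig (Arr A A) isId) inv inv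
  K .pair (Arr A A) (Lam fun f => isEquiv A A fun x => f x) (Lam fun x => x) idIsEquiv

/-- The canonical map `(A = B) → (A ≃ B)` for `A B : U i`. -/
def idToEquiv (i : ℕ) (A B p : Term) : Term :=
  K .eqInd (U i) (Lam fun A => Lam fun B => Lam fun _ => Equiv A B)
    (Lam fun A => idEquiv A) A B p

/-- The canonical map `(f = g) → ((x : A) → f x = g x)`, where `f g : (x : A) → B x`. -/
def happly (A : Term) (B : Term → Term) (f g p : Term) : Term :=
  K .eqInd (Pi A B)
    (Lam fun f => Lam fun g => Lam fun _ => Pi A fun x => Id (B x) (f x) (g x))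
    (Lam fun f => Lam fun x => K .refl (B x) (f x)) f g p

/-! ### Natural numbers, booleans, sequences -/

/-- The type of natural numbers. -/
def N : Term := K .nat

/-- The successor of a natural number. -/
def S (n : Term) : Term := K .suc n

/-- The type of booleans. -/
def Two : Term := K .bool

/-- `f : ℕ → A` is increasing with respect to `lt`. -/
def incr (lt : Term → Term → Term) (f : Term) : Term := Pi N fun k => lt (f k) (f (S k))

/-- The type of sequences in `A` that are increasing with respect to `lt`. -/
def Seq (A : Term) (lt : Term → Term → Term) : Term := Sig (Arr N A) (incr lt)

/-- The function `ℕ → A` underlying an increasing sequence. -/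
def seqFn (A : Term) (lt : Term → Term → Term) (F : Term) : Term := fst (Arr N A) (incr lt) F

/-- The proof that it is increasing. -/
def seqIncr (A : Term) (lt : Term → Term → Term) (F : Term) : Term := snd (Arr N A) (incr lt) F

/-- `f` is simulated by `g`, for functions `f g : ℕ → A`. -/
def simulated (le : Term → Term → Term) (f g : Term) : Term :=
  Pi N fun k => Ex N fun n => le (f k) (g n)

/-- `f` and `g` are bisimilar. -/
def bisimilar (le : Term → Term → Term) (f g : Term) : Term :=
  Prod (simulated le f g) (simulated le g f)

/-! ### Brouwer trees: formation and constructors -/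

/-- The type of Brouwer trees. -/
def Brw : Term := K .brw

/-- The successor of a Brouwer tree. -/
def bsucc (x : Term) : Term := K .bsucc x

/-- The order `x ≤ y` of Brouwer trees. -/
def le (x y : Term) : Term := K .le x y

/-- The order `x < y` of Brouwer trees. -/
def lt (x y : Term) : Term := le (bsucc x) y

/-- Increasing sequences of Brouwer trees. -/
def BSeq : Term := Seq Brw lt

/-- The function underlying an increasing sequence of Brouwer trees. -/
def fn (F : Term) : Term := seqFn Brw lt F

/-- The limit of an increasing sequence of Brouwer trees. -/
def blimit (F : Term) : Term := K .blimit F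

/-! ### Brouwer trees: induction

The simultaneous induction principle of the quotient inductive-inductive type `(Brw, ≤)` takes a
family `B x` of sets over `x : Brw` and a family `C x y b c p` of propositions over `p : x ≤ y`,
`b : B x`, `c : B y`, and one method for each constructor. It yields
`brwInd : (x : Brw) → B x` and `leInd : (p : x ≤ y) → C x y (brwInd x) (brwInd y) p`.
The methods for the truncation constructors say that `B x` is a set and `C x y b c p` a
proposition. -/

/-- The type of lifts of `F : BSeq` to the family `B`. -/
def liftFn (B F : Term) : Term := Pi N fun k => B (fn F k)

/-- The induction hypothesis for the proof that `F` is increasing, where `s` is the method for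
successors and `F'` is a lift of `F`. -/
def liftIncr (C s F F' : Term) : Term :=
  Pi N fun k => C (bsucc (fn F k)) (fn F (S k)) (s (fn F k) (F' k)) (F' (S k))
    (seqIncr Brw lt F k)

/-- The induction hypothesis for a simulation of `F` by `G`, where `F'` and `G'` are lifts. -/
def liftSim (C F F' G G' : Term) : Term :=
  Pi N fun k => Ex N fun n => Sig (le (fn F k) (fn G n)) fun p =>
    C (fn F k) (fn G n) (F' k) (G' n) p

/-- Quantification over the two motives (with values in `U j`) and all methods, which are passed
as a list to the rest of the type. -/
def withMethods (j : ℕ) (goal : (B C : Term) → List Term → Term) : Term :=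
  Pi (Arr Brw (U j)) fun B =>
  Pi (Pi Brw fun x => Pi Brw fun y => Arr (B x) (Arr (B y) (Arr (le x y) (U j)))) fun C =>
  Pi (Pi Brw fun x => isSet (B x)) fun hB =>
  Pi (Pi Brw fun x => Pi Brw fun y => Pi (B x) fun x' => Pi (B y) fun y' =>
    Pi (le x y) fun p => isProp (C x y x' y' p)) fun hC =>
  Pi (B (K .bzero)) fun z =>
  Pi (Pi Brw fun x => Arr (B x) (B (bsucc x))) fun s =>
  Pi (Pi BSeq fun F => Pi (liftFn B F) fun F' =>
    Arr (liftIncr C s F F') (B (blimit F))) fun l =>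
  Pi (Pi BSeq fun F => Pi (liftFn B F) fun F' => Pi (liftIncr C s F F') fun F'' =>
    Pi BSeq fun G => Pi (liftFn B G) fun G' => Pi (liftIncr C s G G') fun G'' =>
    Pi (bisimilar le (fn F) (fn G)) fun r =>
    Arr (liftSim C F F' G G') (Arr (liftSim C G G' F F')
      (Id (B (blimit G))
        (transport Brw (fun x => B x) (blimit F) (blimit G) (K .bisim F G r) (l F F' F''))
        (l G G' G'')))) fun b =>
  Pi (Pi Brw fun x => Pi (B x) fun x' => C (K .bzero) x z x' (K .leZero x)) fun m1 =>
  Pi (Pi Brw fun x => Pi (B x) fun x' => Pi Brw fun y => Pi (B y) fun y' =>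
    Pi Brw fun w => Pi (B w) fun w' =>
    Pi (le x y) fun p => Arr (C x y x' y' p) <|
    Pi (le y w) fun q => Arr (C y w y' w' q) <|
    C x w x' w' (K .leTrans x y w p q)) fun m2 =>
  Pi (Pi Brw fun x => Pi (B x) fun x' => Pi Brw fun y => Pi (B y) fun y' =>
    Pi (le x y) fun p => Arr (C x y x' y' p)
      (C (bsucc x) (bsucc y) (s x x') (s y y') (K .leSuccMono x y p))) fun m3 =>
  Pi (Pi Brw fun x => Pi (B x) fun x' =>
    Pi BSeq fun F => Pi (liftFn B F) fun F' => Pi (liftIncr C s F F') fun F'' =>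
    Pi N fun k => Pi (le x (fn F k)) fun p => Arr (C x (fn F k) x' (F' k) p)
      (C x (blimit F) x' (l F F' F'') (K .leCocone x F k p))) fun m4 =>
  Pi (Pi BSeq fun F => Pi (liftFn B F) fun F' => Pi (liftIncr C s F F') fun F'' =>
    Pi Brw fun x => Pi (B x) fun x' =>
    Pi (Pi N fun k => le (fn F k) x) fun h =>
    Arr (Pi N fun k => C (fn F k) x (F' k) x' (h k))
      (C (blimit F) x (l F F' F'') x' (K .leLimiting F x h))) fun m5 =>
  goal B C [B, C, hB, hC, z, s, l, b, m1, m2, m3, m4, m5]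

/-- Application of a constant to a list of arguments. -/
def apList (c : Cst) (as : List Term) : Term := as.foldl (fun f a => f a) (K c)

/-! ### The types of the constants -/

/-- The types of a constant. Universe levels are typically ambiguous: a constant has each of the
types `c.type i j`, at universe levels `i` (for parameters) and `j` (for motives). -/
def Cst.type (i j : ℕ) : Cst → Term
  | empty => U i
  | emptyInd => Pi (Arr (K empty) (U j)) fun P => Pi (K empty) fun x => P x
  | unit => U i
  | star => K unit
  | unitInd => Pi (Arr (K unit) (U j)) fun P => Arr (P (K star)) <| Pi (K unit) fun x => P x
  | bool => U i
  | ff => Two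
  | tt => Two
  | boolInd => Pi (Arr Two (U j)) fun P => Arr (P (K ff)) <| Arr (P (K tt)) <|
      Pi Two fun x => P x
  | nat => U i
  | zero => N
  | suc => Arr N N
  | natInd => Pi (Arr N (U j)) fun P => Arr (P (K zero)) <|
      Arr (Pi N fun n => Arr (P n) (P (S n))) <| Pi N fun n => P n
  | sum => Arr (U i) (Arr (U i) (U i))
  | inl => Pi (U i) fun A => Pi (U i) fun B => Arr A (Sum A B)
  | inr => Pi (U i) fun A => Pi (U i) fun B => Arr B (Sum A B)
  | sumInd => Pi (U i) fun A => Pi (U i) fun B => Pi (Arr (Sum A B) (U j)) fun P =>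
      Arr (Pi A fun a => P (K inl A B a)) <| Arr (Pi B fun b => P (K inr A B b)) <|
      Pi (Sum A B) fun x => P x
  | sig => Pi (U i) fun A => Arr (Arr A (U i)) (U i)
  | pair => Pi (U i) fun A => Pi (Arr A (U i)) fun B =>
      Pi A fun a => Arr (B a) (K sig A B)
  | sigInd => Pi (U i) fun A => Pi (Arr A (U i)) fun B =>
      Pi (Arr (K sig A B) (U j)) fun P =>
      Arr (Pi A fun a => Pi (B a) fun b => P (K pair A B a b)) <|
      Pi (K sig A B) fun x => P x
  | eq => Pi (U i) fun A => Arr A (Arr A (U i))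
  | refl => Pi (U i) fun A => Pi A fun x => Id A x x
  | eqInd => Pi (U i) fun A =>
      Pi (Pi A fun x => Pi A fun y => Arr (Id A x y) (U j)) fun P =>
      Arr (Pi A fun x => P x x (K refl A x)) <|
      Pi A fun x => Pi A fun y => Pi (Id A x y) fun p => P x y p
  | funext => Pi (U i) fun A => Pi (Arr A (U i)) fun B =>
      Pi (Pi A fun x => B x) fun f => Pi (Pi A fun x => B x) fun g =>
      isEquiv (Id (Pi A fun x => B x) f g) (Pi A fun x => Id (B x) (f x) (g x))
        (happly A (fun x => B x) f g)
  | univalence => Pi (U i) fun A => Pi (U i) fun B =>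
      isEquiv (Id (U i) A B) (Equiv A B) (idToEquiv i A B)
  | trunc => Arr (U i) (U i)
  | tr => Pi (U i) fun A => Arr A (Trunc A)
  | squash => Pi (U i) fun A => isProp (Trunc A)
  | truncInd => Pi (U i) fun A => Pi (Arr (Trunc A) (U j)) fun P =>
      Arr (Pi (Trunc A) fun x => isProp (P x)) <|
      Arr (Pi A fun a => P (K tr A a)) <| Pi (Trunc A) fun x => P x
  | brw => U i
  | le => Arr Brw (Arr Brw (U i))
  | bzero => Brw
  | bsucc => Arr Brw Brw
  | blimit => Arr BSeq Brw
  | bisim => Pi BSeq fun F => Pi BSeq fun G =>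
      Arr (bisimilar HoTT.le (fn F) (fn G)) (Id Brw (HoTT.blimit F) (HoTT.blimit G))
  | brwSet => isSet Brw
  | leZero => Pi Brw fun x => HoTT.le (K bzero) x
  | leTrans => Pi Brw fun x => Pi Brw fun y => Pi Brw fun z =>
      Arr (HoTT.le x y) (Arr (HoTT.le y z) (HoTT.le x z))
  | leSuccMono => Pi Brw fun x => Pi Brw fun y =>
      Arr (HoTT.le x y) (HoTT.le (HoTT.bsucc x) (HoTT.bsucc y))
  | leCocone => Pi Brw fun x => Pi BSeq fun F => Pi N fun k =>
      Arr (HoTT.le x (fn F k)) (HoTT.le x (HoTT.blimit F))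
  | leLimiting => Pi BSeq fun F => Pi Brw fun x =>
      Arr (Pi N fun k => HoTT.le (fn F k) x) (HoTT.le (HoTT.blimit F) x)
  | leProp => Pi Brw fun x => Pi Brw fun y => isProp (HoTT.le x y)
  | brwInd => withMethods j fun B _ _ => Pi Brw fun x => B x
  | leInd => withMethods j fun _ C ms =>
      Pi Brw fun x => Pi Brw fun y => Pi (HoTT.le x y) fun p =>
      C x y (apList brwInd ms x) (apList brwInd ms y) p

/-! ### Conversion and typing -/

open Tm in
/-- Conversion (judgemental equality): the congruence generated by the beta and eta rules for
functions and the computation rules of the eliminators on point constructors. -/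
inductive Conv : Tm → Tm → Prop
  | rfl {t} : Conv t t
  | symm {t u} : Conv t u → Conv u t
  | trans {t u v} : Conv t u → Conv u v → Conv t v
  | pi {A A' B B'} : Conv A A' → Conv B B' → Conv (.pi A B) (.pi A' B')
  | lam {t t'} : Conv t t' → Conv (.lam t) (.lam t')
  | app {f f' a a'} : Conv f f' → Conv a a' → Conv (.app f a) (.app f' a')
  | beta {t a} : Conv (.app (.lam t) a) (t.inst a)
  | eta {t} : Conv (.lam (.app (t.lift 1) (.var 0))) t
  | unit {P d} : Conv (ap .unitInd [P, d, .cst .star]) d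
  | boolFF {P d e} : Conv (ap .boolInd [P, d, e, .cst .ff]) d
  | boolTT {P d e} : Conv (ap .boolInd [P, d, e, .cst .tt]) e
  | natZero {P d e} : Conv (ap .natInd [P, d, e, .cst .zero]) d
  | natSuc {P d e n} :
      Conv (ap .natInd [P, d, e, .app (.cst .suc) n]) (.app (.app e n) (ap .natInd [P, d, e, n]))
  | sumInl {A B P d e A' B' a} :
      Conv (ap .sumInd [A, B, P, d, e, ap .inl [A', B', a]]) (.app d a)
  | sumInr {A B P d e A' B' b} :
      Conv (ap .sumInd [A, B, P, d, e, ap .inr [A', B', b]]) (.app e b)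
  | sig {A B P d A' B' a b} :
      Conv (ap .sigInd [A, B, P, d, ap .pair [A', B', a, b]]) (.app (.app d a) b)
  | eq {A P d x y A' z} :
      Conv (ap .eqInd [A, P, d, x, y, ap .refl [A', z]]) (.app d z)
  | trunc {A P h d A' a} :
      Conv (ap .truncInd [A, P, h, d, ap .tr [A', a]]) (.app d a)
  | brwZero {B C hB hC z s l b m1 m2 m3 m4 m5} :
      Conv (ap .brwInd [B, C, hB, hC, z, s, l, b, m1, m2, m3, m4, m5, .cst .bzero]) z
  | brwSucc {B C hB hC z s l b m1 m2 m3 m4 m5 x} :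
      Conv (ap .brwInd [B, C, hB, hC, z, s, l, b, m1, m2, m3, m4, m5, .app (.cst .bsucc) x])
        (.app (.app s x) (ap .brwInd [B, C, hB, hC, z, s, l, b, m1, m2, m3, m4, m5, x]))
  | brwLimit {B C hB hC z s l b m1 m2 m3 m4 m5 F} :
      Conv (ap .brwInd [B, C, hB, hC, z, s, l, b, m1, m2, m3, m4, m5, .app (.cst .blimit) F])
        (let ms : List Term := [B, C, hB, hC, z, s, l, b, m1, m2, m3, m4, m5].map .raw
         let f : Term := fn (.raw F)
         let p : Term := seqIncr Brw lt (.raw F)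
         (Term.raw l (.raw F) (Lam fun k => apList .brwInd ms (f k))
           (Lam fun k => apList .leInd ms (bsucc (f k)) (f (S k)) (p k))).close)

/-- The typing relation `Γ ⊢ t : A`; the most recently bound variable is the head of `Γ`.
Universes are cumulative. In a derivation that starts from the empty context all contexts are
well formed, since the rules for `pi` and `lam` extend `Γ` by types only. -/
inductive HasType : List Tm → Tm → Tm → Prop
  | var {Γ : List Tm} {n : ℕ} {A : Tm} : Γ[n]? = some A → HasType Γ (.var n) (A.lift (n + 1))
  | cst {Γ : List Tm} {c : Cst} {i j : ℕ} : HasType Γ (.cst c) (c.type i j).close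
  | univ {Γ : List Tm} {i : ℕ} : HasType Γ (.univ i) (.univ (i + 1))
  | pi {Γ : List Tm} {A B : Tm} {i : ℕ} :
      HasType Γ A (.univ i) → HasType (A :: Γ) B (.univ i) → HasType Γ (.pi A B) (.univ i)
  | lam {Γ : List Tm} {A B t : Tm} {i : ℕ} :
      HasType Γ A (.univ i) → HasType (A :: Γ) t B → HasType Γ (.lam t) (.pi A B)
  | app {Γ : List Tm} {A B f a : Tm} :
      HasType Γ f (.pi A B) → HasType Γ a A → HasType Γ (.app f a) (B.inst a)
  | conv {Γ : List Tm} {A B t : Tm} {i : ℕ} :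
      HasType Γ t A → Conv A B → HasType Γ B (.univ i) → HasType Γ t B
  | cumul {Γ : List Tm} {A : Tm} {i : ℕ} :
      HasType Γ A (.univ i) → HasType Γ A (.univ (i + 1))

/-- `A` is a (small) type of homotopy type theory and has a closed element: the statement that
`A` expresses is a theorem of homotopy type theory. -/
def Provable (A : Term) : Prop :=
  HasType [] A.close (.univ 0) ∧ ∃ t : Tm, HasType [] t A.close

/-! ### Arithmetic on a type `A` with relations `<` and `≤` -/

section Arithmetic

variable (A : Term) (lt le : Term → Term → Term)

/-- `a` is zero. -/
def isZero (a : Term) : Term := Pi A fun b => le a b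

/-- `a` is a successor of `b`. -/
def isSuccOf (a b : Term) : Term := Prod (lt b a) (Pi A fun x => Arr (lt b x) (le a x))

/-- `a` is the supremum of the sequence `f` of elements of `A`. -/
def isSupOf (a : Term) (f : Term → Term) : Term :=
  Prod (Pi N fun n => le (f n) a) (Pi A fun b => Arr (Pi N fun n => le (f n) b) (le a b))

/-- `a` is the limit of the increasing sequence `F`. -/
def isLimOf (a F : Term) : Term := isSupOf A le a fun n => seqFn A lt F n

/-- `plus : A → A → A` satisfies the specification of addition. -/
def isAddition (plus : Term) : Term :=
  Prod (Pi A fun c => Pi A fun a => Arr (isZero A le a) (Id A (plus c a) c)) <|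
  Prod (Pi A fun c => Pi A fun a => Pi A fun b => Pi A fun d =>
    Arr (isSuccOf A lt le a b) <| Arr (isSuccOf A lt le d (plus c b)) (Id A (plus c a) d)) <|
  Pi A fun c => Pi A fun a => Pi A fun b => Pi (Seq A lt) fun F =>
    Arr (isLimOf A lt le a F) <|
    Arr (isSupOf A le b fun i => plus c (seqFn A lt F i)) (Id A (plus c a) b)

/-- The type of binary operations on `A`. -/
def BinOp : Term := Arr A (Arr A A)

/-- `A` has addition. -/
def hasAddition : Term := Sig (BinOp A) fun plus => isAddition A lt le plus

/-- The type of subtraction functions for the operation `plus`: they map `b`, `a` and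
`p : a ≤ b` to an element `b - a` with `a + (b - a) = b`. -/
def subtractionFor (plus : Term) : Term :=
  Sig (Pi A fun b => Pi A fun a => Arr (le a b) A) fun minus =>
    Pi A fun b => Pi A fun a => Pi (le a b) fun p => Id A (plus a (minus b a p)) b

/-- `A` has subtraction: it has addition and a subtraction function for it. -/
def hasSubtraction : Term :=
  Sig (hasAddition A lt le) fun s =>
    subtractionFor A le (fst (BinOp A) (isAddition A lt le) s)

/-- `A` has unique subtraction: it has exactly one addition and, for it, exactly one
subtraction function. -/
def hasUniqueSubtraction : Term :=
  Sig (hasAddition A lt le) fun s =>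
    Prod (Pi (hasAddition A lt le) fun s' => Id (hasAddition A lt le) s s')
      (isContr (subtractionFor A le (fst (BinOp A) (isAddition A lt le) s)))

end Arithmetic

/-- The limited principle of omniscience. -/
def LPO : Term :=
  Pi (Arr N Two) fun s =>
    Sum (Pi N fun n => Id Two (s n) (K .ff)) (Ex N fun n => Id Two (s n) (K .tt))

end HoTT

/-! Both claims say that a type of the object theory is inhabited, so closed terms have to be
exhibited and typed. This is done by reflection. Reduction, conversion and bidirectional type
checking are implemented with bounded recursion depth and proved sound for `Conv` and `HasType`
(`conv_whnf`, `conv_of_isConv`, `Checker.sound_ofDepth`); the kernel evaluates the checker on each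
proof term. The lemmas of the object theory form a telescope: each proved type becomes an entry of a
context, later proofs refer to it as a variable, and `Realized` records that the whole context has a
closed instance. Substituting this instance yields closed proofs.

The argument inside type theory starts from an encode-decode description of the strict order. A
family of propositions defined by recursion on `y` characterizes `z < y`: it is empty at zero, `z ≤
x` at `succ x`, and a mere existential at limits (`ltRecProof`). From the resulting inversion
principles follow irreflexivity and antisymmetry. Addition of `c` is defined by recursion into the
trees above `c`. Zero, successors and limits are determined by their order properties, so induction
on the second argument leaves only one addition. Moreover `x ↦ a + x` reflects the order
(`addReflectProof`), hence is injective. Differences are therefore unique, and any subtraction is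
the only one.

Under LPO, induction gives `x ≤ y` or `y < x` (`leOrLtProof`), and then differences `b - a` by
induction on `b`: at a limit `F` either `a` is the limit itself, or `a < F k` for some `k`, and the
differences of `a` and the later members form an increasing sequence.

Conversely, a binary sequence `s` gives an increasing sequence of trees that starts at zero, takes
successors while `s` is false and exceeds `ω` as soon as `s` is true. Its limit `J` is at least `ω`,
and whether `J - ω` is zero or positive can be decided. Zero forces `J = ω`, so that `s` is
constantly false; a positive difference gives `ω < J`, so some member is above `ω`, which requires a
true value of `s` (`lpoOfDiffProof`). -/

namespace HoTT

/-! ### Substitution calculus -/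

namespace Tm

theorem rename_eq_subst (t : Tm) : ∀ ξ : ℕ → ℕ, t.rename ξ = t.subst fun n => var (ξ n) := by
  have up (ξ : ℕ → ℕ) : (fun n => var (upRen ξ n)) = upSub fun n => var (ξ n) := by
    funext n; cases n <;> rfl
  induction t with
  | var | cst | univ => intros; rfl
  | pi A B hA hB => intro ξ; simp only [rename, subst, hA, hB, up]
  | lam t h => intro ξ; simp only [rename, subst, h, up]
  | app f a hf ha => intro ξ; simp only [rename, subst, hf, ha]

/-- The composition laws build on one another: going under a binder weakens the substitution, so
each law for substitutions needs the laws for renamings there. -/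
theorem subst_rename (t : Tm) : ∀ (ξ : ℕ → ℕ) (σ : ℕ → Tm),
    (t.rename ξ).subst σ = t.subst fun n => σ (ξ n) := by
  have up (ξ : ℕ → ℕ) (σ : ℕ → Tm) :
      (fun n => upSub σ (upRen ξ n)) = upSub fun n => σ (ξ n) := by
    funext n; cases n <;> rfl
  induction t with
  | var | cst | univ => intros; rfl
  | pi A B hA hB => intro ξ σ; simp only [rename, subst, hA, hB, up]
  | lam t h => intro ξ σ; simp only [rename, subst, h, up]
  | app f a hf ha => intro ξ σ; simp only [rename, subst, hf, ha]

theorem rename_rename (t : Tm) (ξ ζ : ℕ → ℕ) :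
    (t.rename ξ).rename ζ = t.rename fun n => ζ (ξ n) := by
  rw [rename_eq_subst _ ζ, subst_rename, rename_eq_subst]

theorem rename_subst (t : Tm) : ∀ (σ : ℕ → Tm) (ξ : ℕ → ℕ),
    (t.subst σ).rename ξ = t.subst fun n => (σ n).rename ξ := by
  have up (ξ : ℕ → ℕ) (σ : ℕ → Tm) :
      (fun n => (upSub σ n).rename (upRen ξ)) = upSub fun n => (σ n).rename ξ := by
    funext n
    cases n with
    | zero => rfl
    | succ n => simp only [upSub, lift, rename_rename, upRen]
  induction t with
  | var | cst | univ => intros; rfl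
  | pi A B hA hB => intro σ ξ; simp only [rename, subst, hA, hB, up]
  | lam t h => intro σ ξ; simp only [rename, subst, h, up]
  | app f a hf ha => intro σ ξ; simp only [rename, subst, hf, ha]

theorem subst_upSub_lift (σ : ℕ → Tm) (t : Tm) :
    (t.lift 1).subst (upSub σ) = (t.subst σ).lift 1 := by
  simp only [lift, subst_rename, rename_subst]; rfl

theorem subst_subst (t : Tm) : ∀ σ τ : ℕ → Tm,
    (t.subst σ).subst τ = t.subst fun n => (σ n).subst τ := by
  have up (σ τ : ℕ → Tm) :
      (fun n => (upSub σ n).subst (upSub τ)) = upSub fun n => (σ n).subst τ := by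
    funext n
    cases n with
    | zero => rfl
    | succ n => exact subst_upSub_lift τ (σ n)
  induction t with
  | var | cst | univ => intros; rfl
  | pi A B hA hB => intro σ τ; simp only [subst, hA, hB, up]
  | lam t h => intro σ τ; simp only [subst, h, up]
  | app f a hf ha => intro σ τ; simp only [subst, hf, ha]

theorem upSub_var : upSub var = var := by
  funext n; cases n <;> rfl

theorem subst_var (t : Tm) : t.subst var = t := by
  induction t with
  | var | cst | univ => rfl
  | pi A B hA hB => simp only [subst, upSub_var, hA, hB]
  | lam t h => simp only [subst, upSub_var, h]
  | app f a hf ha => simp only [subst, hf, ha]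

theorem lift_zero (t : Tm) : t.lift 0 = t := by
  rw [lift, rename_eq_subst]; exact subst_var t

theorem lift_lift (t : Tm) (m n : ℕ) : (t.lift m).lift n = t.lift (m + n) := by
  simp only [lift, rename_rename, Nat.add_assoc]

theorem inst_lift (t a : Tm) : (t.lift 1).inst a = t := by
  rw [inst, lift, subst_rename]; exact subst_var t

theorem inst_subst (t a : Tm) (σ : ℕ → Tm) :
    (t.inst a).subst σ = (t.subst (upSub σ)).inst (a.subst σ) := by
  simp only [inst, subst_subst]
  congr 1; funext n
  cases n with
  | zero => rfl
  | succ n => exact (inst_lift _ _).symm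

end Tm

/-- All free variables of `t` are less than `k`. -/
def Tm.closedAt : ℕ → Tm → Bool
  | k, .var n => Nat.blt n k
  | _, .cst _ => true
  | _, .univ _ => true
  | k, .pi A B => A.closedAt k && B.closedAt (k + 1)
  | k, .lam t => t.closedAt (k + 1)
  | k, .app f a => f.closedAt k && a.closedAt k

theorem Tm.subst_of_closedAt {t : Tm} : ∀ {k : ℕ} {σ : ℕ → Tm}, t.closedAt k = true →
    (∀ n < k, σ n = var n) → t.subst σ = t := by
  have up {k : ℕ} {σ : ℕ → Tm} (h : ∀ n < k, σ n = var n) : ∀ n < k + 1, upSub σ n = var n := by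
    rintro (_ | n) hn
    · rfl
    · rw [upSub, h n (by omega)]; rfl
  induction t with
  | var n => intro k σ h hσ; exact hσ n (by simpa [closedAt] using h)
  | cst | univ => intros; rfl
  | pi A B hA hB =>
    intro k σ h hσ
    simp only [closedAt, Bool.and_eq_true] at h
    rw [subst, hA h.1 hσ, hB h.2 (up hσ)]
  | lam t ih => intro k σ h hσ; rw [subst, ih h (up hσ)]
  | app f a hf ha =>
    intro k σ h hσ
    simp only [closedAt, Bool.and_eq_true] at h
    rw [subst, hf h.1 hσ, ha h.2 hσ]

/-- Levels occur only inside `univ`, so `closedAt` evaluates even though `i` and `j` are variables.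
-/
theorem Cst.closedAt_type (c : Cst) (i j : ℕ) : (c.type i j).close.closedAt 0 = true := by
  cases c <;> rfl

theorem Cst.subst_type (σ : ℕ → Tm) (c : Cst) (i j : ℕ) :
    (c.type i j).close.subst σ = (c.type i j).close :=
  Tm.subst_of_closedAt (c.closedAt_type i j) nofun

/-! ### Stability of conversion and typing under substitution -/

open Tm

theorem Conv.subst {t u : Tm} (h : Conv t u) : ∀ σ : ℕ → Tm, Conv (t.subst σ) (u.subst σ) := by
  induction h with
  | rfl => exact fun _ => .rfl
  | symm _ h => exact fun σ => (h σ).symm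
  | trans _ _ h k => exact fun σ => (h σ).trans (k σ)
  | pi _ _ h k => exact fun σ => (h σ).pi (k _)
  | lam _ h => exact fun σ => (h _).lam
  | app _ _ h k => exact fun σ => (h σ).app (k σ)
  | beta => intro σ; rw [inst_subst]; exact .beta
  | @eta t =>
    intro σ
    have h : (Tm.lam (.app (t.lift 1) (.var 0))).subst σ
        = .lam (.app ((t.subst σ).lift 1) (.var 0)) := by
      simp only [Tm.subst, subst_upSub_lift, upSub]
    rw [h]; exact .eta
  | unit => exact fun _ => .unit
  | boolFF => exact fun _ => .boolFF
  | boolTT => exact fun _ => .boolTT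
  | natZero => exact fun _ => .natZero
  | natSuc => exact fun _ => .natSuc
  | sumInl => exact fun _ => .sumInl
  | sumInr => exact fun _ => .sumInr
  | sig => exact fun _ => .sig
  | eq => exact fun _ => .eq
  | trunc => exact fun _ => .trunc
  | brwZero => exact fun _ => .brwZero
  | brwSucc => exact fun _ => .brwSucc
  | @brwLimit B C hB hC z s l b m1 m2 m3 m4 m5 F =>
    intro σ
    refine (Conv.brwLimit (B := B.subst σ) (C := C.subst σ) (hB := hB.subst σ) (hC := hC.subst σ)
      (z := z.subst σ) (s := s.subst σ) (l := l.subst σ) (b := b.subst σ) (m1 := m1.subst σ)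
      (m2 := m2.subst σ) (m3 := m3.subst σ) (m4 := m4.subst σ) (m5 := m5.subst σ)
      (F := F.subst σ)).trans ?_
    -- The right-hand side of this rule weakens its parameters under the binders of the two
    -- abstractions, so the substitution has to be commuted with `lift`.
    simp only [Term.raw, Term.close, Lam, apList, List.map, List.foldl, K, fn, seqFn, seqIncr, fst,
      snd, incr, lt, le, bsucc, S, Arr, Pi, N, Brw, Term.bound, lift_zero, Nat.reduceAdd,
      Nat.reduceSub, Tm.subst, subst_upSub_lift, upSub]
    exact .rfl

theorem Conv.rename {t u : Tm} (h : Conv t u) (ξ : ℕ → ℕ) : Conv (t.rename ξ) (u.rename ξ) := by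
  simp only [rename_eq_subst]; exact h.subst _

theorem Tm.inst_rename (t a : Tm) (ξ : ℕ → ℕ) :
    (t.inst a).rename ξ = (t.rename (upRen ξ)).inst (a.rename ξ) := by
  simp only [inst, rename_subst, subst_rename]
  congr 1; funext n; cases n <;> rfl

theorem HasType.rename {Γ : List Tm} {t A : Tm} (h : HasType Γ t A) :
    ∀ {Δ : List Tm} {ξ : ℕ → ℕ},
      (∀ n B, Γ[n]? = some B →
        ∃ B', Δ[ξ n]? = some B' ∧ B'.lift (ξ n + 1) = (B.lift (n + 1)).rename ξ) →
      HasType Δ (t.rename ξ) (A.rename ξ) := by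
  have up {Γ Δ : List Tm} {ξ : ℕ → ℕ} (A : Tm) (h : ∀ n B, Γ[n]? = some B →
        ∃ B', Δ[ξ n]? = some B' ∧ B'.lift (ξ n + 1) = (B.lift (n + 1)).rename ξ) :
      ∀ n B, (A :: Γ)[n]? = some B →
        ∃ B', (A.rename ξ :: Δ)[upRen ξ n]? = some B' ∧
          B'.lift (upRen ξ n + 1) = (B.lift (n + 1)).rename (upRen ξ) := by
    rintro (_ | n) B hB
    · obtain rfl : A = B := by simpa using hB
      exact ⟨_, rfl, by simp only [lift, rename_rename, upRen]⟩
    · obtain ⟨B', h1, h2⟩ := h n B (by simpa using hB)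
      refine ⟨B', by simpa [upRen] using h1, ?_⟩
      rw [upRen, ← lift_lift B' (ξ n + 1) 1, h2, ← lift_lift B (n + 1) 1]
      simp only [lift, rename_rename, upRen]
  induction h with
  | var hn =>
    intro Δ ξ H
    obtain ⟨B', h1, h2⟩ := H _ _ hn
    rw [← h2]; exact .var h1
  | cst =>
    intro Δ ξ H
    rw [rename_eq_subst (Term.close _), Cst.subst_type]; exact .cst
  | univ => exact fun _ => .univ
  | pi _ _ hA hB => exact fun H => .pi (hA H) (hB (up _ H))
  | lam _ _ hA ht => exact fun H => .lam (hA H) (ht (up _ H))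
  | app _ _ hf ha =>
    intro Δ ξ H
    rw [inst_rename]; exact .app (hf H) (ha H)
  | conv _ c _ ht hB => exact fun H => .conv (ht H) (c.rename _) (hB H)
  | cumul _ h => exact fun H => .cumul (h H)

theorem HasType.weaken {Γ : List Tm} {t A : Tm} (B : Tm) (h : HasType Γ t A) :
    HasType (B :: Γ) (t.lift 1) (A.lift 1) := by
  refine h.rename fun n C hC => ⟨C, by simpa using hC, ?_⟩
  rw [← lift_lift C (n + 1) 1]; rfl

/-- Under a binder the substituted terms are weakened, so this rests on `weaken`, which comes from
the analogous statement for renamings. Constants cause no difficulty because their types are closed.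
-/
theorem HasType.subst {Γ : List Tm} {t A : Tm} (h : HasType Γ t A) :
    ∀ {Δ : List Tm} {σ : ℕ → Tm},
      (∀ n B, Γ[n]? = some B → HasType Δ (σ n) ((B.lift (n + 1)).subst σ)) →
      HasType Δ (t.subst σ) (A.subst σ) := by
  have up {Γ Δ : List Tm} {σ : ℕ → Tm} (A : Tm)
      (h : ∀ n B, Γ[n]? = some B → HasType Δ (σ n) ((B.lift (n + 1)).subst σ)) :
      ∀ n B, (A :: Γ)[n]? = some B →
        HasType (A.subst σ :: Δ) (upSub σ n) ((B.lift (n + 1)).subst (upSub σ)) := by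
    rintro (_ | n) B hB
    · obtain rfl : A = B := by simpa using hB
      rw [subst_upSub_lift]; exact .var rfl
    · rw [← lift_lift B (n + 1) 1, subst_upSub_lift]
      exact (h n B (by simpa using hB)).weaken _
  induction h with
  | var hn => exact fun H => H _ _ hn
  | cst => intro Δ σ H; rw [Cst.subst_type]; exact .cst
  | univ => exact fun _ => .univ
  | pi _ _ hA hB => exact fun H => .pi (hA H) (hB (up _ H))
  | lam _ _ hA ht => exact fun H => .lam (hA H) (ht (up _ H))
  | app _ _ hf ha => intro Δ σ H; rw [inst_subst]; exact .app (hf H) (ha H)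
  | conv _ c _ ht hB => exact fun H => .conv (ht H) (c.subst _) (hB H)
  | cumul _ h => exact fun H => .cumul (h H)

theorem HasType.inst {Γ : List Tm} {t A B a : Tm} (h : HasType (A :: Γ) t B) (ha : HasType Γ a A) :
    HasType Γ (t.inst a) (B.inst a) := by
  refine h.subst ?_
  rintro (_ | n) C hC
  · obtain rfl : A = C := by simpa using hC
    have := inst_lift A a
    rw [Tm.inst] at this
    rw [this]; exact ha
  · rw [← lift_lift C (n + 1) 1]
    have := inst_lift (C.lift (n + 1)) a
    rw [Tm.inst] at this
    rw [this]; exact .var (by simpa using hC)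

/-- `A` is a type in the context `Γ`. -/
def IsType (Γ : List Tm) (A : Tm) : Prop := ∃ i, HasType Γ A (.univ i)

/-- The rules `conv` and `cumul` change only the type of the term, so a derivation for a function
type goes back to the rule `pi`. -/
theorem HasType.of_pi {Γ : List Tm} {A B T : Tm} (h : HasType Γ (.pi A B) T) :
    IsType Γ A ∧ IsType (A :: Γ) B := by
  generalize ht : Tm.pi A B = t at h
  induction h with
  | var | cst | univ | lam | app => cases ht
  | pi hA hB => cases ht; exact ⟨⟨_, hA⟩, _, hB⟩
  | conv _ _ _ h _ => exact h ht
  | cumul _ h => exact h ht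

theorem HasType.cumul_le {Γ : List Tm} {A : Tm} {i j : ℕ} (h : HasType Γ A (.univ i))
    (hij : i ≤ j) : HasType Γ A (.univ j) := by
  induction hij with
  | refl => exact h
  | step _ ih => exact ih.cumul

end HoTT

namespace HoTT
open Tm

/-! ### Decidable equality and efficient substitution -/

/-- All constants, in the order of their declaration. -/
def Cst.all : List Cst :=
  [.empty, .emptyInd, .unit, .star, .unitInd, .bool, .ff, .tt, .boolInd, .nat, .zero, .suc, .natInd,
    .sum, .inl, .inr, .sumInd, .sig, .pair, .sigInd, .eq, .refl, .eqInd, .funext, .univalence,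
    .trunc, .tr, .squash, .truncInd, .brw, .le, .bzero, .bsucc, .blimit, .bisim, .brwSet, .leZero,
    .leTrans, .leSuccMono, .leCocone, .leLimiting, .leProp, .brwInd, .leInd]

/-- Lets `beq` compare constants as natural numbers. The list `Cst.all` supplies a left inverse of
the index. -/
theorem Cst.ctorIdx_injective {c c' : Cst} (h : c.ctorIdx = c'.ctorIdx) : c = c' := by
  have key (c : Cst) : Cst.all[c.ctorIdx]? = some c := by cases c <;> rfl
  exact Option.some.inj ((key c).symm.trans (h ▸ key c'))

namespace Tm

def beq : Tm → Tm → Bool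
  | var n, u => match u with
    | var m => Nat.beq n m
    | _ => false
  | cst c, u => match u with
    | cst c' => Nat.beq c.ctorIdx c'.ctorIdx
    | _ => false
  | univ i, u => match u with
    | univ j => Nat.beq i j
    | _ => false
  | pi A B, u => match u with
    | pi A' B' => A.beq A' && B.beq B'
    | _ => false
  | lam t, u => match u with
    | lam t' => t.beq t'
    | _ => false
  | app f a, u => match u with
    | app f' a' => f.beq f' && a.beq a'
    | _ => false

theorem eq_of_beq : ∀ {t u : Tm}, t.beq u = true → t = u := by
  intro t
  induction t with
  | var n => rintro ⟨⟩ h <;> simp_all [beq]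
  | cst c =>
    rintro ⟨⟩ h <;> simp only [beq, Bool.false_eq_true] at h
    rw [Cst.ctorIdx_injective (Nat.eq_of_beq_eq_true h)]
  | univ n => rintro ⟨⟩ h <;> simp_all [beq]
  | pi A B hA hB =>
    rintro ⟨⟩ h <;> simp only [beq, Bool.and_eq_true, Bool.false_eq_true] at h
    rw [hA h.1, hB h.2]
  | lam t ih =>
    rintro ⟨⟩ h <;> simp only [beq, Bool.false_eq_true] at h
    rw [ih h]
  | app f a hf ha =>
    rintro ⟨⟩ h <;> simp only [beq, Bool.and_eq_true, Bool.false_eq_true] at h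
    rw [hf h.1, ha h.2]

/-- Weakening by `k` variables below `c` bound variables. -/
def liftAt (k : ℕ) : ℕ → Tm → Tm
  | c, var n => var (cond (Nat.ble c n) (Nat.add n k) n)
  | _, cst a => cst a
  | _, univ i => univ i
  | c, pi A B => pi (liftAt k c A) (liftAt k (.succ c) B)
  | c, lam t => lam (liftAt k (.succ c) t)
  | c, app f a => app (liftAt k c f) (liftAt k c a)

theorem liftAt_eq (k : ℕ) (t : Tm) : ∀ c, liftAt k c t = t.rename (upRen^[c] fun n => n + k) := by
  have key (c n : ℕ) : upRen^[c] (fun n => n + k) n = cond (Nat.ble c n) (n + k) n := by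
    induction c generalizing n with
    | zero => cases n <;> rfl
    | succ c ih =>
      rw [Function.iterate_succ_apply']
      cases n with
      | zero => rfl
      | succ n =>
        have h : Nat.ble (c + 1) (n + 1) = Nat.ble c n := rfl
        rw [upRen, ih, h]
        cases Nat.ble c n
        · rfl
        · exact Nat.add_right_comm n k 1
  induction t with
  | var n => intro c; simp only [liftAt, rename, key, Nat.add_eq]
  | cst | univ => intros; rfl
  | pi A B hA hB => intro c; simp only [liftAt, rename, hA, hB, Function.iterate_succ_apply']
  | lam t h => intro c; simp only [liftAt, rename, h, Function.iterate_succ_apply']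
  | app f a hf ha => intro c; simp only [liftAt, rename, hf, ha]

theorem liftAt_zero (k : ℕ) (t : Tm) : liftAt k 0 t = t.lift k := liftAt_eq k t 0

/-- Simultaneous instantiation of the last variables. -/
def instSub : List Tm → ℕ → Tm
  | [], n => var n
  | a :: as, n => Nat.casesOn n a fun n => instSub as n

/-- `instSub` under `d` binders; `m` is the index minus `d`. -/
def instVar (d : ℕ) : List Tm → ℕ → Tm
  | [], m => var (Nat.add m d)
  | a :: as, m => Nat.casesOn m (Nat.casesOn d a fun _ => liftAt d 0 a) fun m => instVar d as m

/-- Instantiation of the variables from `d` on. -/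
def instAt (as : List Tm) : ℕ → Tm → Tm
  | d, var n => cond (Nat.ble d n) (instVar d as (Nat.sub n d)) (var n)
  | _, cst c => cst c
  | _, univ i => univ i
  | d, pi A B => pi (instAt as d A) (instAt as (.succ d) B)
  | d, lam t => lam (instAt as (.succ d) t)
  | d, app f b => app (instAt as d f) (instAt as d b)

theorem instVar_eq (d : ℕ) (as : List Tm) : ∀ m, instVar d as m = (instSub as m).lift d := by
  induction as with
  | nil => intro m; rfl
  | cons a as ih =>
    rintro (_ | m)
    · cases d with
      | zero => exact a.lift_zero.symm
      | succ d => exact liftAt_zero _ a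
    · exact ih m

/-- Connects the evaluation-friendly instantiation, which carries the depth and lifts only at
variables, with the substitution used in the typing rules. -/
theorem instAt_eq (as : List Tm) (t : Tm) : ∀ d, instAt as d t = t.subst (upSub^[d] (instSub as)) :=
    by
  have key (d n : ℕ) : upSub^[d] (instSub as) n = instAt as d (var n) := by
    induction d generalizing n with
    | zero =>
      have h : Nat.ble 0 n = true := Nat.ble_eq_true_of_le (Nat.zero_le n)
      rw [instAt, h, cond, instVar_eq, lift_zero]; rfl
    | succ d ih =>
      rw [Function.iterate_succ_apply']
      cases n with
      | zero => rfl
      | succ n =>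
        have h1 : Nat.ble (d + 1) (n + 1) = Nat.ble d n := rfl
        rw [upSub, ih, instAt, instAt, h1]
        cases Nat.ble d n with
        | true =>
          have h2 : Nat.sub (n + 1) (d + 1) = Nat.sub n d := Nat.succ_sub_succ n d
          simp only [cond, instVar_eq, h2, lift_lift]
        | false => rfl
  induction t with
  | var n => intro d; rw [subst, key]
  | cst | univ => intros; rfl
  | pi A B hA hB => intro c; simp only [instAt, subst, hA, hB, Function.iterate_succ_apply']
  | lam t h => intro c; simp only [instAt, subst, h, Function.iterate_succ_apply']
  | app f a hf ha => intro c; simp only [instAt, subst, hf, ha]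

theorem instAt_nil (t : Tm) : instAt [] 0 t = t :=
  (instAt_eq [] t 0).trans t.subst_var

/-- Justifies delaying substitutions: arguments are collected in a list and instantiated in one
traversal, although the typing and conversion rules instantiate them one at a time. -/
theorem instAt_cons (a : Tm) (as : List Tm) (t : Tm) :
    instAt (a :: as) 0 t = (instAt as 1 t).inst a := by
  rw [instAt_eq, instAt_eq, inst, subst_subst]
  congr 1; funext n
  cases n with
  | zero => rfl
  | succ n => exact (inst_lift _ _).symm

theorem instAt_singleton (a t : Tm) : instAt [a] 0 t = t.inst a := by
  rw [instAt_cons, instAt_eq]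
  have : upSub^[1] (instSub []) = var := upSub_var
  rw [this, subst_var]

/-! ### Normalization -/

/-- Unwinding of iterated applications. -/
def spine : Tm → List Tm → Tm × List Tm
  | app f a, as => spine f (a :: as)
  | t, as => (t, as)

theorem foldl_spine (t : Tm) : ∀ as, (spine t as).2.foldl app (spine t as).1 = as.foldl app t := by
  induction t with
  | app f a hf => intro as; exact hf _
  | _ => intros; rfl

theorem app_of_spine {f a h : Tm} {as : List Tm} (hs : spine f [a] = (h, as)) :
    app f a = as.foldl app h := by
  have := foldl_spine f [a]
  rw [hs] at this
  exact this.symm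

/-- The right-hand side of the computation rule for trees at limits. -/
def brwLimitRhs (B C hB hC z s l b m1 m2 m3 m4 m5 F : Tm) : Tm :=
  let ms : List Term := [B, C, hB, hC, z, s, l, b, m1, m2, m3, m4, m5].map .raw
  let f : Term := fn (.raw F)
  let p : Term := seqIncr Brw lt (.raw F)
  (Term.raw l (.raw F) (Lam fun k => apList .brwInd ms (f k))
    (Lam fun k => apList .leInd ms (bsucc (f k)) (f (S k)) (p k))).close

/-- The computation rules of the eliminators. -/
def iota : Cst → List Tm → Option Tm
  | .unitInd, [_, d, cst .star] => some d
  | .boolInd, [_, d, e, x] => match x with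
    | cst .ff => some d
    | cst .tt => some e
    | _ => none
  | .natInd, [P, d, e, x] => match x with
    | cst .zero => some d
    | app (cst .suc) n => some (app (app e n) (ap .natInd [P, d, e, n]))
    | _ => none
  | .sumInd, [_, _, _, d, e, x] => match x with
    | app (app (app (cst .inl) _) _) a => some (app d a)
    | app (app (app (cst .inr) _) _) b => some (app e b)
    | _ => none
  | .sigInd, [_, _, _, d, x] => match x with
    | app (app (app (app (cst .pair) _) _) a) b => some (app (app d a) b)
    | _ => none
  | .eqInd, [_, _, d, _, _, x] => match x with
    | app (app (cst .refl) _) z => some (app d z)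
    | _ => none
  | .truncInd, [_, _, _, d, x] => match x with
    | app (app (cst .tr) _) a => some (app d a)
    | _ => none
  | .brwInd, [B, C, hB, hC, z, s, l, b, m1, m2, m3, m4, m5, x] => match x with
    | cst .bzero => some z
    | app (cst .bsucc) x =>
      some (app (app s x) (ap .brwInd [B, C, hB, hC, z, s, l, b, m1, m2, m3, m4, m5, x]))
    | app (cst .blimit) F => some (brwLimitRhs B C hB hC z s l b m1 m2 m3 m4 m5 F)
    | _ => none
  | _, _ => none

/-- The branches correspond one by one to computation rules of `Conv`; as in those rules, the
parameters of a constructor need not agree with those of the eliminator. -/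
theorem conv_of_iota {c : Cst} {as : List Tm} {t : Tm} (h : iota c as = some t) :
    Conv (ap c as) t := by
  unfold iota at h
  split at h <;> (try split at h) <;> cases h
  · exact .unit
  · exact .boolFF
  · exact .boolTT
  · exact .natZero
  · exact .natSuc
  · exact .sumInl
  · exact .sumInr
  · exact .sig
  · exact .eq
  · exact .trunc
  · exact .brwZero
  · exact .brwSucc
  · exact .brwLimit

/-- The number of arguments of an eliminator before its target. -/
def arity : Cst → Option ℕ
  | .unitInd => some 2
  | .boolInd | .natInd => some 3
  | .sumInd => some 5
  | .sigInd | .truncInd => some 4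
  | .eqInd => some 5
  | .brwInd => some 13
  | _ => none

/-- Splitting of a list into the first `n` members, the next one, and the rest. -/
def splitAt : ℕ → List Tm → Option (List Tm × Tm × List Tm)
  | _, [] => none
  | n, a :: as => Nat.casesOn n (some ([], a, as)) fun n =>
    match splitAt n as with
    | some (bs, b, cs) => some (a :: bs, b, cs)
    | none => none

theorem of_splitAt {n : ℕ} {as bs cs : List Tm} {b : Tm} (h : splitAt n as = some (bs, b, cs)) :
    as = bs ++ b :: cs := by
  induction as generalizing n bs with
  | nil => cases n <;> cases h
  | cons a as ih =>
    cases n with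
    | zero => cases h; rfl
    | succ n =>
      dsimp only [splitAt] at h
      split at h
      case h_1 bs b cs hs => cases h; rw [ih hs]; rfl
      case h_2 => cases h

/-- Application of a term to arguments. -/
def apps : Tm → List Tm → Tm
  | f, [] => f
  | f, a :: as => apps (app f a) as

/-- Contraction of the beta redexes at the head, where the last variables stand for `σ`. -/
def betas (σ : List Tm) : Tm → List Tm → Tm
  | t, [] => instAt σ 0 t
  | t, a :: as => match t with
    | lam t => betas (a :: σ) t as
    | t => apps (instAt σ 0 t) (a :: as)

/-- Reduction of an eliminator applied to arguments, where `t` is the whole term. -/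
def whnfElim (wh : Tm → Tm) (t : Tm) (c : Cst) (as : List Tm) : Tm :=
  match arity c with
  | some n => match splitAt n as with
    | some (bs, b, cs) => match iota c (bs ++ [wh b]) with
      | some t => wh (apps t cs)
      | none => t
    | none => t
  | none => t

/-- One layer of reduction to weak head normal form. -/
def whnfStep (wh : Tm → Tm) : Tm → Tm
  | app f a => match spine f [a] with
    | (lam t, as) => wh (betas [] (lam t) as)
    | (cst c, as) => whnfElim wh (app f a) c as
    | _ => app f a
  | t => t

theorem apps_eq (f : Tm) (as : List Tm) : apps f as = as.foldl app f := by
  induction as generalizing f with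
  | nil => rfl
  | cons a as ih => exact ih _

theorem conv_foldl {f g : Tm} (h : Conv f g) (as : List Tm) :
    Conv (as.foldl app f) (as.foldl app g) := by
  induction as generalizing f g with
  | nil => exact h
  | cons a as ih => exact ih (h.app .rfl)

theorem conv_betas (as : List Tm) : ∀ σ t, Conv (as.foldl app (instAt σ 0 t)) (betas σ t as) := by
  induction as with
  | nil => exact fun _ _ => .rfl
  | cons a as ih =>
    intro σ t
    unfold betas
    split
    case h_1 t =>
      -- One beta step on the partially instantiated abstraction moves `a` into the list of pending
      -- arguments.
      refine (conv_foldl .beta as).trans ?_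
      rw [← instAt_cons]; exact ih _ _
    case h_2 => rw [apps_eq]; exact .rfl

theorem conv_whnfElim {wh : Tm → Tm} (hwh : ∀ t, Conv t (wh t)) (c : Cst) (as : List Tm) :
    Conv (as.foldl app (cst c)) (whnfElim wh (as.foldl app (cst c)) c as) := by
  unfold whnfElim
  split
  · split
    case h_1 bs b cs hs =>
      split
      case h_1 t ht =>
        have h1 := conv_of_iota ht
        rw [ap, List.foldl_append] at h1
        rw [of_splitAt hs, List.foldl_append, List.foldl_cons]
        refine (conv_foldl (Conv.trans (.app .rfl (hwh b)) h1) cs).trans ?_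
        rw [← apps_eq]; exact hwh _
      case h_2 => exact .rfl
    case h_2 => exact .rfl
  · exact .rfl

/-- Reduction to weak head normal form with recursion depth at most `n`. -/
def whnf : ℕ → Tm → Tm
  | 0 => id
  | n + 1 => whnfStep (whnf n)

/-- Only soundness is needed: when the depth is exhausted the term is returned unchanged, which is
still convertible to itself. -/
theorem conv_whnf (n : ℕ) : ∀ t, Conv t (whnf n t) := by
  induction n with
  | zero => exact fun _ => .rfl
  | succ n ih =>
    intro t
    rw [whnf, whnfStep.eq_def]
    split
    case h_1 f a =>
      split
      case h_1 t as h =>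
        have := conv_betas as [] (lam t)
        rw [instAt_nil, ← app_of_spine h] at this
        exact this.trans (ih _)
      case h_2 c as h => rw [app_of_spine h]; exact conv_whnfElim ih c as
      case h_3 => exact .rfl
    · exact .rfl

/-- Convertibility of the members of two lists. -/
def convArgs (cv : Tm → Tm → Bool) : List Tm → List Tm → Bool
  | [], [] => true
  | a :: as, b :: bs => cond (cv a b) (convArgs cv as bs) false
  | _, _ => false

/-- Convertibility of terms in weak head normal form. -/
def convWhnf (cv : Tm → Tm → Bool) : Tm → Tm → Bool
  | pi A B, pi A' B' => cond (cv A A') (cv B B') false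
  | lam t, lam u => cv t u
  | lam t, u => cv t (app (liftAt 1 0 u) (var 0))
  | t, lam u => cv (app (liftAt 1 0 t) (var 0)) u
  | app f a, app g b => match spine f [a], spine g [b] with
    | (h, as), (k, bs) => cond (beq h k) (convArgs cv as bs) false
  | t, u => beq t u

/-- The convertibility check with recursion depth at most `n`. -/
def isConv (m : ℕ) : ℕ → Tm → Tm → Bool
  | 0, _, _ => false
  | n + 1, t, u => cond (beq t u) true (convWhnf (isConv m n) (whnf m t) (whnf m u))

theorem conv_of_cond {a b : Bool} (h : cond a b false = true) : a = true ∧ b = true := by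
  cases a
  · cases h
  · exact ⟨rfl, h⟩

theorem conv_of_convArgs {cv : Tm → Tm → Bool} (hcv : ∀ t u, cv t u = true → Conv t u)
    {as bs : List Tm} (h : convArgs cv as bs = true) :
    ∀ {f g : Tm}, Conv f g → Conv (as.foldl app f) (bs.foldl app g) := by
  induction as generalizing bs with
  | nil =>
    cases bs with
    | nil => exact id
    | cons => cases h
  | cons a as ih =>
    cases bs with
    | nil => cases h
    | cons b bs =>
      obtain ⟨h1, h2⟩ := conv_of_cond h
      exact fun hfg => ih h2 (hfg.app (hcv _ _ h1))

/-- An abstraction is compared with any other term by eta expansion of the latter. Applications are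
compared by their heads, syntactically, and their arguments, up to conversion. -/
theorem conv_of_convWhnf {cv : Tm → Tm → Bool} (hcv : ∀ t u, cv t u = true → Conv t u)
    {t u : Tm} (h : convWhnf cv t u = true) : Conv t u := by
  unfold convWhnf at h
  split at h
  · obtain ⟨h1, h2⟩ := conv_of_cond h
    exact .pi (hcv _ _ h1) (hcv _ _ h2)
  · exact .lam (hcv _ _ h)
  · rw [liftAt_zero] at h
    exact (Conv.lam (hcv _ _ h)).trans .eta
  · rw [liftAt_zero] at h
    exact .trans (.symm .eta) (Conv.lam (hcv _ _ h))
  · split at h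
    case h_1 hs k bs hk hs' =>
      obtain ⟨h1, h2⟩ := conv_of_cond h
      rw [app_of_spine hk, app_of_spine hs', eq_of_beq h1]
      exact conv_of_convArgs hcv h2 .rfl
  · exact eq_of_beq h ▸ .rfl

theorem conv_of_isConv {m n : ℕ} : ∀ t u, isConv m n t u = true → Conv t u := by
  induction n with
  | zero => intro t u h; cases h
  | succ n ih =>
    intro t u h
    rw [isConv] at h
    cases hb : beq t u with
    | true => exact eq_of_beq hb ▸ .rfl
    | false =>
      rw [hb] at h
      exact (conv_whnf m t).trans ((conv_of_convWhnf ih h).trans (conv_whnf m u).symm)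

end Tm

/-! ### Type checking -/

/-- A bound for the depth of recursion. -/
def depth : ℕ := 10000

/-- Convertibility of types up to cumulativity. -/
def isSub (A B : Tm) : Bool :=
  cond (beq A B) true <|
    match whnf depth A, whnf depth B with
    | univ i, univ j => Nat.ble i j
    | A', B' => isConv depth depth A' B'

theorem HasType.of_isSub {Γ : List Tm} {t A B : Tm} (ht : HasType Γ t A) (hB : IsType Γ B)
    (h : isSub A B = true) : HasType Γ t B := by
  obtain ⟨k, hB⟩ := hB
  rw [isSub] at h
  cases hb : beq A B with
  | true => exact eq_of_beq hb ▸ ht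
  | false =>
    rw [hb, cond] at h
    have hA := conv_whnf depth A
    have hB' := conv_whnf depth B
    split at h
    case h_1 i j hi hj =>
      rw [hi] at hA; rw [hj] at hB'
      -- Cumulativity enters only here, between types that reduce to universes.
      exact ((ht.conv hA .univ).cumul_le (Nat.le_of_ble_eq_true h)).conv hB'.symm hB
    case h_2 => exact ht.conv (hA.trans ((conv_of_isConv _ _ h).trans hB'.symm)) hB

/-- A context all of whose entries are types. -/
def WellFormed (Γ : List Tm) : Prop := ∀ n (A : Tm), Γ[n]? = some A → IsType Γ (A.lift (n + 1))

theorem IsType.weaken {Γ : List Tm} {A : Tm} (B : Tm) (h : IsType Γ A) :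
    IsType (B :: Γ) (A.lift 1) :=
  ⟨_, h.choose_spec.weaken B⟩

theorem WellFormed.cons {Γ : List Tm} {A : Tm} (h : WellFormed Γ) (hA : IsType Γ A) :
    WellFormed (A :: Γ) := by
  rintro (_ | n) B hB
  · obtain rfl : A = B := by simpa using hB
    exact hA.weaken _
  · rw [← lift_lift B (n + 1) 1]
    exact (h n B (by simpa using hB)).weaken _

/-- A pair of algorithms for type inference and type checking. -/
structure Checker where
  infer : List Tm → Tm → Option Tm
  check : List Tm → Tm → Tm → Bool

/-- The bidirectional contract: inference guarantees that its result is a type, while checking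
presupposes this of the type it is given. -/
structure Checker.Sound (C : Checker) : Prop where
  infer {Γ : List Tm} {t T : Tm} :
    WellFormed Γ → C.infer Γ t = some T → HasType Γ t T ∧ IsType Γ T
  check {Γ : List Tm} {t T : Tm} :
    WellFormed Γ → IsType Γ T → C.check Γ t T = true → HasType Γ t T

namespace Checker

variable (C : Checker) (table : Cst → List Tm)

/-- The universe level of a type. -/
def sort (Γ : List Tm) (A : Tm) : Option ℕ :=
  match C.infer Γ A with
  | some T => match whnf depth T with
    | univ i => some i
    | _ => none
  | none => none

/-- Domain and codomain of a type that is convertible to a function type. -/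
def asPi (Γ : List Tm) (T : Tm) : Option (Tm × Tm) :=
  match T with
  | pi A B => some (A, B)
  | T => match whnf depth T with
    | pi A B => match C.sort Γ (pi A B) with
      | some _ => some (A, B)
      | none => none
    | _ => none

/-- The type at position `n` of a context. -/
def lookup : List Tm → ℕ → Option Tm
  | [], _ => none
  | A :: Γ, n => Nat.casesOn n (some A) fun n => lookup Γ n

/-- The type of `t` applied to the arguments `as`, where `t` has the type `T`, in which the last
variables stand for `σ`. -/
def inferArgs (Γ : List Tm) : List Tm → List Tm → Tm → Option Tm
  | [], σ, T => some (instAt σ 0 T)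
  | a :: as, σ, T => match T with
    | pi A B => cond (C.check Γ a (instAt σ 0 A)) (inferArgs Γ as (a :: σ) B) none
    | T => match C.asPi Γ (instAt σ 0 T) with
      | some (A, B) => cond (C.check Γ a A) (inferArgs Γ as [a] B) none
      | none => none

/-- The first success of `inferArgs` for a list of types. -/
def inferFirst (Γ as : List Tm) : List Tm → Option Tm
  | [] => none
  | T :: Ts => match C.inferArgs Γ as [] T with
    | some T' => some T'
    | none => inferFirst Γ as Ts

/-- The type of `t`, where the domains of the abstractions at its head are taken from the
arguments `as`, which have to be lifted by `k`. -/
def inferHead : ℕ → List Tm → List Tm → Tm → Option Tm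
  | _, Γ, [], t => C.infer Γ t
  | k, Γ, a :: as, t => match t with
    | lam t => match C.infer Γ (liftAt k 0 a) with
      | some A => match inferHead (.succ k) (A :: Γ) as t with
        | some B => some (pi A B)
        | none => none
      | none => none
    | t => C.infer Γ t

/-- One layer of type inference. As the levels of the constants are ambiguous, their types are tried
one after the other. -/
def inferStep (Γ : List Tm) : Tm → Option Tm
  | var n => match lookup Γ n with
    | some A => some (liftAt (.succ n) 0 A)
    | none => none
  | cst c => C.inferFirst Γ [] (table c)
  | univ i => some (univ (.succ i))
  | pi A B => match C.sort Γ A with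
    | some i => match C.sort (A :: Γ) B with
      | some j => some (univ (cond (Nat.ble i j) j i))
      | none => none
    | none => none
  | lam _ => none
  | app f a => match spine f [a] with
    | (cst c, as) => C.inferFirst Γ as (table c)
    | (h, as) => match C.inferHead 0 Γ as h with
      | some T => C.inferArgs Γ as [] T
      | none => none

/-- One layer of type checking. -/
def checkStep (Γ : List Tm) (t T : Tm) : Bool :=
  match t with
  | lam t => match C.asPi Γ T with
    | some (A, B) => C.check (A :: Γ) t B
    | none => false
  | t => match C.infer Γ t with
    | some T' => isSub T' T
    | none => false

/-- The type checker with recursion depth at most `n`. -/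
def ofDepth : ℕ → Checker
  | 0 => ⟨fun _ _ => none, fun _ _ _ => false⟩
  | n + 1 => ⟨inferStep (ofDepth n) table, checkStep (ofDepth n)⟩

variable {C table}

theorem Sound.sort (h : C.Sound) {Γ : List Tm} {A : Tm} {i : ℕ} (hΓ : WellFormed Γ)
    (hi : C.sort Γ A = some i) : HasType Γ A (univ i) := by
  unfold Checker.sort at hi
  split at hi
  case h_1 T hT =>
    split at hi
    case h_1 j hj => cases hi; exact (h.infer hΓ hT).1.conv (hj ▸ conv_whnf _ _) .univ
    case h_2 => cases hi
  case h_2 => cases hi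

/-- A weak head normal form is known to be convertible to `T` but not to be well typed, as subject
reduction is not established. This is why `asPi` infers a sort for it afresh. -/
theorem Sound.asPi (h : C.Sound) {Γ : List Tm} {T A B : Tm} (hΓ : WellFormed Γ)
    (hT : IsType Γ T) (hAB : C.asPi Γ T = some (A, B)) :
    Conv T (pi A B) ∧ IsType Γ (pi A B) := by
  unfold Checker.asPi at hAB
  split at hAB
  · cases hAB; exact ⟨.rfl, hT⟩
  · split at hAB
    case h_1 A' B' hnf =>
      split at hAB
      case h_1 i hi => cases hAB; exact ⟨hnf ▸ conv_whnf _ _, i, h.sort hΓ hi⟩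
      case h_2 => cases hAB
    case h_2 => cases hAB

theorem of_lookup {Γ : List Tm} {n : ℕ} {A : Tm} (h : lookup Γ n = some A) : Γ[n]? = some A := by
  induction Γ generalizing n with
  | nil => cases h
  | cons B Γ ih =>
    cases n with
    | zero => exact h
    | succ n => exact ih h

/-- The invariant is that the applied head has the type `T` with the pending arguments `σ`
instantiated. Consuming a further argument is the application rule together with `instAt_cons`. -/
theorem Sound.inferArgs (h : C.Sound) {Γ : List Tm} (hΓ : WellFormed Γ) {as : List Tm} :
    ∀ {σ : List Tm} {f T T' : Tm}, HasType Γ f (instAt σ 0 T) → IsType Γ (instAt σ 0 T) →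
      C.inferArgs Γ as σ T = some T' → HasType Γ (as.foldl app f) T' ∧ IsType Γ T' := by
  induction as with
  | nil =>
    intro σ f T T' hf hT hT'
    cases hT'
    exact ⟨hf, hT⟩
  | cons a as ih =>
    have key {f A B : Tm} {σ : List Tm} {T' : Tm} (hf : HasType Γ f (pi A (instAt σ 1 B)))
        (hT : IsType Γ (pi A (instAt σ 1 B)))
        (hT' : cond (C.check Γ a A) (C.inferArgs Γ as (a :: σ) B) none = some T') :
        HasType Γ ((a :: as).foldl app f) T' ∧ IsType Γ T' := by
      obtain ⟨hA, j, hB⟩ := hT.choose_spec.of_pi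
      cases hca : C.check Γ a A with
      | false => rw [hca] at hT'; cases hT'
      | true =>
        rw [hca] at hT'
        have ha := h.check hΓ hA hca
        refine ih ?_ ⟨j, ?_⟩ hT' <;> rw [instAt_cons]
        · exact .app hf ha
        · exact hB.inst ha
    intro σ f T T' hf hT hT'
    unfold Checker.inferArgs at hT'
    split at hT'
    case h_1 A B => exact key hf hT hT'
    case h_2 =>
      split at hT'
      case h_1 A B hAB =>
        obtain ⟨hc, k, hpi⟩ := h.asPi hΓ hT hAB
        have hB : instAt [] 1 B = B := by
          rw [instAt_eq]; exact (congrArg (fun σ => Tm.subst σ B) upSub_var).trans B.subst_var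
        refine key (σ := []) (B := B) ?_ ?_ hT' <;> rw [hB]
        · exact hf.conv hc hpi
        · exact ⟨k, hpi⟩
      case h_2 => cases hT'

theorem Sound.inferFirst (h : C.Sound) {Γ : List Tm} (hΓ : WellFormed Γ) {as Ts : List Tm}
    {f T' : Tm} (hf : ∀ T ∈ Ts, HasType Γ f T ∧ IsType Γ T)
    (hT' : C.inferFirst Γ as Ts = some T') : HasType Γ (as.foldl app f) T' ∧ IsType Γ T' := by
  induction Ts with
  | nil => cases hT'
  | cons T Ts ih =>
    unfold Checker.inferFirst at hT'
    split at hT'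
    case h_1 T'' hT'' =>
      cases hT'
      have hfT := hf T (.head _)
      refine h.inferArgs (f := f) hΓ ?_ ?_ hT'' <;> rw [instAt_nil]
      · exact hfT.1
      · exact hfT.2
    case h_2 => exact ih (fun T hT => hf T (.tail _ hT)) hT'

/-- Abstractions carry no domains, so a beta redex takes the domain from the inferred type of its
argument; `k` counts the binders that have been crossed. -/
theorem Sound.inferHead (h : C.Sound) {as : List Tm} : ∀ {k : ℕ} {Γ : List Tm} {t T : Tm},
    WellFormed Γ → C.inferHead k Γ as t = some T → HasType Γ t T ∧ IsType Γ T := by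
  induction as with
  | nil => exact h.infer
  | cons a as ih =>
    intro k Γ t T hΓ hT
    unfold Checker.inferHead at hT
    split at hT
    case h_1 t =>
      split at hT
      case h_1 A hA =>
        split at hT
        case h_1 B hB =>
          cases hT
          obtain ⟨-, i, hA⟩ := h.infer hΓ hA
          obtain ⟨ht, j, hB⟩ := ih (hΓ.cons ⟨i, hA⟩) hB
          exact ⟨.lam hA ht, max i j, .pi (hA.cumul_le (le_max_left i j))
            (hB.cumul_le (le_max_right i j))⟩
        case h_2 => cases hT
      case h_2 => cases hT
    case h_2 => exact h.infer hΓ hT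

theorem Sound.step (h : C.Sound)
    (ht : ∀ Γ c, ∀ T ∈ table c, HasType Γ (cst c) T ∧ IsType Γ T) :
    Checker.Sound ⟨C.inferStep table, C.checkStep⟩ where
  infer {Γ t T} hΓ hT := by
    dsimp only at hT
    unfold inferStep at hT
    split at hT
    case h_1 n =>
      split at hT
      case h_1 A hA =>
        cases hT
        rw [liftAt_zero]
        exact ⟨.var (of_lookup hA), hΓ _ _ (of_lookup hA)⟩
      case h_2 => cases hT
    case h_2 c => exact h.inferFirst (f := cst c) hΓ (ht Γ c) hT
    case h_3 i => cases hT; exact ⟨.univ, _, .univ⟩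
    case h_4 A B =>
      split at hT
      case h_1 i hi =>
        have hA := h.sort hΓ hi
        split at hT
        case h_1 j hj =>
          have hB := h.sort (hΓ.cons ⟨_, hA⟩) hj
          cases hT
          refine ⟨?_, _, .univ⟩
          cases hij : Nat.ble i j with
          | true => exact .pi (hA.cumul_le (Nat.le_of_ble_eq_true hij)) hB
          | false =>
            have : ¬ i ≤ j := fun h => by rw [Nat.ble_eq_true_of_le h] at hij; cases hij
            exact .pi hA (hB.cumul_le (Nat.le_of_not_le this))
        case h_2 => cases hT
      case h_2 => cases hT
    case h_5 => cases hT
    case h_6 f a =>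
      split at hT
      case h_1 c as hsp =>
        rw [app_of_spine hsp]
        exact h.inferFirst (f := cst c) hΓ (ht Γ c) hT
      case h_2 t as _ hsp =>
        rw [app_of_spine hsp]
        split at hT
        case h_1 T' hT' =>
          obtain ⟨hf, hT'⟩ := h.inferHead hΓ hT'
          refine h.inferArgs (f := t) hΓ ?_ ?_ hT <;> rw [instAt_nil]
          · exact hf
          · exact hT'
        case h_2 => cases hT
  check {Γ t T} hΓ hT hc := by
    dsimp only at hc
    unfold checkStep at hc
    split at hc
    case h_1 t =>
      split at hc
      case h_1 A B hAB =>
        obtain ⟨hconv, k, hpi⟩ := h.asPi hΓ hT hAB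
        obtain ⟨⟨i, hA⟩, hB⟩ := hpi.of_pi
        obtain ⟨j, hT⟩ := hT
        exact (HasType.lam hA (h.check (hΓ.cons ⟨i, hA⟩) hB hc)).conv hconv.symm hT
      case h_2 => cases hc
    case h_2 =>
      split at hc
      case h_1 T' hT' => exact (h.infer hΓ hT').1.of_isSub hT hc
      case h_2 => cases hc

theorem sound_ofDepth (ht : ∀ Γ c, ∀ T ∈ table c, HasType Γ (cst c) T ∧ IsType Γ T) (n : ℕ) :
    (ofDepth table n).Sound := by
  induction n with
  | zero => exact ⟨nofun, nofun⟩
  | succ n ih => exact ih.step ht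

end Checker

end HoTT

/-! ### Well-formedness of the types of the constants -/

namespace HoTT
open Tm

theorem HasType.of_closed {t A : Tm} (h : HasType [] t A) (Γ : List Tm)
    (ht : t.closedAt 0 = true) (hA : A.closedAt 0 = true) : HasType Γ t A := by
  have := h.subst (Δ := Γ) (σ := Tm.var) nofun
  rwa [subst_of_closedAt ht nofun, subst_of_closedAt hA nofun] at this

/-- An enumeration of the constants in stages, such that the stage of a constant is larger than
those of the constants that occur in its type. -/
def Cst.stage : Cst → ℕ
  | empty | unit | bool | nat | sum | sig | eq | trunc | brw => 0
  | star | ff | tt | zero | suc | inl | inr | pair | refl | le | bzero | bsucc | tr => 1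
  | unitInd | emptyInd | boolInd | natInd | sumInd | sigInd | eqInd | squash | truncInd | brwSet
  | leProp | leZero | leTrans | leSuccMono => 2
  | funext | univalence | blimit => 3
  | bisim | leCocone | leLimiting => 4
  | brwInd => 5
  | leInd => 6

/-- The levels at which the constant `c` is used in the mode `m`; univalence is only used at level
zero, as its type mentions constants of the next level. -/
def Cst.levels (m : ℕ) : Cst → List ℕ
  | .univalence => [0]
  | _ => Nat.casesOn m [0] fun m => Nat.casesOn m [0, 1] fun _ => [1]

/-- The types of a constant in the mode `m`. -/
def Cst.types (m : ℕ) (c : Cst) : List Tm := (c.levels m).map fun i => (c.type i i).close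

/-- The types of the constants before stage `n`. -/
def Cst.typesBelow (n : ℕ) (c : Cst) : List Tm := cond (Nat.ble n c.stage) [] (c.types 1)

/-- The types of the constants of stage `n` are well-typed if the constants of smaller stages may be
used. -/
def stageCheck (n : ℕ) : Bool :=
  Cst.all.all fun c => cond (Nat.beq c.stage n)
    ((c.types 1).all fun A => ((Checker.ofDepth (Cst.typesBelow n) depth).sort [] A).isSome) true

theorem wellFormed_nil : WellFormed [] := fun _ _ h => by cases h

theorem Cst.mem_all (c : Cst) : c ∈ Cst.all := by
  have key : Cst.all[c.ctorIdx]? = some c := by cases c <;> rfl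
  exact List.mem_of_getElem? key

theorem Cst.hasType_of_mem_types {c : Cst} {m : ℕ} {T : Tm} (h : T ∈ c.types m) (Γ : List Tm) :
    HasType Γ (cst c) T := by
  obtain ⟨i, -, rfl⟩ := List.mem_map.mp h
  exact .cst

/-- Breaks a circle: soundness of the checker presupposes that the tabulated types of the constants
are types, and this is itself verified by the checker. The types of stage `n` are checked with a
table that offers only the constants of smaller stages. -/
theorem Cst.isType_of_mem_typesBelow {n : ℕ} (hn : ∀ k < n, stageCheck k = true) :
    ∀ Γ c, ∀ T ∈ Cst.typesBelow n c, HasType Γ (cst c) T ∧ IsType Γ T := by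
  induction n with
  | zero =>
    intro Γ c T hT
    have : Nat.ble 0 c.stage = true := Nat.ble_eq_true_of_le (Nat.zero_le _)
    rw [typesBelow, this] at hT; cases hT
  | succ n ih =>
    intro Γ c T hT
    replace ih := ih fun k hk => hn k (Nat.lt_succ_of_lt hk)
    have hT' : T ∈ c.types 1 ∧ c.stage < n + 1 := by
      rw [typesBelow] at hT
      cases h : Nat.ble (n + 1) c.stage with
      | true => rw [h] at hT; cases hT
      | false =>
        rw [h] at hT
        refine ⟨hT, lt_of_not_ge fun h' => ?_⟩
        rw [Nat.ble_eq_true_of_le h'] at h; cases h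
    refine ⟨hasType_of_mem_types hT'.1 Γ, ?_⟩
    rcases Nat.lt_succ_iff_lt_or_eq.mp hT'.2 with hc | hc
    · refine (ih Γ c T ?_).2
      have : Nat.ble n c.stage = false := by
        rw [Bool.eq_false_iff]; exact fun h => absurd (Nat.le_of_ble_eq_true h) (by omega)
      rw [typesBelow, this]; exact hT'.1
    · have key := List.all_eq_true.mp (hn n (Nat.lt_succ_self n)) c c.mem_all
      rw [hc, Nat.beq_refl] at key
      obtain ⟨i, hi⟩ := Option.isSome_iff_exists.mp (List.all_eq_true.mp key T hT'.1)
      have hty := (Checker.sound_ofDepth ih depth).sort wellFormed_nil hi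
      obtain ⟨l, -, rfl⟩ := List.mem_map.mp hT'.1
      exact ⟨i, hty.of_closed Γ (c.closedAt_type l l) rfl⟩

theorem stageCheck_eq_true : ∀ k < 7, stageCheck k = true := by
  decide +kernel

theorem Cst.isType_of_mem_types {m : ℕ} (Γ : List Tm) (c : Cst) (T : Tm) (hT : T ∈ c.types m) :
    HasType Γ (cst c) T ∧ IsType Γ T := by
  refine isType_of_mem_typesBelow stageCheck_eq_true Γ c T ?_
  -- The largest stage is 6, so the table below 7 contains every constant. The levels of each mode
  -- are among those of mode 1, for which the stages were checked.
  have h7 : Nat.ble 7 c.stage = false := by cases c <;> rfl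
  rw [typesBelow, h7]
  obtain ⟨i, hi, rfl⟩ := List.mem_map.mp hT
  exact List.mem_map.mpr ⟨i, by
    revert hi; rcases m with _ | _ | m <;> cases c <;> simp +contextual [levels], rfl⟩

/-- The type checker that uses the constants in the mode `m`. -/
def checker (m : ℕ) : Checker := .ofDepth (Cst.types m) depth

theorem checker_sound (m : ℕ) : (checker m).Sound :=
  Checker.sound_ofDepth Cst.isType_of_mem_types depth

/-! ### Contexts of theorems -/

/-- The context `Γ` is well formed and has an instance in the empty context: all of its entries are
theorems, or types of definable objects. -/
def Realized (Γ : List Tm) : Prop :=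
  WellFormed Γ ∧ ∃ σ : ℕ → Tm, ∀ n (A : Tm), Γ[n]? = some A →
    HasType [] (σ n) ((A.lift (n + 1)).subst σ)

theorem realized_nil : Realized [] := ⟨wellFormed_nil, Tm.var, nofun⟩

/-- Extension of a substitution. -/
def consSub (t : Tm) (σ : ℕ → Tm) : ℕ → Tm
  | 0 => t
  | n + 1 => σ n

theorem subst_consSub_lift (t A : Tm) (σ : ℕ → Tm) (n : ℕ) :
    (A.lift (n + 1)).subst (consSub t σ) = (A.lift n).subst σ := by
  simp only [lift, subst_rename]; rfl

theorem subst_consSub (t A : Tm) (σ : ℕ → Tm) :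
    A.subst (consSub (t.subst σ) σ) = (A.inst t).subst σ := by
  rw [inst, subst_subst]
  congr 1; funext n; cases n <;> rfl

theorem realizes_cons {Γ : List Tm} {σ : ℕ → Tm} {t A : Tm}
    (h : ∀ n (A : Tm), Γ[n]? = some A → HasType [] (σ n) ((A.lift (n + 1)).subst σ))
    (ht : HasType [] t (A.subst σ)) :
    ∀ n (B : Tm), (A :: Γ)[n]? = some B →
      HasType [] (consSub t σ n) ((B.lift (n + 1)).subst (consSub t σ)) := by
  rintro (_ | n) B hB <;> rw [subst_consSub_lift]
  · obtain rfl : A = B := by simpa using hB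
    rw [lift_zero]; exact ht
  · exact h n B (by simpa using hB)

/-- The check that `t` is an element of the type `A`. -/
def elemCheck (m : ℕ) (Γ : List Tm) (t A : Tm) : Bool :=
  ((checker m).sort Γ A).isSome && (checker m).check Γ t A

theorem hasType_of_elemCheck {m : ℕ} {Γ : List Tm} {t A : Tm} (hΓ : WellFormed Γ)
    (h : elemCheck m Γ t A = true) : HasType Γ t A ∧ IsType Γ A := by
  rw [elemCheck, Bool.and_eq_true] at h
  obtain ⟨i, hi⟩ := Option.isSome_iff_exists.mp h.1
  have hA : IsType Γ A := ⟨i, (checker_sound m).sort hΓ hi⟩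
  exact ⟨(checker_sound m).check hΓ hA h.2, hA⟩

/-- Extension by a theorem. -/
theorem Realized.extend {Γ : List Tm} (hΓ : Realized Γ) (m : ℕ) (t A : Tm)
    (h : elemCheck m Γ t A = true) : Realized (A :: Γ) := by
  obtain ⟨hw, σ, hσ⟩ := hΓ
  obtain ⟨ht, hA⟩ := hasType_of_elemCheck hw h
  exact ⟨hw.cons hA, _, realizes_cons hσ (ht.subst hσ)⟩

/-- Extension by an object `t` and a theorem about it, in which the definition of `t` may be used in
the proof. -/
theorem Realized.define {Γ : List Tm} (hΓ : Realized Γ) (m : ℕ) (t A u B : Tm)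
    (ht : elemCheck m Γ t A = true) (hB : ((checker m).sort (A :: Γ) B).isSome = true)
    (hu : (checker m).check Γ u (instAt [t] 0 B) = true) : Realized (B :: A :: Γ) := by
  obtain ⟨hw, σ, hσ⟩ := hΓ
  obtain ⟨ht, hA⟩ := hasType_of_elemCheck hw ht
  obtain ⟨i, hi⟩ := Option.isSome_iff_exists.mp hB
  have hB := (checker_sound m).sort (hw.cons hA) hi
  rw [instAt_singleton] at hu
  have hu := (checker_sound m).check hw ⟨i, hB.inst ht⟩ hu
  refine ⟨(hw.cons hA).cons ⟨i, hB⟩, _,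
    realizes_cons (t := u.subst σ) (realizes_cons hσ (ht.subst hσ)) ?_⟩
  rw [subst_consSub]; exact hu.subst hσ

/-- The instance of the context supplies a closed term at position `n`. Its type is an instance of
`A`, hence `A` itself, since a closed term is fixed by substitution. -/
theorem Realized.provable {Γ : List Tm} (hΓ : Realized Γ) {n : ℕ} {A : Term}
    (h : Γ[n]? = some A.close) (hA : (checker 0).sort [] A.close = some 0)
    (hc : A.close.closedAt 0 = true) : Provable A := by
  obtain ⟨-, σ, hσ⟩ := hΓ
  refine ⟨(checker_sound 0).sort wellFormed_nil hA, σ n, ?_⟩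
  have := hσ n _ h
  rwa [lift, rename_eq_subst, subst_of_closedAt hc nofun, subst_of_closedAt hc nofun] at this

end HoTT

namespace HoTT

/-! ### Proof terms

`Pf A` is a term that is meant to be an element of the type `A`. Nothing is claimed here: it is the
type checker that verifies this later. The index makes it possible to leave the arguments of
the constants and of the theorems implicit. -/

structure Pf (A : Term) : Type where
  tm : Term

namespace Pf

/-- Conversion, which is left to the type checker. -/
def cast {A B : Term} (p : Pf A) : Pf B := ⟨p.tm⟩

def lam {A : Term} {B : Term → Term} (f : ∀ x : Term, Pf (B x)) : Pf (Pi A B) :=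
  ⟨Lam fun x => (f x).tm⟩

def imp {A B : Term} (f : Pf A → Pf B) : Pf (Arr A B) := ⟨Lam fun x => (f ⟨x⟩).tm⟩

/-- Abstraction over an element of a type on which the codomain depends. -/
def lamPf {A : Term} {B : Term → Term} (f : ∀ x : Pf A, Pf (B x.tm)) : Pf (Pi A B) :=
  ⟨Lam fun x => (f ⟨x⟩).tm⟩

def app {A : Term} {B : Term → Term} (f : Pf (Pi A B)) (x : Term) : Pf (B x) := ⟨f.tm x⟩

def mp {A B : Term} (f : Pf (Arr A B)) (x : Pf A) : Pf B := ⟨f.tm x.tm⟩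

instance {A : Term} {B : Term → Term} : CoeFun (Pf (Pi A B)) fun _ => (x : Term) → Pf (B x) :=
  ⟨app⟩

instance {A B : Term} : CoeFun (Pf (Arr A B)) fun _ => Pf A → Pf B := ⟨mp⟩

instance {A : Term} : CoeFun (Pf (isProp A)) fun _ => (x y : Term) → Pf (Id A x y) :=
  ⟨fun h x y => ⟨h.tm x y⟩⟩

instance {A : Term} : CoeFun (Pf (isSet A)) fun _ => (x y : Term) → Pf (isProp (Id A x y)) :=
  ⟨fun h x y => ⟨h.tm x y⟩⟩

/-! #### Identity types -/

def refl {A : Term} (x : Term) : Pf (Id A x x) := ⟨K .refl A x⟩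

/-- Reflexivity for convertible terms. -/
def rfl {A x y : Term} : Pf (Id A x y) := ⟨K .refl A x⟩

def rw {A x y : Term} (P : Term → Term) (p : Pf (Id A x y)) (u : Pf (P x)) : Pf (P y) :=
  ⟨transport A P x y p.tm u.tm⟩

def symm {A x y : Term} (p : Pf (Id A x y)) : Pf (Id A y x) := rw (fun w => Id A w x) p (refl x)

def trans {A x y z : Term} (p : Pf (Id A x y)) (q : Pf (Id A y z)) : Pf (Id A x z) :=
  rw (fun w => Id A x w) q p

def congr {A B x y : Term} (f : Term → Term) (p : Pf (Id A x y)) : Pf (Id B (f x) (f y)) :=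
  rw (fun w => Id B (f x) (f w)) p (refl (f x))

/-- Path induction. -/
def pathInd {A : Term} (P : Term → Term → Term → Term) (d : ∀ x, Pf (P x x (K .refl A x)))
    {x y : Term} (p : Pf (Id A x y)) : Pf (P x y p.tm) :=
  ⟨K .eqInd A (Lam fun x => Lam fun y => Lam fun q => P x y q) (Lam fun x => (d x).tm) x y p.tm⟩

/-! #### Dependent pairs -/

def pair {A : Term} {B : Term → Term} (a : Term) (b : Pf (B a)) : Pf (Sig A B) :=
  ⟨K .pair A (Lam B) a b.tm⟩

def fst {A : Term} {B : Term → Term} (p : Pf (Sig A B)) : Term := HoTT.fst A B p.tm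

def snd {A : Term} {B : Term → Term} (p : Pf (Sig A B)) : Pf (B p.fst) := ⟨HoTT.snd A B p.tm⟩

def sigInd {A : Term} {B : Term → Term} (P : Term → Term)
    (d : ∀ a b, Pf (P (K .pair A (Lam B) a b))) (p : Term) : Pf (P p) :=
  ⟨K .sigInd A (Lam B) (Lam P) (Lam fun a => Lam fun b => (d a b).tm) p⟩

def and {A B : Term} (a : Pf A) (b : Pf B) : Pf (Prod A B) := pair (B := fun _ => B) a.tm b

def left {A B : Term} (p : Pf (Prod A B)) : Pf A := ⟨HoTT.fst A (fun _ => B) p.tm⟩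

def right {A B : Term} (p : Pf (Prod A B)) : Pf B := ⟨HoTT.snd A (fun _ => B) p.tm⟩

/-! #### Sums, the empty type and propositional truncation -/

def inl {A B : Term} (a : Pf A) : Pf (Sum A B) := ⟨K .inl A B a.tm⟩

def inr {A B : Term} (b : Pf B) : Pf (Sum A B) := ⟨K .inr A B b.tm⟩

def sumInd {A B : Term} (P : Term → Term) (f : ∀ a, Pf (P (K .inl A B a)))
    (g : ∀ b, Pf (P (K .inr A B b))) (p : Term) : Pf (P p) :=
  ⟨K .sumInd A B (Lam P) (Lam fun a => (f a).tm) (Lam fun b => (g b).tm) p⟩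

def elim {A B C : Term} (p : Pf (Sum A B)) (f : Pf A → Pf C) (g : Pf B → Pf C) : Pf C :=
  sumInd (A := A) (B := B) (fun _ => C) (fun a => f ⟨a⟩) (fun b => g ⟨b⟩) p.tm

def absurd {A : Term} (p : Pf (K .empty)) : Pf A := ⟨K .emptyInd (Lam fun _ => A) p.tm⟩

def natInd (P : Term → Term) (z : Pf (P (K .zero))) (s : ∀ n, Pf (P n) → Pf (P (S n)))
    (n : Term) : Pf (P n) :=
  ⟨K .natInd (Lam P) z.tm (Lam fun n => Lam fun h => (s n ⟨h⟩).tm) n⟩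

def boolInd (P : Term → Term) (f : Pf (P (K .ff))) (t : Pf (P (K .tt))) (b : Term) : Pf (P b) :=
  ⟨K .boolInd (Lam P) f.tm t.tm b⟩

def tr {A : Term} (a : Pf A) : Pf (Trunc A) := ⟨K .tr A a.tm⟩

def exI {A : Term} {B : Term → Term} (a : Term) (b : Pf (B a)) : Pf (Ex A B) := tr (pair a b)

end Pf

/-- Automatic proofs that a type is a proposition. -/
class IsProp (A : Term) where
  pf : Pf (isProp A)

namespace Pf

/-- Elimination of a truncation into a proposition. -/
def trElim {A C : Term} [IsProp C] (p : Pf (Trunc A)) (f : Pf A → Pf C) : Pf C :=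
  ⟨K .truncInd A (Lam fun _ => C) (Lam fun _ => (IsProp.pf (A := C)).tm)
    (Lam fun a => (f ⟨a⟩).tm) p.tm⟩

def exElim {A C : Term} {B : Term → Term} [IsProp C] (p : Pf (Ex A B))
    (f : ∀ x, Pf (B x) → Pf C) : Pf C :=
  trElim (A := Sig A B) p fun q => f q.fst q.snd

end Pf

instance {A : Term} {B : Term → Term} : IsProp (Ex A B) := ⟨⟨K .squash (Sig A B)⟩⟩
instance {x y : Term} : IsProp (le x y) := ⟨⟨K .leProp x y⟩⟩
instance {x y : Term} : IsProp (lt x y) := ⟨⟨K .leProp (bsucc x) y⟩⟩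
instance {x y : Term} : IsProp (Id Brw x y) := ⟨⟨K .brwSet x y⟩⟩
instance : IsProp (K .empty) := ⟨.lam fun x => .lam fun _ => .absurd ⟨x⟩⟩

namespace Pf

/-! #### The order of Brouwer trees -/

def leZero (x : Term) : Pf (le (K .bzero) x) := ⟨K .leZero x⟩

def leTrans {x y z : Term} (p : Pf (le x y)) (q : Pf (le y z)) : Pf (le x z) :=
  ⟨K .leTrans x y z p.tm q.tm⟩

def leSuccMono {x y : Term} (p : Pf (le x y)) : Pf (le (bsucc x) (bsucc y)) :=
  ⟨K .leSuccMono x y p.tm⟩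

def leCocone {x F : Term} (k : Term) (p : Pf (le x (fn F k))) : Pf (le x (blimit F)) :=
  ⟨K .leCocone x F k p.tm⟩

def leLimiting {F x : Term} (h : ∀ k, Pf (le (fn F k) x)) : Pf (le (blimit F) x) :=
  ⟨K .leLimiting F x (Lam fun k => (h k).tm)⟩

/-- The increasing sequence with members `f k`. -/
def seq (f : Term → Term) (h : ∀ k, Pf (lt (f k) (f (S k)))) : Term :=
  K .pair (Arr N Brw) (Lam (incr lt)) (Lam f) (Lam fun k => (h k).tm)

def seqIncr (F k : Term) : Pf (lt (fn F k) (fn F (S k))) := ⟨HoTT.seqIncr Brw lt F k⟩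

end Pf

end HoTT

namespace HoTT

/-! ### A library of theorems of homotopy type theory

Each theorem `foo` consists of its type `fooType`, a proof term `fooProof`, the context `fooCtx`
that extends the context of the preceding theorems by its type, the verification `foo_realized` of
the proof by the type checker, which the kernel evaluates, and the constant `fooConst` for its use
in later proofs. Definitions are theorems together with an object that they specify. -/

def emptyCtx : List Tm := []

theorem empty_realized : Realized emptyCtx := realized_nil

/-! ### Propositions and sets -/

namespace Pf

def funext {A f g : Term} {B : Term → Term} (h : ∀ x, Pf (Id (B x) (f x) (g x))) :
    Pf (Id (Pi A B) f g) :=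
  let e : Pf (isEquiv (Id (Pi A B) f g) (Pi A fun x => Id (B x) (f x) (g x)) (happly A B f g)) :=
    ⟨K .funext A (Lam B) f g⟩
  ⟨e.left.fst (Lam fun x => (h x).tm)⟩

def ua {A B : Term} (h : Pf (Equiv A B)) : Pf (Id (U 0) A B) :=
  let e : Pf (isEquiv (Id (U 0) A B) (Equiv A B) (idToEquiv 0 A B)) := ⟨K .univalence A B⟩
  ⟨e.left.fst h.tm⟩

def unitProp : Pf (isProp (K .unit)) :=
  ⟨K .unitInd (Lam fun x => Pi (K .unit) fun y => Id (K .unit) x y)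
    (K .unitInd (Lam fun y => Id (K .unit) (K .star) y) (K .refl (K .unit) (K .star)))⟩

def symmTrans {A x y : Term} (p : Pf (Id A x y)) :
    Pf (Id (Id A y y) (K .refl A y) (p.symm.trans p).tm) :=
  pathInd (fun x y p => Id (Id A y y) (K .refl A y)
    ((symm (A := A) (x := x) (y := y) ⟨p⟩).trans (A := A) (z := y) ⟨p⟩).tm) (fun _ => rfl) p

def transportConst {A B x y : Term} (p : Pf (Id A x y)) (u : Term) :
    Pf (Id B (transport A (fun _ => B) x y p.tm u) u) :=
  pathInd (fun x y p => Id B (transport A (fun _ => B) x y p u) u) (fun _ => rfl) p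

end Pf

/-- Entries of the context are not universe polymorphic, so a lemma needed at two levels is stated
once as a function of the level and added twice. -/
abbrev piPropType' (i : ℕ) : Term :=
  Pi (U i) fun A => Pi (Arr A (U i)) fun B =>
    Arr (Pi A fun x => isProp (B x)) (isProp (Pi A fun x => B x))

def piPropProof' (i : ℕ) : Pf (piPropType' i) :=
  .lam fun A => .lam fun B => .imp fun h => .lam fun f => .lam fun g =>
    .funext (A := A) (B := fun x => B x) fun x => h x (f x) (g x)

abbrev piPropType : Term :=
  piPropType' 0

def piPropProof : Pf piPropType :=
  piPropProof' 0

def piPropCtx : List Tm := piPropType.form 0 :: emptyCtx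

theorem piProp_realized : Realized piPropCtx :=
  empty_realized.extend 0 (piPropProof.tm.form 0) _ (by decide +kernel)

/-- Variables are named by de Bruijn level: the entry with `k` predecessors is `bound k`, and its
type and proof are taken in the form `form k`. -/
def piPropConst : Pf piPropType := ⟨.bound 0⟩

instance {A : Term} {B : Term → Term} [∀ x, IsProp (B x)] : IsProp (Pi A B) :=
  ⟨(piPropConst A (Lam B)).cast (B := Arr (Pi A fun x => isProp (B x)) (isProp (Pi A B)))
      (.lam fun _ => IsProp.pf)⟩

instance {A B : Term} [IsProp B] : IsProp (Arr A B) :=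
  inferInstanceAs (IsProp (Pi A fun _ => B))

abbrev sigPathType' (i : ℕ) : Term :=
  Pi (U i) fun A => Pi (Arr A (U i)) fun B => Arr (Pi A fun x => isProp (B x)) <|
    Pi A fun x => Pi A fun y => Arr (Id A x y) <| Pi (B x) fun u => Pi (B y) fun v =>
      Id (Sig A fun x => B x) (K .pair A B x u) (K .pair A B y v)

def sigPathProof' (i : ℕ) : Pf (sigPathType' i) :=
  .lam fun A => .lam fun B => .imp fun h => .lam fun _ => .lam fun _ => .imp fun e =>
    .pathInd (fun x y _ => Pi (B x) fun u => Pi (B y) fun v =>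
      Id (Sig A fun x => B x) (K .pair A B x u) (K .pair A B y v))
    (fun x => .lam fun u => .lam fun v => .congr (A := B x) (fun u => K .pair A B x u) (h x u v)) e

/-- Elements of a subtype are equal if their first components are. -/
abbrev sigPathType : Term :=
  sigPathType' 0

def sigPathProof : Pf sigPathType :=
  sigPathProof' 0

def sigPathCtx : List Tm := sigPathType.form 1 :: piPropCtx

theorem sigPath_realized : Realized sigPathCtx :=
  piProp_realized.extend 0 (sigPathProof.tm.form 1) _ (by decide +kernel)

def sigPathConst : Pf sigPathType := ⟨.bound 1⟩

/-- A type is a set if a reflexive propositional relation on it implies equality. -/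
abbrev setOfRelType : Term :=
  Pi (U 1) fun A => Pi (Arr A (Arr A (U 1))) fun R =>
    Arr (Pi A fun x => Pi A fun y => isProp (R x y)) <|
    Arr (Pi A fun x => R x x) <|
    Arr (Pi A fun x => Pi A fun y => Arr (R x y) (Id A x y)) (isSet A)

/-- Hedberg's argument: by path induction every `p : x = y` equals the inverse of `f x x (r x)`
followed by `f x y` at the transport of `r x` along `p`. Since `R x y` is a proposition, this
composite does not depend on `p`. -/
def setOfRelProof : Pf setOfRelType :=
  .lam fun A => .lam fun R => .imp fun hR => .imp fun r => .imp fun f => .lam fun x => .lam fun y =>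
    let g (x y s : Term) : Pf (Id A x y) := (f x x (r x)).symm.trans (f x y ⟨s⟩)
    let s (x y p : Term) : Term := transport A (fun w => R x w) x y p (r x).tm
    let key (p : Pf (Id A x y)) : Pf (Id (Id A x y) p.tm (g x y (s x y p.tm)).tm) :=
      .pathInd (fun x y p => Id (Id A x y) p (g x y (s x y p)).tm)
        (fun x => (f x x (r x)).symmTrans.cast) p
    .lamPf fun p => .lamPf fun q => (key p).trans <| .trans
      (.congr (A := R x y) (fun s => (g x y s).tm) (hR x y (s x y p.tm) (s x y q.tm))) (key q).symm

def setOfRelCtx : List Tm := setOfRelType.form 2 :: sigPathCtx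

theorem setOfRel_realized : Realized setOfRelCtx :=
  sigPath_realized.extend 2 (setOfRelProof.tm.form 2) _ (by decide +kernel)

def setOfRelConst : Pf setOfRelType := ⟨.bound 2⟩

abbrev propIsSetType : Term :=
  Pi (U 0) fun A => Arr (isProp A) (isSet A)

def propIsSetProof : Pf propIsSetType :=
  .lam fun A => .imp fun h =>
    (setOfRelConst A (Lam fun _ => Lam fun _ => K .unit)) (.lam fun _ => .lam fun _ =>
        Pf.unitProp.cast) (.lam fun _ => ⟨K .star⟩)
      (.lam fun x => .lam fun y => .imp fun _ => h x y)

def propIsSetCtx : List Tm := propIsSetType.form 3 :: setOfRelCtx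

theorem propIsSet_realized : Realized propIsSetCtx :=
  setOfRel_realized.extend 0 (propIsSetProof.tm.form 3) _ (by decide +kernel)

def propIsSetConst : Pf propIsSetType := ⟨.bound 3⟩

def propIsSet {A : Term} (h : Pf (isProp A)) : Pf (isSet A) := propIsSetConst A h

abbrev isPropPropType : Term :=
  Pi (U 0) fun A => isProp (isProp A)

def isPropPropProof : Pf isPropPropType :=
  .lam fun A => .lamPf fun h => .lamPf fun k =>
    let _ (x y : Term) : IsProp (Id A x y) := ⟨propIsSet h x y⟩
    (IsProp.pf (A := Pi A fun x => Pi A fun y => Id A x y)) h.tm k.tm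

def isPropPropCtx : List Tm := isPropPropType.form 4 :: propIsSetCtx

theorem isPropProp_realized : Realized isPropPropCtx :=
  propIsSet_realized.extend 0 (isPropPropProof.tm.form 4) _ (by decide +kernel)

def isPropPropConst : Pf isPropPropType := ⟨.bound 4⟩

abbrev sigPropType : Term :=
  Pi (U 0) fun A => Pi (Arr A (U 0)) fun B => Arr (isProp A) <| Arr (Pi A fun x => isProp (B x))
      (isProp (Sig A fun x => B x))

def sigPropProof : Pf sigPropType :=
  .lam fun A => .lam fun B => .imp fun hA => .imp fun hB => .lam fun p => .lam fun q =>
    .app (A := Sig A fun x => B x) (B := fun q => Id (Sig A fun x => B x) p q)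
        (.sigInd (A := A) (B := fun x => B x) (fun p => Pi (Sig A fun x => B x) fun q =>
          Id (Sig A fun x => B x) p q) (fun a u =>
      .lam fun q => .cast <| .sigInd (A := A) (B := fun x => B x) (fun q =>
          Id (Sig A fun x => B x) (K .pair A B a u) q) (fun b v =>
        (sigPathConst A B hB a b (hA a b) u v).cast) q) p) q

def sigPropCtx : List Tm := sigPropType.form 5 :: isPropPropCtx

theorem sigProp_realized : Realized sigPropCtx :=
  isPropProp_realized.extend 0 (sigPropProof.tm.form 5) _ (by decide +kernel)

def sigPropConst : Pf sigPropType := ⟨.bound 5⟩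

instance {A B : Term} [IsProp A] [IsProp B] : IsProp (Prod A B) :=
  ⟨(sigPropConst A (Lam fun _ => B) IsProp.pf (.lam fun _ => (IsProp.pf (A := B)).cast)).cast⟩

abbrev sigPathOneType : Term :=
  sigPathType' 1

def sigPathOneProof : Pf sigPathOneType :=
  sigPathProof' 1

def sigPathOneCtx : List Tm := sigPathOneType.form 6 :: sigPropCtx

theorem sigPathOne_realized : Realized sigPathOneCtx :=
  sigProp_realized.extend 2 (sigPathOneProof.tm.form 6) _ (by decide +kernel)

def sigPathOneConst : Pf sigPathOneType := ⟨.bound 6⟩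

/-- The type of propositions. -/
def HProp : Term := Sig (U 0) isProp

/-- The underlying type of a proposition. -/
def El (P : Term) : Term := fst (U 0) isProp P

def elProp (P : Term) : Pf (isProp (El P)) := ⟨snd (U 0) isProp P⟩

def hPropMk (A : Term) [IsProp A] : Term := K .pair (U 0) (Lam isProp) A (IsProp.pf (A := A)).tm

/-- Propositional extensionality. -/
abbrev propExtType : Term :=
  Pi HProp fun P => Pi HProp fun Q => Arr (Prod (Arr (El P) (El Q)) (Arr (El Q) (El P)))
      (Id HProp P Q)

def propExtProof : Pf propExtType :=
  .lam fun P => .cast <| .sigInd (A := U 0) (B := isProp) (fun P => Pi HProp fun Q =>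
      Arr (Prod (Arr (El P) (El Q)) (Arr (El Q) (El P))) (Id HProp P Q))
    (fun A a => .lam fun Q => .cast <| .sigInd (A := U 0) (B := isProp) (fun Q =>
        Arr (Prod (Arr A (El Q)) (Arr (El Q) A)) (Id HProp (K .pair (U 0) (Lam isProp) A a) Q))
      (fun B b => .cast <| .imp (A := Prod (Arr A B) (Arr B A)) fun r =>
        let f : Pf (Arr A B) := r.left
        let g : Pf (Arr B A) := r.right
        -- Maps in both directions between propositions are mutually inverse, and univalence turns
        -- them into an identity.
        let e : Pf (Equiv A B) := .pair f.tm <| .and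
          (.pair g.tm (.lam fun x => ⟨a (g.tm (f.tm x)) x⟩)) (.pair g.tm (.lam fun y =>
            ⟨b (f.tm (g.tm y)) y⟩))
        sigPathOneConst (U 0) (Lam isProp) (.lam fun A => (isPropPropConst A).cast) A B (.ua e) a b)
          Q) P

def propExtCtx : List Tm := propExtType.form 7 :: sigPathOneCtx

theorem propExt_realized : Realized propExtCtx :=
  sigPathOne_realized.extend 1 (propExtProof.tm.form 7) _ (by decide +kernel)

def propExtConst : Pf propExtType := ⟨.bound 7⟩

abbrev hPropSetType : Term :=
  isSet HProp

/-- Mutual implication is a reflexive propositional relation, and it implies equality by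
propositional extensionality. -/
def hPropSetProof : Pf hPropSetType :=
  let R (P Q : Term) : Term := Prod (Arr (El P) (El Q)) (Arr (El Q) (El P))
  let _ (P) : IsProp (El P) := ⟨elProp P⟩
  (setOfRelConst HProp (Lam fun P => Lam fun Q => R P Q))
    (.lam fun P => .lam fun Q => (IsProp.pf (A := R P Q)).cast)
    (.lam fun P => .cast <| .and (A := Arr (El P) (El P)) (B := Arr (El P) (El P)) (.imp fun x => x)
        (.imp fun x => x))
    propExtConst.cast

def hPropSetCtx : List Tm := hPropSetType.form 8 :: propExtCtx

theorem hPropSet_realized : Realized hPropSetCtx :=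
  propExt_realized.extend 1 (hPropSetProof.tm.form 8) _ (by decide +kernel)

def hPropSetConst : Pf hPropSetType := ⟨.bound 8⟩

/-! ### Induction on Brouwer trees -/

/-- Induction for families of propositions. -/
abbrev brwPropType : Term :=
  Pi (Arr Brw (U 0)) fun B => Arr (Pi Brw fun x => isProp (B x)) <| Arr (B (K .bzero)) <|
    Arr (Pi Brw fun x => Arr (B x) (B (bsucc x))) <|
    Arr (Pi BSeq fun F => Arr (Pi N fun k => B (fn F k)) (B (blimit F))) <| Pi Brw fun x => B x

/-- The motive over the order is the unit type, so its methods are trivial; the method for bisimilar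
limits holds because the fibres are propositions. -/
def brwPropProof : Pf brwPropType :=
  .lam fun B => .imp fun hB => .imp fun z => .imp fun s => .imp fun l => ⟨
    let unit := K .unit
    let star := K .star
    apList .brwInd [
    B,
    Lam fun _ => Lam fun _ => Lam fun _ => Lam fun _ => Lam fun _ => unit,
    Lam fun x => (propIsSet (hB x)).tm,
    Lam fun _ => Lam fun _ => Lam fun _ => Lam fun _ => Lam fun _ => Pf.unitProp.tm,
    z.tm,
    s.tm,
    Lam fun F => Lam fun F' => Lam fun _ => l.tm F F',
    Lam fun F => Lam fun F' => Lam fun _ => Lam fun G => Lam fun G' => Lam fun _ =>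
      Lam fun r => Lam fun _ => Lam fun _ => (hB (blimit G)
        (transport Brw (fun x => B x) (blimit F) (blimit G) (K .bisim F G r) (l.tm F F'))
        (l.tm G G')).tm,
    Lam fun _ => Lam fun _ => star,
    Lam fun _ => Lam fun _ => Lam fun _ => Lam fun _ => Lam fun _ => Lam fun _ =>
      Lam fun _ => Lam fun _ => Lam fun _ => Lam fun _ => star,
    Lam fun _ => Lam fun _ => Lam fun _ => Lam fun _ => Lam fun _ => Lam fun _ => star,
    Lam fun _ => Lam fun _ => Lam fun _ => Lam fun _ => Lam fun _ =>
      Lam fun _ => Lam fun _ => Lam fun _ => star,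
    Lam fun _ => Lam fun _ => Lam fun _ => Lam fun _ => Lam fun _ => Lam fun _ => Lam fun _ =>
        star]⟩

def brwPropCtx : List Tm := brwPropType.form 9 :: hPropSetCtx

theorem brwProp_realized : Realized brwPropCtx :=
  hPropSet_realized.extend 0 (brwPropProof.tm.form 9) _ (by decide +kernel)

def brwPropConst : Pf brwPropType := ⟨.bound 9⟩

/-- Induction on Brouwer trees for a family of propositions. -/
def Pf.brwInd (P : Term → Term) [∀ x, IsProp (P x)] (z : Pf (P (K .bzero)))
    (s : ∀ x, Pf (P x) → Pf (P (bsucc x)))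
    (l : ∀ F, (∀ k, Pf (P (fn F k))) → Pf (P (blimit F))) (x : Term) : Pf (P x) :=
  ⟨brwPropConst.tm (Lam P) (Lam fun x => (IsProp.pf (A := P x)).tm) z.tm
    (Lam fun x => Lam fun h => (s x ⟨h⟩).tm) (Lam fun F => Lam fun h => (l F fun k => ⟨h k⟩).tm) x⟩

/-- `f` is a lift of `F` that is increasing with respect to `R`. -/
abbrev incrLift (R s F f : Term) : Term := Pi N fun k => R (s (fn F k) (f k)) (f (S k))

abbrev simLift (R f g : Term) : Term := Pi N fun n => Ex N fun m => R (f n) (g m)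

/-- The equations for a map from Brouwer trees to `B` that is monotone with respect to `R` imply
`C`. -/
abbrev recFactsImp (B R z s l m C : Term) : Term :=
  Arr (Pi Brw fun x => Pi Brw fun y => Arr (le x y) (R (m x) (m y))) <|
  Arr (Id B (m (K .bzero)) z) <|
  Arr (Pi Brw fun x => Id B (m (bsucc x)) (s x (m x))) <|
  Arr (Pi BSeq fun F => Pi (incrLift R s F (Lam fun k => m (fn F k))) fun h =>
    Id B (m (blimit F)) (l F (Lam fun k => m (fn F k)) h)) C

/-! ### Recursion into sets with a preorder -/

abbrev piPropOneType : Term :=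
  piPropType' 1

def piPropOneProof : Pf piPropOneType :=
  piPropProof' 1

def piPropOneCtx : List Tm := piPropOneType.form 10 :: brwPropCtx

theorem piPropOne_realized : Realized piPropOneCtx :=
  brwProp_realized.extend 2 (piPropOneProof.tm.form 10) _ (by decide +kernel)

def piPropOneConst : Pf piPropOneType := ⟨.bound 10⟩

abbrev limitIrrelType : Term :=
  Pi (U 1) fun B => Pi (Arr B (Arr B (U 1))) fun R => Pi (Arr Brw (Arr B B)) fun s =>
    Pi (Pi BSeq fun F => Pi (Arr N B) fun f => Arr (incrLift R s F f) B) fun l =>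
    Arr (Pi B fun b => Pi B fun c => isProp (R b c)) <|
    Pi BSeq fun F => Pi (Arr N B) fun f => Pi (incrLift R s F f) fun h =>
        Pi (incrLift R s F f) fun k =>
    Id B (l F f h) (l F f k)

/-- Being an increasing lift is a proposition. Computation at a limit yields the particular
monotonicity proof supplied by `leInd`; this replaces it by an arbitrary one. -/
def limitIrrelProof : Pf limitIrrelType :=
  .lam fun B => .lam fun R => .lam fun s => .lam fun l => .imp fun hR => .lam fun F => .lam fun f =>
    .lam fun h => .lam fun k => .cast <| .congr (A := incrLift R s F f) (B := B) (x := h) (y := k)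
        (fun h => l F f h)
      ⟨piPropOneConst.tm N (Lam fun k => R (s (fn F k) (f k)) (f (S k)))
        (Lam fun k => hR.tm (s (fn F k) (f k)) (f (S k))) h k⟩

def limitIrrelCtx : List Tm := limitIrrelType.form 11 :: piPropOneCtx

theorem limitIrrel_realized : Realized limitIrrelCtx :=
  piPropOne_realized.extend 2 (limitIrrelProof.tm.form 11) _ (by decide +kernel)

def limitIrrelConst : Pf limitIrrelType := ⟨.bound 11⟩

/-- Recursive definition of monotone maps. -/
abbrev brwRecType : Term :=
  Pi (U 1) fun B => Pi (Arr B (Arr B (U 1))) fun R =>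
    Pi (Arr Brw (Arr B B)) fun s =>
    Pi B fun z =>
    Pi (Pi BSeq fun F => Pi (Arr N B) fun f => Arr (incrLift R s F f) B) fun l =>
    Arr (isSet B) <|
    Arr (Pi B fun b => Pi B fun c => isProp (R b c)) <|
    Arr (Pi BSeq fun F => Pi (Arr N B) fun f => Pi (incrLift R s F f) fun h =>
      Pi BSeq fun G => Pi (Arr N B) fun g => Pi (incrLift R s G g) fun k =>
      Arr (simLift R f g) <| Arr (simLift R g f) <| Id B (l F f h) (l G g k)) <|
    Arr (Pi B fun b => R z b) <|
    Arr (Pi B fun b => Pi B fun c => Pi B fun d => Arr (R b c) (Arr (R c d) (R b d))) <|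
    Arr (Pi Brw fun x => Pi Brw fun y => Pi B fun b => Pi B fun c =>
      Arr (le x y) (Arr (R b c) (R (s x b) (s y c)))) <|
    Arr (Pi BSeq fun F => Pi (Arr N B) fun f => Pi (incrLift R s F f) fun h => Pi B fun b =>
        Pi N fun k =>
      Arr (R b (f k)) (R b (l F f h))) <|
    Arr (Pi BSeq fun F => Pi (Arr N B) fun f => Pi (incrLift R s F f) fun h => Pi B fun b =>
      Arr (Pi N fun k => R (f k) b) (R (l F f h) b)) <|
    Pi (U 1) fun C => Arr (Pi (Arr Brw B) fun m => recFactsImp B R z s l m C) C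

/-- The induction principle with constant motives. The result is in continuation form: to obtain `C`
it suffices to derive it from any map satisfying the equations, which stands for a nested sum type
without its projections. -/
def brwRecProof : Pf brwRecType :=
  .lam fun B => .lam fun R => .lam fun s => .lam fun z => .lam fun l => .imp fun hB =>
      .imp fun hR =>
    .imp fun hb => .imp fun h1 => .imp fun h2 => .imp fun h3 => .imp fun h4 => .imp fun h5 =>
  let sim (F G f g t : Term) : Pf (simLift R f g) := .lam fun n =>
    .trElim (A := Sig N fun m => Sig (le (fn F n) (fn G m)) fun _ => R (f n) (g m)) ⟨t n⟩ fun q =>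
      .exI q.fst (.snd (A := le (fn F n) (fn G q.fst)) (B := fun _ => R (f n) (g q.fst)) q.snd)
  let methods : List Term := [
    Lam fun _ => B,
    Lam fun _ => Lam fun _ => Lam fun b => Lam fun c => Lam fun _ => R b c,
    Lam fun _ => hB.tm,
    Lam fun _ => Lam fun _ => Lam fun b => Lam fun c => Lam fun _ => hR.tm b c,
    z, s, l,
    Lam fun F => Lam fun f => Lam fun h => Lam fun G => Lam fun g => Lam fun k =>
      Lam fun q => Lam fun t => Lam fun u =>
        -- The motive is constant, so the path over `bisim` reduces to an equation in `B`.
        ((Pf.transportConst (A := Brw) (x := blimit F) (y := blimit G) ⟨K .bisim F G q⟩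
          (l F f h)).trans
          ⟨hb.tm F f h G g k (sim F G f g t).tm (sim G F g f u).tm⟩ : Pf (Id B _ (l G g k))).tm,
    Lam fun _ => Lam fun b => h1.tm b,
    Lam fun _ => Lam fun b => Lam fun _ => Lam fun c => Lam fun _ => Lam fun d =>
      Lam fun _ => Lam fun p => Lam fun _ => Lam fun q => h2.tm b c d p q,
    Lam fun x => Lam fun b => Lam fun y => Lam fun c => Lam fun p => Lam fun q => h3.tm x y b c p q,
    Lam fun _ => Lam fun b => Lam fun F => Lam fun f => Lam fun h => Lam fun k =>
      Lam fun _ => Lam fun p => h4.tm F f h b k p,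
    Lam fun F => Lam fun f => Lam fun h => Lam fun _ => Lam fun b => Lam fun _ => Lam fun p =>
      h5.tm F f h b p]
  let m (x : Term) : Term := apList .brwInd methods x
  let mono (x y p : Term) : Pf (R (m x) (m y)) := ⟨apList .leInd methods x y p⟩
  .lam fun _ => .imp fun h => ⟨h.tm (Lam m)
    (Lam fun x => Lam fun y => Lam fun p => (mono x y p).tm)
    (K .refl B z) (Lam fun x => K .refl B (s x (m x)))
    (Lam fun F => Lam fun h => limitIrrelConst.tm B R s l hR.tm F (Lam fun k => m (fn F k))
      (Lam fun k => (mono (bsucc (fn F k)) (fn F (S k)) (Pf.seqIncr F k).tm).tm) h)⟩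

def brwRecCtx : List Tm := brwRecType.form 12 :: limitIrrelCtx

theorem brwRec_realized : Realized brwRecCtx :=
  limitIrrel_realized.extend 2 (brwRecProof.tm.form 12) _ (by decide +kernel)

def brwRecConst : Pf brwRecType := ⟨.bound 12⟩

abbrev leReflType : Term :=
  Pi Brw fun x => le x x

def leReflProof : Pf leReflType :=
  .lam <| .brwInd (fun x => le x x) (.leZero _) (fun _ h => .leSuccMono h)
    (fun _ h => .leLimiting fun k => .leCocone k (h k))

def leReflCtx : List Tm := leReflType.form 13 :: brwRecCtx

theorem leRefl_realized : Realized leReflCtx :=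
  brwRec_realized.extend 0 (leReflProof.tm.form 13) _ (by decide +kernel)

def leReflConst : Pf leReflType := ⟨.bound 13⟩

def leRefl (x : Term) : Pf (le x x) := leReflConst x

/-- The data for a recursive definition of a map from Brouwer trees to `B` that is monotone with
respect to the relation `R`. -/
structure BrwRec where
  B : Term
  R : Term → Term → Term
  isSet : Pf (isSet B)
  isProp (b c : Term) : Pf (isProp (R b c))
  zero : Term
  succ (x b : Term) : Term
  limit (F f h : Term) : Term
  bisim {F f h G g k : Term}
    (s : ∀ n, Pf (Ex N fun m => R (f n) (g m))) (t : ∀ n, Pf (Ex N fun m => R (g n) (f m))) :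
    Pf (Id B (limit F f h) (limit G g k))
  leZero (b : Term) : Pf (R zero b)
  leTrans {b c d : Term} (p : Pf (R b c)) (q : Pf (R c d)) : Pf (R b d)
  leSuccMono {x y b c : Term} (p : Pf (le x y)) (q : Pf (R b c)) : Pf (R (succ x b) (succ y c))
  leCocone {F f h b k : Term} (p : Pf (R b (f k))) : Pf (R b (limit F f h))
  leLimiting {F f h b : Term} (p : ∀ k, Pf (R (f k) b)) : Pf (R (limit F f h) b)

/-- The map that is defined by recursion, and its equations. -/
def BrwRec.elim (r : BrwRec) {C : Term}
    (f : (m : Term → Term) → (∀ {x y}, Pf (le x y) → Pf (r.R (m x) (m y))) →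
      Pf (Id r.B (m (K .bzero)) r.zero) → (∀ x, Pf (Id r.B (m (bsucc x)) (r.succ x (m x)))) →
      (∀ F, (h : ∀ k, Pf (r.R (r.succ (fn F k) (m (fn F k))) (m (fn F (S k))))) →
        Pf (Id r.B (m (blimit F)) (r.limit F (Lam fun k => m (fn F k)) (Lam fun k => (h k).tm)))) →
      Pf C) : Pf C :=
  let Lam₂ (f : Term → Term → Term) : Term := Lam fun x => Lam fun y => f x y
  let Lam₃ (f : Term → Term → Term → Term) : Term := Lam fun x => Lam₂ (f x)
  ⟨brwRecConst.tm r.B (Lam₂ r.R) (Lam₂ r.succ) r.zero (Lam₃ r.limit) r.isSet.tm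
    (Lam₂ fun b c => (r.isProp b c).tm)
    (Lam₃ fun F f h => Lam₃ fun G g k => Lam₂ fun s t =>
      (r.bisim (F := F) (f := f) (h := h) (G := G) (g := g) (k := k)
        (fun n => ⟨s n⟩) fun n => ⟨t n⟩).tm)
    (Lam fun b => (r.leZero b).tm)
    (Lam₃ fun b c d => Lam₂ fun p q => (r.leTrans (b := b) (c := c) (d := d) ⟨p⟩ ⟨q⟩).tm)
    (Lam₃ fun x y b => Lam₃ fun c p q =>
      (r.leSuccMono (x := x) (y := y) (b := b) (c := c) ⟨p⟩ ⟨q⟩).tm)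
    (Lam₃ fun F f h => Lam₃ fun b k p =>
      (r.leCocone (F := F) (f := f) (h := h) (b := b) (k := k) ⟨p⟩).tm)
    (Lam₃ fun F f h => Lam₂ fun b p =>
      (r.leLimiting (F := F) (f := f) (h := h) (b := b) fun k => ⟨p k⟩).tm) C
    (Lam fun m => Lam fun p => Lam₃ fun a b c =>
      (f (fun x => m x) (fun {x y} h => ⟨p x y h.tm⟩) ⟨a⟩ (fun x => ⟨b x⟩)
        fun F h => ⟨c F (Lam fun k => (h k).tm)⟩).tm)⟩

/-- The strict order with respect to `z`, as a family of propositions defined by recursion. -/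
def belowRec (z : Term) : BrwRec where
  B := HProp
  R P Q := Arr (El P) (El Q)
  isSet := hPropSetConst
  isProp _ Q :=
    let _ : IsProp (El Q) := ⟨elProp Q⟩
    IsProp.pf
  zero := hPropMk (K .empty)
  succ x _ := hPropMk (le z x)
  limit _ f _ := hPropMk (Ex N fun k => El (f k))
  bisim {_ f _ _ g _} s t :=
    propExtConst (hPropMk (Ex N fun k => El (f k))) (hPropMk (Ex N fun k => El (g k))) <|
      .cast <| .and (A := Arr (Ex N fun k => El (f k)) (Ex N fun k => El (g k)))
        (B := Arr (Ex N fun k => El (g k)) (Ex N fun k => El (f k)))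
      (.imp fun e => e.exElim fun k d => (s k).exElim fun n q => .exI n (q d))
      (.imp fun e => e.exElim fun k d => (t k).exElim fun n q => .exI n (q d))
  leZero Q := .cast <| .imp (A := K .empty) (B := El Q) fun x => x.absurd
  leTrans p q := .imp fun x => q (p x)
  leSuccMono {x y _ _} p _ := .cast <| .imp (A := le z x) (B := le z y) fun q => q.leTrans p
  leCocone {_ f _ b k} p := .cast <| .imp (A := El b) (B := Ex N fun k => El (f k)) fun x =>
      .exI k (p x)
  leLimiting {_ f _ b} p :=
    let _ : IsProp (El b) := ⟨elProp b⟩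
    .cast <| .imp (A := Ex N fun k => El (f k)) (B := El b) fun e => e.exElim fun k x => p k x

/-- The strict order has a characterization by recursion. -/
abbrev ltRecType : Term :=
  Pi Brw fun z => Pi (U 0) fun C => Arr (Pi (Arr Brw (U 0)) fun p =>
  Arr (Pi Brw fun y => Arr (lt z y) (p y)) <|
  Arr (Pi Brw fun y => Arr (p y) (lt z y)) <|
  Arr (Arr (p (K .bzero)) (K .empty)) <|
  Arr (Pi Brw fun y => Arr (p (bsucc y)) (le z y)) <|
  Arr (Pi BSeq fun F => Arr (p (blimit F)) (Ex N fun k => p (fn F k))) C) C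

/-- Encode-decode with the family `El (m y)`. It is inhabited at `succ z`, where it is `z ≤ z`, and
monotone, so it holds whenever `succ z ≤ y`. The converse is by induction on `y`. -/
def ltRecProof : Pf ltRecType :=
  .lam fun z => .lam fun _ => .imp fun c => (belowRec z).elim fun m mono zero succ limit =>
  let mono {x y : Term} (h : Pf (le x y)) (u : Pf (El (m x))) : Pf (El (m y)) :=
    Pf.mp (A := El (m x)) (B := El (m y)) (mono h) u
  let ez (h : Pf (El (m (K .bzero)))) : Pf (K .empty) := (zero.rw El h).cast
  let es (y : Term) (h : Pf (El (m (bsucc y)))) : Pf (le z y) := ((succ y).rw El h).cast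
  let es' (y : Term) (h : Pf (le z y)) : Pf (El (m (bsucc y))) := (succ y).symm.rw El h.cast
  let el (F : Term) (h : Pf (El (m (blimit F)))) : Pf (Ex N fun k => El (m (fn F k))) :=
    ((limit F fun k => .cast <| .imp (A := le z (fn F k)) (B := El (m (fn F (S k)))) fun h =>
      mono (x := bsucc (fn F k)) (.seqIncr F k) (es' _ h)).rw El h).cast
  ⟨c.tm (Lam fun y => El (m y))
    (Lam fun y => Lam fun h => (mono (x := bsucc z) (y := y) ⟨h⟩ (es' z (leRefl z))).tm)
    (Lam fun y => (Pf.brwInd (fun y => Arr (El (m y)) (lt z y))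
      (.imp fun h => (ez h).absurd)
      (fun y _ => .imp fun h => .leSuccMono (es y h))
      (fun F ih => .imp fun h => (el F h).exElim fun k h => .leCocone k (ih k h)) y).tm)
    (Lam fun h => (ez ⟨h⟩).tm)
    (Lam fun y => Lam fun h => (es y ⟨h⟩).tm)
    (Lam fun F => Lam fun h => (el F ⟨h⟩).tm)⟩

def ltRecCtx : List Tm := ltRecType.form 14 :: leReflCtx

theorem ltRec_realized : Realized ltRecCtx :=
  leRefl_realized.extend 1 (ltRecProof.tm.form 14) _ (by decide +kernel)

def ltRecConst : Pf ltRecType := ⟨.bound 14⟩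

def Pf.ltRec (z : Term) {C : Term}
    (f : (p : Term → Term) → (∀ {y}, Pf (lt z y) → Pf (p y)) → (∀ {y}, Pf (p y) → Pf (lt z y)) →
      (Pf (p (K .bzero)) → Pf (K .empty)) → (∀ {y}, Pf (p (bsucc y)) → Pf (le z y)) →
      (∀ {F}, Pf (p (blimit F)) → Pf (Ex N fun k => p (fn F k))) → Pf C) : Pf C :=
  ⟨ltRecConst.tm z C <| Lam fun p => Lam fun a => Lam fun b => Lam fun c => Lam fun d =>
      Lam fun e =>
    (f (fun y => p y) (fun {y} h => ⟨a y h.tm⟩) (fun {y} h => ⟨b y h.tm⟩) (fun h => ⟨c h.tm⟩)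
      (fun {y} h => ⟨d y h.tm⟩) (fun {F} h => ⟨e F h.tm⟩)).tm⟩

/-! ### Inversion principles for the strict order -/

abbrev notLtZeroType : Term :=
  Pi Brw fun z => Arr (lt z (K .bzero)) (K .empty)

def notLtZeroProof : Pf notLtZeroType :=
  .lam fun z => .imp fun h => .ltRec z fun _ b _ e _ _ => e (b h)

def notLtZeroCtx : List Tm := notLtZeroType.form 15 :: ltRecCtx

theorem notLtZero_realized : Realized notLtZeroCtx :=
  ltRec_realized.extend 0 (notLtZeroProof.tm.form 15) _ (by decide +kernel)

def notLtZeroConst : Pf notLtZeroType := ⟨.bound 15⟩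

def notLtZero {z A : Term} (h : Pf (lt z (K .bzero))) : Pf A := (notLtZeroConst z h).absurd

abbrev leOfLtSuccType : Term :=
  Pi Brw fun z => Pi Brw fun y => Arr (lt z (bsucc y)) (le z y)

def leOfLtSuccProof : Pf leOfLtSuccType :=
  .lam fun z => .lam fun _ => .imp fun h => .ltRec z fun _ b _ _ e _ => e (b h)

def leOfLtSuccCtx : List Tm := leOfLtSuccType.form 16 :: notLtZeroCtx

theorem leOfLtSucc_realized : Realized leOfLtSuccCtx :=
  notLtZero_realized.extend 0 (leOfLtSuccProof.tm.form 16) _ (by decide +kernel)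

def leOfLtSuccConst : Pf leOfLtSuccType := ⟨.bound 16⟩

def leOfLtSucc {z y : Term} (h : Pf (lt z (bsucc y))) : Pf (le z y) := leOfLtSuccConst z y h

abbrev ltLimitType : Term :=
  Pi Brw fun z => Pi BSeq fun F => Arr (lt z (blimit F)) (Ex N fun k => lt z (fn F k))

def ltLimitProof : Pf ltLimitType :=
  .lam fun z => .lam fun _ => .imp fun h => .ltRec z fun _ b c _ _ e => (e (b h)).exElim fun k h =>
      .exI k (c h)

def ltLimitCtx : List Tm := ltLimitType.form 17 :: leOfLtSuccCtx

theorem ltLimit_realized : Realized ltLimitCtx :=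
  leOfLtSucc_realized.extend 0 (ltLimitProof.tm.form 17) _ (by decide +kernel)

def ltLimitConst : Pf ltLimitType := ⟨.bound 17⟩

def ltLimit {z F : Term} (h : Pf (lt z (blimit F))) : Pf (Ex N fun k => lt z (fn F k)) :=
    ltLimitConst z F h

/-! ### The order is a partial order -/

abbrev leSuccType : Term :=
  Pi Brw fun x => le x (bsucc x)

def leSuccProof : Pf leSuccType :=
  .lam <| .brwInd (fun x => le x (bsucc x)) (.leZero _) (fun _ h => .leSuccMono h)
    (fun F h => .leLimiting fun k => (h k).leTrans (.leSuccMono (.leCocone k (leRefl (fn F k)))))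

def leSuccCtx : List Tm := leSuccType.form 18 :: ltLimitCtx

theorem leSucc_realized : Realized leSuccCtx :=
  ltLimit_realized.extend 0 (leSuccProof.tm.form 18) _ (by decide +kernel)

def leSuccConst : Pf leSuccType := ⟨.bound 18⟩

def leSucc (x : Term) : Pf (le x (bsucc x)) := leSuccConst x

namespace Pf

def leOfLt {x y : Term} (h : Pf (lt x y)) : Pf (le x y) := (leSucc x).leTrans h

def leOfEq {x y : Term} (p : Pf (Id Brw x y)) : Pf (le x y) := p.rw (fun w => le x w) (leRefl x)

def memLt (F k : Term) : Pf (lt (fn F k) (blimit F)) := leCocone (S k) (seqIncr F k)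

def memLe (F k : Term) : Pf (le (fn F k) (blimit F)) := leCocone k (leRefl (fn F k))

end Pf

abbrev ltIrreflType : Term :=
  Pi Brw fun x => Arr (lt x x) (K .empty)

/-- At a limit, inversion places the limit strictly below some member `F k`; as `F k` is below the
limit, this gives `F k < F k`. -/
def ltIrreflProof : Pf ltIrreflType :=
  .lam <| .brwInd (fun x => Arr (lt x x) (K .empty)) (.imp fun h => notLtZero h)
    (fun _ ih => .imp fun h => ih (leOfLtSucc h))
    (fun F ih => .imp fun h => (ltLimit h).exElim fun k h => ih k
      (.leTrans (.leSuccMono (.memLe F k)) h))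

def ltIrreflCtx : List Tm := ltIrreflType.form 19 :: leSuccCtx

theorem ltIrrefl_realized : Realized ltIrreflCtx :=
  leSucc_realized.extend 0 (ltIrreflProof.tm.form 19) _ (by decide +kernel)

def ltIrreflConst : Pf ltIrreflType := ⟨.bound 19⟩

def ltIrrefl {x A : Term} (h : Pf (lt x x)) : Pf A := (ltIrreflConst x h).absurd

abbrev limitLeOfLeSuccType : Term :=
  Pi BSeq fun F => Pi Brw fun y => Arr (le (blimit F) (bsucc y)) (le (blimit F) y)

/-- Members are strictly below the limit, so the successor can be stripped off for each of them. -/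
def limitLeOfLeSuccProof : Pf limitLeOfLeSuccType :=
  .lam fun F => .lam fun _ => .imp fun h => .leLimiting fun k =>
      leOfLtSucc ((Pf.memLt F k).leTrans h)

def limitLeOfLeSuccCtx : List Tm := limitLeOfLeSuccType.form 20 :: ltIrreflCtx

theorem limitLeOfLeSucc_realized : Realized limitLeOfLeSuccCtx :=
  ltIrrefl_realized.extend 0 (limitLeOfLeSuccProof.tm.form 20) _ (by decide +kernel)

def limitLeOfLeSuccConst : Pf limitLeOfLeSuccType := ⟨.bound 20⟩

def limitLeOfLeSucc {F y : Term} (h : Pf (le (blimit F) (bsucc y))) : Pf (le (blimit F) y) :=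
    limitLeOfLeSuccConst F y h

abbrev leAntisymmType : Term :=
  Pi Brw fun x => Pi Brw fun y => Arr (le x y) (Arr (le y x) (Id Brw x y))

/-- Double induction. Two limits below each other are bisimilar and hence equal by the path
constructor. A successor and a limit cannot be equivalent: `x < G n` for some `n`, while `G n < succ
x` gives `G n ≤ x`. -/
def leAntisymmProof : Pf leAntisymmType :=
  
  let P (x y : Term) : Term := Arr (le x y) (Arr (le y x) (Id Brw x y))
  .lam <| .brwInd (fun x => Pi Brw fun y => P x y)
    (.lam <| .brwInd (P (K .bzero)) (.imp fun _ => .imp fun _ => .refl _)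
      (fun _ _ => .imp fun _ => .imp fun h => notLtZero h)
      (fun G _ => .imp fun _ => .imp fun h => notLtZero ((Pf.memLt G (K .zero)).leTrans h)))
    (fun x ih => .lam <| .brwInd (P (bsucc x)) (.imp fun h => .imp fun _ => notLtZero h)
      (fun y _ => .imp fun h => .imp fun k =>
        .congr bsucc (ih.app y |>.mp (leOfLtSucc h) |>.mp (leOfLtSucc k)))
      (fun G _ => .imp fun h => .imp fun k => (ltLimit h).exElim fun n h =>
        ltIrrefl (h.leTrans (leOfLtSucc ((Pf.memLt G n).leTrans k)))))
    (fun F _ => .lam <| .brwInd (P (blimit F))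
      (.imp fun h => .imp fun _ => notLtZero ((Pf.memLt F (K .zero)).leTrans h))
      (fun _ _ => .imp fun k => .imp fun h => (ltLimit h).exElim fun n h =>
        ltIrrefl (h.leTrans (leOfLtSucc ((Pf.memLt F n).leTrans k))))
      (fun G _ => .imp fun h => .imp fun k =>
        let sim (F G : Term) (h : Pf (le (blimit F) (blimit G))) : Pf
          (simulated le (fn F) (fn G)) :=
          .lam fun k => (ltLimit ((Pf.memLt F k).leTrans h)).exElim fun n h => .exI n h.leOfLt
        ⟨K .bisim F G (Pf.and (sim F G h) (sim G F k)).tm⟩))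

def leAntisymmCtx : List Tm := leAntisymmType.form 21 :: limitLeOfLeSuccCtx

theorem leAntisymm_realized : Realized leAntisymmCtx :=
  limitLeOfLeSucc_realized.extend 0 (leAntisymmProof.tm.form 21) _ (by decide +kernel)

def leAntisymmConst : Pf leAntisymmType := ⟨.bound 21⟩

def leAntisymm {x y : Term} (p : Pf (le x y)) (q : Pf (le y x)) : Pf (Id Brw x y) :=
    leAntisymmConst x y p q

/-! ### Addition -/

/-- The type of Brouwer trees above `c`. -/
def Cone (c : Term) : Term := Sig Brw fun y => le c y

/-- The Brouwer tree underlying an element of a cone. -/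
def base (c u : Term) : Term := fst Brw (fun y => le c y) u

def leBase (c u : Term) : Pf (le c (base c u)) := ⟨snd Brw (fun y => le c y) u⟩

def coneMk {c y : Term} (h : Pf (le c y)) : Term :=
    (Pf.pair (A := Brw) (B := fun y => le c y) y h).tm

def coneEq {c x y : Term} (p : Pf (Id Brw x y)) (u : Pf (le c x)) (v : Pf (le c y)) :
    Pf (Id (Cone c) (coneMk u) (coneMk v)) :=
  ⟨sigPathConst.tm Brw (Lam fun y => le c y) (Lam fun y => K .leProp c y) x y p.tm u.tm v.tm⟩

abbrev coneSetType : Term :=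
  Pi Brw fun c => isSet (Cone c)

/-- Equality of the underlying trees is a propositional relation on the cone that implies equality.
-/
def coneSetProof : Pf coneSetType :=
  .lam fun c =>
  let R (u v : Term) : Term := Id Brw (base c u) (base c v)
  setOfRelConst (Cone c) (Lam fun u => Lam fun v => R u v)
    (.lam fun u => .lam fun v => (IsProp.pf (A := R u v)).cast) (.lam fun u =>
        (Pf.refl (A := Brw) (base c u)).cast)
    (.lam fun u => .lam fun v => .cast <| .app (A := Cone c) (B := fun v =>
        Arr (R u v) (Id (Cone c) u v))
      (.sigInd (A := Brw) (B := fun y => le c y) (fun u => Pi (Cone c) fun v =>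
          Arr (R u v) (Id (Cone c) u v))
        (fun x p => .lam fun v => .cast <|
          .sigInd (A := Brw) (B := fun y => le c y)
            (fun v => Arr (R (coneMk (c := c) (y := x) ⟨p⟩) v)
              (Id (Cone c) (coneMk (c := c) (y := x) ⟨p⟩) v))
            (fun y q => .cast <| .imp fun e : Pf (Id Brw x y) => coneEq (c := c) e ⟨p⟩ ⟨q⟩) v) u) v)

def coneSetCtx : List Tm := coneSetType.form 22 :: leAntisymmCtx

theorem coneSet_realized : Realized coneSetCtx :=
  leAntisymm_realized.extend 1 (coneSetProof.tm.form 22) _ (by decide +kernel)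

def coneSetConst : Pf coneSetType := ⟨.bound 22⟩

/-- Addition of `c` on the left, as a map into the cone of `c`. -/
def addRec (c : Term) : BrwRec where
  B := Cone c
  R u v := le (base c u) (base c v)
  isSet := (coneSetConst c).cast
  isProp _ _ := IsProp.pf
  zero := coneMk (leRefl c)
  succ _ u := coneMk ((leBase c u).leTrans (leSucc _))
  -- The member with index zero already lies above `c`.
  limit _ f h := coneMk (.leCocone (F := Pf.seq (fun k => base c (f k)) fun k => ⟨h k⟩) (K .zero)
    (leBase c (f (K .zero))).cast)
  bisim {_ f h _ g k} s t :=
    let F := Pf.seq (fun k => base c (f k)) fun n => ⟨h n⟩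
    let G := Pf.seq (fun k => base c (g k)) fun n => ⟨k n⟩
    coneEq ⟨K .bisim F G (Pf.and (.cast (.lam (A := N) s)) (.cast (.lam (A := N) t)) :
      Pf (bisimilar le (fn F) (fn G))).tm⟩ _ _
  -- This is why the recursion targets the cone: the value `c` at zero has to be below every
  -- possible value.
  leZero u := (leBase c u).cast
  leTrans p q := p.leTrans q
  leSuccMono _ q := q.leSuccMono.cast
  leCocone {_ f h u k} p := .cast <| .leCocone (x := base c u)
    (F := Pf.seq (fun k => base c (f k)) fun k => ⟨h k⟩) k p.cast
  leLimiting {_ f h u} p := .cast <| .leLimiting (x := base c u)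
    (F := Pf.seq (fun k => base c (f k)) fun k => ⟨h k⟩) fun k => (p k).cast

/-- The properties of a map `p : Brw → Brw` that characterize addition of `c` imply `C`. -/
abbrev addFactsImp (c p C : Term) : Term :=
  Arr (Pi Brw fun x => Pi Brw fun y => Arr (le x y) (le (p x) (p y))) <|
  Arr (Pi Brw fun x => le c (p x)) <|
  Arr (Id Brw (p (K .bzero)) c) <|
  Arr (Pi Brw fun x => Id Brw (p (bsucc x)) (bsucc (p x))) <|
  Arr (Pi BSeq fun F => Pi Brw fun b =>
    Arr (Pi N fun k => le (p (fn F k)) b) (le (p (blimit F)) b)) <|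
  Arr (Pi BSeq fun F => Pi Brw fun z =>
    Arr (lt z (p (blimit F))) (Ex N fun k => lt z (p (fn F k)))) C

abbrev addPropertyOf (c p : Term) : Term := Pi (U 0) fun C => Arr (addFactsImp c p C) C

abbrev addSigType : Term :=
  Pi Brw fun c => Sig (Arr Brw Brw) (addPropertyOf c)

/-- The recursion equations are projected from the cone to the trees. The equation at limits is kept
only as its two order-theoretic consequences, an upper bound property and inversion of the strict
order; these mention no proof that the sums increase. -/
def addSigProof : Pf addSigType :=
  .lam fun c => (addRec c).elim fun m mono zero succ limit =>
  let p (x : Term) : Term := base c (m x)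
  let mono {x y : Term} (h : Pf (le x y)) : Pf (le (p x) (p y)) := (mono h).cast
  let succ (x : Term) : Pf (Id Brw (p (bsucc x)) (bsucc (p x))) :=
    .cast <| .congr (A := Cone c) (B := Brw) (base c) (succ x)
  let incr (F k : Term) : Pf (lt (p (fn F k)) (p (fn F (S k)))) :=
    (succ (fn F k)).rw (fun w => le w (p (fn F (S k)))) (mono (.seqIncr F k))
  let lim (F : Term) : Term := Pf.seq (fun k => p (fn F k)) (incr F)
  let limit (F : Term) : Pf (Id Brw (p (blimit F)) (blimit (lim F))) :=
    .cast <| .congr (A := Cone c) (B := Brw) (base c) (limit F fun k => (incr F k).cast)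
  .pair (B := addPropertyOf c) (Lam p) <| .cast <| .lam (A := U 0) (B := fun C =>
      Arr (addFactsImp c (Lam p) C) C) fun _ =>
    .imp fun h => ⟨h.tm
    (Lam fun x => Lam fun y => Lam fun h => (mono (x := x) (y := y) ⟨h⟩).tm)
    (Lam fun x => (leBase c (m x)).tm)
    (Pf.cast (B := Id Brw (p (K .bzero)) c) (.congr (A := Cone c) (B := Brw) (base c) zero)).tm
    (Lam fun x => (succ x).tm)
    (Lam fun F => Lam fun b => Lam fun h => ((limit F).symm.rw (fun w => le w b)
      (.leLimiting (F := lim F) fun k => ⟨h k⟩)).tm)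
    (Lam fun F => Lam fun z => Lam fun h =>
      (ltLimit (F := lim F) ((limit F).rw (fun w => lt z w) ⟨h⟩)).tm)⟩

def addSigCtx : List Tm := addSigType.form 23 :: coneSetCtx

theorem addSig_realized : Realized addSigCtx :=
  coneSet_realized.extend 1 (addSigProof.tm.form 23) _ (by decide +kernel)

def addSigConst : Pf addSigType := ⟨.bound 23⟩

def addMap (c : Term) : Term := HoTT.fst (Arr Brw Brw) (addPropertyOf c) (addSigConst.tm c)

def addTerm : Term :=
  Lam fun c => Lam fun x => addMap c x

def addType : Term :=
  BinOp Brw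

/-- From here on addition is a variable: later proofs see its specification, and the checker never
unfolds its definition. -/
def add : Term := .bound 24

abbrev addSpecType (add : Term) : Term :=
  Pi Brw fun c => addPropertyOf c (add c)

def addSpecProof : Pf (addSpecType addTerm) :=
  .lam fun c => (Pf.snd (addSigConst c)).cast

def addSpecCtx : List Tm := (addSpecType add).form 25 :: addType.form 24 :: addSigCtx

theorem addSpec_realized : Realized addSpecCtx :=
  addSig_realized.define 1 (addTerm.form 24) _ (addSpecProof.tm.form 24) _
    (by decide +kernel) (by decide +kernel) (by decide +kernel)

def addSpecConst : Pf (addSpecType add) := ⟨.bound 25⟩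

def Pf.addElim {C : Term} (c : Term)
    (f : (∀ {x y}, Pf (le x y) → Pf (le (add c x) (add c y))) → (∀ x, Pf (le c (add c x))) →
      Pf (Id Brw (add c (K .bzero)) c) → (∀ x, Pf (Id Brw (add c (bsucc x)) (bsucc (add c x)))) →
      (∀ {F b}, (∀ k, Pf (le (add c (fn F k)) b)) → Pf (le (add c (blimit F)) b)) →
      (∀ {F z}, Pf (lt z (add c (blimit F))) → Pf (Ex N fun k => lt z (add c (fn F k)))) → Pf C) :
    Pf C :=
  ⟨addSpecConst.tm c C <| Lam fun a => Lam fun b => Lam fun d => Lam fun e => Lam fun g =>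
      Lam fun h =>
    (f (fun {x y} p => ⟨a x y p.tm⟩) (fun x => ⟨b x⟩) ⟨d⟩ (fun x => ⟨e x⟩)
      (fun {F z} p => ⟨g F z (Lam fun k => (p k).tm)⟩) (fun {F z} p => ⟨h F z p.tm⟩)).tm⟩

abbrev addMonoType : Term :=
  Pi Brw fun c => Pi Brw fun x => Pi Brw fun y => Arr (le x y) (le (add c x) (add c y))

def addMonoProof : Pf addMonoType :=
  .lam fun c => .lam fun _ => .lam fun _ => .imp fun h => .addElim c fun p _ _ _ _ _ => p h

def addMonoCtx : List Tm := addMonoType.form 26 :: addSpecCtx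

theorem addMono_realized : Realized addMonoCtx :=
  addSpec_realized.extend 0 (addMonoProof.tm.form 26) _ (by decide +kernel)

def addMonoConst : Pf addMonoType := ⟨.bound 26⟩

def addMono (c : Term) {x y : Term} (h : Pf (le x y)) : Pf (le (add c x) (add c y)) :=
    addMonoConst c x y h

abbrev leAddType : Term :=
  Pi Brw fun c => Pi Brw fun x => le c (add c x)

def leAddProof : Pf leAddType :=
  .lam fun c => .lam fun x => .addElim c fun _ p _ _ _ _ => p x

def leAddCtx : List Tm := leAddType.form 27 :: addMonoCtx

theorem leAdd_realized : Realized leAddCtx :=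
  addMono_realized.extend 0 (leAddProof.tm.form 27) _ (by decide +kernel)

def leAddConst : Pf leAddType := ⟨.bound 27⟩

def leAdd (c x : Term) : Pf (le c (add c x)) := leAddConst c x

abbrev addZeroType : Term :=
  Pi Brw fun c => Id Brw (add c (K .bzero)) c

def addZeroProof : Pf addZeroType :=
  .lam fun c => .addElim c fun _ _ p _ _ _ => p

def addZeroCtx : List Tm := addZeroType.form 28 :: leAddCtx

theorem addZero_realized : Realized addZeroCtx :=
  leAdd_realized.extend 0 (addZeroProof.tm.form 28) _ (by decide +kernel)

def addZeroConst : Pf addZeroType := ⟨.bound 28⟩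

def addZero (c : Term) : Pf (Id Brw (add c (K .bzero)) c) := addZeroConst c

abbrev addSuccType : Term :=
  Pi Brw fun c => Pi Brw fun x => Id Brw (add c (bsucc x)) (bsucc (add c x))

def addSuccProof : Pf addSuccType :=
  .lam fun c => .lam fun x => .addElim c fun _ _ _ p _ _ => p x

def addSuccCtx : List Tm := addSuccType.form 29 :: addZeroCtx

theorem addSucc_realized : Realized addSuccCtx :=
  addZero_realized.extend 0 (addSuccProof.tm.form 29) _ (by decide +kernel)

def addSuccConst : Pf addSuccType := ⟨.bound 29⟩

def addSucc (c x : Term) : Pf (Id Brw (add c (bsucc x)) (bsucc (add c x))) := addSuccConst c x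

abbrev addLimitLeType : Term :=
  Pi Brw fun c => Pi BSeq fun F => Pi Brw fun b =>
    Arr (Pi N fun k => le (add c (fn F k)) b) (le (add c (blimit F)) b)

def addLimitLeProof : Pf addLimitLeType :=
  .lam fun c => .lam fun F => .lam fun b => .imp fun h => .addElim c fun _ _ _ _ p _ =>
      p (F := F) (b := b) h.app

def addLimitLeCtx : List Tm := addLimitLeType.form 30 :: addSuccCtx

theorem addLimitLe_realized : Realized addLimitLeCtx :=
  addSucc_realized.extend 0 (addLimitLeProof.tm.form 30) _ (by decide +kernel)

def addLimitLeConst : Pf addLimitLeType := ⟨.bound 30⟩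

def addLimitLe {c F b : Term} (h : ∀ k, Pf (le (add c (fn F k)) b)) : Pf
    (le (add c (blimit F)) b) := addLimitLeConst c F b (.lam h)

abbrev ltAddLimitType : Term :=
  Pi Brw fun c => Pi BSeq fun F => Pi Brw fun z =>
    Arr (lt z (add c (blimit F))) (Ex N fun k => lt z (add c (fn F k)))

def ltAddLimitProof : Pf ltAddLimitType :=
  .lam fun c => .lam fun F => .lam fun z => .imp fun h => .addElim c fun _ _ _ _ _ p =>
      p (F := F) (z := z) h

def ltAddLimitCtx : List Tm := ltAddLimitType.form 31 :: addLimitLeCtx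

theorem ltAddLimit_realized : Realized ltAddLimitCtx :=
  addLimitLe_realized.extend 0 (ltAddLimitProof.tm.form 31) _ (by decide +kernel)

def ltAddLimitConst : Pf ltAddLimitType := ⟨.bound 31⟩

def ltAddLimit {c F z : Term} (h : Pf (lt z (add c (blimit F)))) : Pf (Ex N fun k =>
    lt z (add c (fn F k))) := ltAddLimitConst c F z h

/-! ### Uniqueness of addition and subtraction -/

abbrev eqSuccOfType : Term :=
  Pi Brw fun a => Pi Brw fun b => Arr (isSuccOf Brw lt le a b) (Id Brw a (bsucc b))

def eqSuccOfProof : Pf eqSuccOfType :=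
  .lam fun _ => .lam fun b => .imp fun h => leAntisymm (h.right (bsucc b) (leRefl (bsucc b))) h.left

def eqSuccOfCtx : List Tm := eqSuccOfType.form 32 :: ltAddLimitCtx

theorem eqSuccOf_realized : Realized eqSuccOfCtx :=
  ltAddLimit_realized.extend 0 (eqSuccOfProof.tm.form 32) _ (by decide +kernel)

def eqSuccOfConst : Pf eqSuccOfType := ⟨.bound 32⟩

abbrev succIsSuccOfType : Term :=
  Pi Brw fun b => isSuccOf Brw lt le (bsucc b) b

def succIsSuccOfProof : Pf succIsSuccOfType :=
  .lam fun b => .and (leRefl (bsucc b)) (.lam fun _ => .imp fun h => h)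

def succIsSuccOfCtx : List Tm := succIsSuccOfType.form 33 :: eqSuccOfCtx

theorem succIsSuccOf_realized : Realized succIsSuccOfCtx :=
  eqSuccOf_realized.extend 0 (succIsSuccOfProof.tm.form 33) _ (by decide +kernel)

def succIsSuccOfConst : Pf succIsSuccOfType := ⟨.bound 33⟩

abbrev limitIsLimOfType : Term :=
  Pi BSeq fun F => isLimOf Brw lt le (blimit F) F

def limitIsLimOfProof : Pf limitIsLimOfType :=
  .lam fun F => .and (.lam fun n => .memLe F n) (.lam fun _ => .imp fun h => .leLimiting h.app)

def limitIsLimOfCtx : List Tm := limitIsLimOfType.form 34 :: succIsSuccOfCtx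

theorem limitIsLimOf_realized : Realized limitIsLimOfCtx :=
  succIsSuccOf_realized.extend 0 (limitIsLimOfProof.tm.form 34) _ (by decide +kernel)

def limitIsLimOfConst : Pf limitIsLimOfType := ⟨.bound 34⟩

abbrev eqLimOfType : Term :=
  Pi Brw fun a => Pi BSeq fun F => Arr (isLimOf Brw lt le a F) (Id Brw a (blimit F))

def eqLimOfProof : Pf eqLimOfType :=
  .lam fun _ => .lam fun F => .imp fun h =>
    leAntisymm (h.right (blimit F) (limitIsLimOfConst F).left) (.leLimiting h.left.app)

def eqLimOfCtx : List Tm := eqLimOfType.form 35 :: limitIsLimOfCtx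

theorem eqLimOf_realized : Realized eqLimOfCtx :=
  limitIsLimOf_realized.extend 0 (eqLimOfProof.tm.form 35) _ (by decide +kernel)

def eqLimOfConst : Pf eqLimOfType := ⟨.bound 35⟩

abbrev addIsAdditionType : Term :=
  isAddition Brw lt le add

def addIsAdditionProof : Pf addIsAdditionType :=
  .and (.lam fun c => .lam fun a => .imp fun h =>
      .trans (.congr (add c) (leAntisymm (Pf.app (A := Brw) (B := fun b => le a b) h (K .bzero))
          (.leZero a))) (addZero c)) <|
    .and (.lam fun c => .lam fun a => .lam fun b => .lam fun d => .imp fun h => .imp fun k =>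
      .trans (.congr (add c) (eqSuccOfConst a b h)) <|
          (addSucc c b).trans (eqSuccOfConst d (add c b) k).symm) <|
    .lam fun c => .lam fun a => .lam fun _ => .lam fun F => .imp fun h => .imp fun k =>
      .trans (.congr (add c) (eqLimOfConst a F h)) <| leAntisymm (addLimitLe k.left.app)
        (k.right (add c (blimit F)) (.lam fun n => addMono c (.memLe F n)))

def addIsAdditionCtx : List Tm := addIsAdditionType.form 36 :: eqLimOfCtx

theorem addIsAddition_realized : Realized addIsAdditionCtx :=
  eqLimOf_realized.extend 0 (addIsAdditionProof.tm.form 36) _ (by decide +kernel)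

def addIsAdditionConst : Pf addIsAdditionType := ⟨.bound 36⟩

abbrev additionUniqueType : Term :=
  Pi (BinOp Brw) fun plus => Arr (isAddition Brw lt le plus) <|
    Pi Brw fun c => Pi Brw fun a => Id Brw (plus c a) (add c a)

/-- Induction on the second argument: each clause of the specification fixes the value at one
constructor. -/
def additionUniqueProof : Pf additionUniqueType :=
  .lam fun plus => .imp fun h => .lam fun c => .lam <|
      .brwInd (fun a => Id Brw (plus c a) (add c a))
    ((h.left c (K .bzero) (.lam fun b => .leZero b)).trans (addZero c).symm)
    (fun x ih => .trans (h.right.left c (bsucc x) x (bsucc (add c x)) (succIsSuccOfConst x)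
      -- The specification asks for a successor of `plus c x`; the induction hypothesis identifies
      -- this with `add c x`.
      (ih.symm.rw (fun y => isSuccOf Brw lt le (bsucc (add c x)) y) (succIsSuccOfConst (add c x))))
          (addSucc c x).symm)
    (fun F ih => h.right.right c (blimit F) (add c (blimit F)) F (limitIsLimOfConst F) <| .and
      (.lam fun n => (Pf.leOfEq (ih n)).leTrans (addMono c (.memLe F n)))
      (.lam fun _ => .imp fun k => addLimitLe fun n => (Pf.leOfEq (ih n).symm).leTrans (k n)))

def additionUniqueCtx : List Tm := additionUniqueType.form 37 :: addIsAdditionCtx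

theorem additionUnique_realized : Realized additionUniqueCtx :=
  addIsAddition_realized.extend 0 (additionUniqueProof.tm.form 37) _ (by decide +kernel)

def additionUniqueConst : Pf additionUniqueType := ⟨.bound 37⟩

instance (plus : Term) : IsProp (isAddition Brw lt le plus) := by
  unfold isAddition; infer_instance

/-! ### Left cancellation and uniqueness of differences -/

abbrev subtypePropType : Term :=
  Pi (U 0) fun A => Pi (Arr A (U 0)) fun B => Arr (Pi A fun x => isProp (B x)) <|
    Arr (Pi A fun x => Pi A fun y => Arr (B x) (Arr (B y) (Id A x y))) (isProp (Sig A fun x => B x))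

def subtypePropProof : Pf subtypePropType :=
  .lam fun A => .lam fun B => .imp fun hB => .imp fun h => .lam fun p => .lam fun q =>
    let T : Term := Sig A fun x => B x
    .app (A := T) (B := fun q => Id T p q)
      (.sigInd (A := A) (B := fun x => B x) (fun p => Pi T fun q => Id T p q) (fun a u =>
          .lam fun q => .cast <|
        .sigInd (A := A) (B := fun x => B x) (fun q => Id T (K .pair A B a u) q)
          (fun b v => (sigPathConst A B hB a b (h.app a |>.app b |>.mp ⟨u⟩ |>.mp ⟨v⟩) u v).cast) q)
            p) q

def subtypePropCtx : List Tm := subtypePropType.form 38 :: additionUniqueCtx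

theorem subtypeProp_realized : Realized subtypePropCtx :=
  additionUnique_realized.extend 0 (subtypePropProof.tm.form 38) _ (by decide +kernel)

def subtypePropConst : Pf subtypePropType := ⟨.bound 38⟩

def subtypeProp {A : Term} {B : Term → Term} [∀ x, IsProp (B x)] (h : ∀ x y, Pf (B x) → Pf
    (B y) → Pf (Id A x y)) : Pf (isProp (Sig A B)) := ⟨subtypePropConst.tm A (Lam B) (Lam fun x =>
        (IsProp.pf (A := B x)).tm) (Lam fun x => Lam fun y => Lam fun p => Lam fun q =>
          (h x y ⟨p⟩ ⟨q⟩).tm)⟩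

/-- Addition reflects the order in the second argument. -/
abbrev addReflectType : Term :=
  Pi Brw fun a => Pi Brw fun x => Pi Brw fun y => Arr (le (add a x) (add a y)) (le x y)

def addReflectProof : Pf addReflectType :=
  .lam fun a => .lam <| .brwInd (fun x => Pi Brw fun y => Arr (le (add a x) (add a y)) (le x y))
    (.lam fun y => .imp fun _ => .leZero y)
    (fun x ih =>
      -- Reflection of `≤` at `succ x` is reflection of `<` at `x`. It needs an inner induction on
      -- `y`, with inversion of the strict order at each constructor.
      let strict : Pf (Pi Brw fun y => Arr (lt (add a x) (add a y)) (lt x y)) :=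
        .lam <| .brwInd (fun y => Arr (lt (add a x) (add a y)) (lt x y))
        (.imp fun h => ltIrrefl (h.leTrans ((Pf.leOfEq (addZero a)).leTrans (leAdd a x))))
        (fun y _ => .imp fun h =>
          .leSuccMono (ih.app y |>.mp (leOfLtSucc (h.leTrans (.leOfEq (addSucc a y))))))
        (fun _ ih => .imp fun h => (ltAddLimit h).exElim fun k h => .leCocone k (ih k h))
      .lam fun y => .imp fun h => strict y ((Pf.leOfEq (addSucc a x).symm).leTrans h))
    (fun F ih => .lam fun y => .imp fun h => .leLimiting fun k =>
        ih k |>.app y |>.mp ((addMono a (.memLe F k)).leTrans h))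

def addReflectCtx : List Tm := addReflectType.form 39 :: subtypePropCtx

theorem addReflect_realized : Realized addReflectCtx :=
  subtypeProp_realized.extend 0 (addReflectProof.tm.form 39) _ (by decide +kernel)

def addReflectConst : Pf addReflectType := ⟨.bound 39⟩

def addReflect {a x y : Term} (h : Pf (le (add a x) (add a y))) : Pf (le x y) :=
    addReflectConst a x y h

abbrev addCancelType : Term :=
  Pi Brw fun a => Pi Brw fun x => Pi Brw fun y => Arr (Id Brw (add a x) (add a y)) (Id Brw x y)

def addCancelProof : Pf addCancelType :=
  .lam fun _ => .lam fun _ => .lam fun _ => .imp fun h =>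
    leAntisymm (addReflect (.leOfEq h)) (addReflect (.leOfEq h.symm))

def addCancelCtx : List Tm := addCancelType.form 40 :: addReflectCtx

theorem addCancel_realized : Realized addCancelCtx :=
  addReflect_realized.extend 0 (addCancelProof.tm.form 40) _ (by decide +kernel)

def addCancelConst : Pf addCancelType := ⟨.bound 40⟩

def addCancel {a x y : Term} (h : Pf (Id Brw (add a x) (add a y))) : Pf (Id Brw x y) :=
    addCancelConst a x y h

abbrev differencePropType : Term :=
  Pi Brw fun a => Pi Brw fun b => isProp (Sig Brw fun c => Id Brw (add a c) b)

def differencePropProof : Pf differencePropType :=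
  .lam fun _ => .lam fun _ => subtypeProp fun _ _ p q => addCancel (p.trans q.symm)

def differencePropCtx : List Tm := differencePropType.form 41 :: addCancelCtx

theorem differenceProp_realized : Realized differencePropCtx :=
  addCancel_realized.extend 0 (differencePropProof.tm.form 41) _ (by decide +kernel)

def differencePropConst : Pf differencePropType := ⟨.bound 41⟩

abbrev subtractionPropType : Term :=
  isProp (subtractionFor Brw le add)

/-- Left cancellation gives equality of the values, and function extensionality equality of the
functions. -/
def subtractionPropProof : Pf subtractionPropType :=
  subtypeProp (B := fun m => Pi Brw fun b => Pi Brw fun a => Pi (le a b) fun p =>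
      Id Brw (add a (m b a p)) b)
    fun _ _ p q => .funext (A := Brw) fun b => .funext (A := Brw) fun a =>
        .funext (A := le a b) fun h =>
      addCancel (a := a) (.trans ((p.app b).app a |>.app h) (.symm ((q.app b).app a |>.app h)))

def subtractionPropCtx : List Tm := subtractionPropType.form 42 :: differencePropCtx

theorem subtractionProp_realized : Realized subtractionPropCtx :=
  differenceProp_realized.extend 0 (subtractionPropProof.tm.form 42) _ (by decide +kernel)

def subtractionPropConst : Pf subtractionPropType := ⟨.bound 42⟩

def additionPair : Term := K .pair (BinOp Brw) (Lam (isAddition Brw lt le))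
    add addIsAdditionConst.tm

abbrev additionContrType : Term :=
  Pi (hasAddition Brw lt le) fun s => Id (hasAddition Brw lt le) additionPair s

def additionContrProof : Pf additionContrType :=
  .lam fun s => .cast <| .sigInd (A := BinOp Brw) (B := isAddition Brw lt le) (fun s =>
      Id (hasAddition Brw lt le) additionPair s)
    (fun plus h => .cast <| sigPathConst (BinOp Brw) (Lam (isAddition Brw lt le))
      (.lam fun p => (IsProp.pf (A := isAddition Brw lt le p)).cast) add plus
      (.funext (A := Brw) fun c => .funext (A := Brw) fun a =>
          (additionUniqueConst plus ⟨h⟩ c a).symm)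
      addIsAdditionConst.tm h) s

def additionContrCtx : List Tm := additionContrType.form 43 :: subtractionPropCtx

theorem additionContr_realized : Realized additionContrCtx :=
  subtractionProp_realized.extend 0 (additionContrProof.tm.form 43) _ (by decide +kernel)

def additionContrConst : Pf additionContrType := ⟨.bound 43⟩

abbrev subtractionForAddType : Term :=
  Arr (hasSubtraction Brw lt le) (subtractionFor Brw le add)

/-- A given subtraction comes with an addition of its own; it is transported along the uniqueness of
addition. -/
def subtractionForAddProof : Pf subtractionForAddType :=
  .imp fun s =>
    let A := hasAddition Brw lt le
    let plus (s : Term) : Term := fst (BinOp Brw) (isAddition Brw lt le) s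
    .cast <| .sigInd (A := A) (B := fun t => subtractionFor Brw le (plus t)) (fun _ =>
        subtractionFor Brw le add)
      (fun t sub => .cast <| (additionContrConst t).symm.rw (fun t =>
          subtractionFor Brw le (plus t)) ⟨sub⟩) s.tm

def subtractionForAddCtx : List Tm := subtractionForAddType.form 44 :: additionContrCtx

theorem subtractionForAdd_realized : Realized subtractionForAddCtx :=
  additionContr_realized.extend 0 (subtractionForAddProof.tm.form 44) _ (by decide +kernel)

def subtractionForAddConst : Pf subtractionForAddType := ⟨.bound 44⟩

abbrev uniqueOfHasSubtractionType : Term :=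
  Arr (hasSubtraction Brw lt le) (hasUniqueSubtraction Brw lt le)

def uniqueOfHasSubtractionProof : Pf uniqueOfHasSubtractionType :=
  .imp fun s =>
    .pair additionPair <| .and additionContrConst <| .cast <|
      .pair (A := subtractionFor Brw le add) (B := fun x => Pi (subtractionFor Brw le add) fun y =>
          Id (subtractionFor Brw le add) x y)
        (subtractionForAddConst s).tm (.lam fun y =>
          subtractionPropConst (subtractionForAddConst s).tm y)

def uniqueOfHasSubtractionCtx : List Tm :=
    uniqueOfHasSubtractionType.form 45 :: subtractionForAddCtx

theorem uniqueOfHasSubtraction_realized : Realized uniqueOfHasSubtractionCtx :=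
  subtractionForAdd_realized.extend 0 (uniqueOfHasSubtractionProof.tm.form 45) _ (by decide +kernel)

/-! ### Subtraction from the limited principle of omniscience -/

abbrev ffNeTtType : Term :=
  Arr (Id Two (K .ff) (K .tt)) (K .empty)

def ffNeTtProof : Pf ffNeTtType :=
  -- Transport in the family that is the unit type at `ff` and empty at `tt`.
  .imp fun h => .cast <| h.rw (fun b => K .boolInd (Lam fun _ => U 0) (K .unit) (K .empty) b)
    (Pf.cast (A := K .unit) ⟨K .star⟩)

def ffNeTtCtx : List Tm := ffNeTtType.form 46 :: uniqueOfHasSubtractionCtx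

theorem ffNeTt_realized : Realized ffNeTtCtx :=
  uniqueOfHasSubtraction_realized.extend 1 (ffNeTtProof.tm.form 46) _ (by decide +kernel)

def ffNeTtConst : Pf ffNeTtType := ⟨.bound 46⟩

def ffNeTt {A : Term} (h : Pf (Id Two (K .ff) (K .tt))) : Pf A := (ffNeTtConst h).absurd

abbrev sumPropType : Term :=
  Pi (U 0) fun A => Pi (U 0) fun B => Arr (isProp A) <| Arr (isProp B) <|
      Arr (Arr A (Arr B (K .empty))) (isProp (Sum A B))

def sumPropProof : Pf sumPropType :=
  .lam fun A => .lam fun B => .imp fun hA => .imp fun hB => .imp fun h => .lam fun x =>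
      .lam fun y =>
    let T := Sum A B
    .app (A := T) (B := fun y => Id T x y) (.sumInd (A := A) (B := B) (fun x => Pi T fun y =>
        Id T x y)
      (fun a => .lam fun y => .sumInd (A := A) (B := B) (fun y => Id T (K .inl A B a) y)
        (fun b => .congr (fun a => K .inl A B a) (hA a b))
        (fun b => (h.mp ⟨a⟩ |>.mp ⟨b⟩).absurd) y)
      (fun a => .lam fun y => .sumInd (A := A) (B := B) (fun y => Id T (K .inr A B a) y)
        (fun b => (h.mp ⟨b⟩ |>.mp ⟨a⟩).absurd)
        (fun b => .congr (fun a => K .inr A B a) (hB a b)) y) x) y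

def sumPropCtx : List Tm := sumPropType.form 47 :: ffNeTtCtx

theorem sumProp_realized : Realized sumPropCtx :=
  ffNeTt_realized.extend 0 (sumPropProof.tm.form 47) _ (by decide +kernel)

def sumPropConst : Pf sumPropType := ⟨.bound 47⟩

abbrev sumProp {A B : Term} [IsProp A] [IsProp B] (h : Pf A → Pf B → Pf (K .empty)) : IsProp
    (Sum A B) := ⟨sumPropConst A B IsProp.pf IsProp.pf (.imp fun a => .imp fun b => h a b)⟩

abbrev allOrExType : Term :=
  Arr LPO <| Pi (Arr N (U 0)) fun P => Pi (Arr N (U 0)) fun Q =>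
      Arr (Pi N fun k => Sum (P k) (Q k)) <|
    Sum (Pi N fun k => P k) (Ex N fun k => Q k)

/-- LPO is applied to the sequence recording which alternative `d` selects: `ff` for `P`, `tt` for
`Q`. The alternatives need not exclude each other. -/
def allOrExProof : Pf allOrExType :=
  .imp fun lpo => .lam fun P => .lam fun Q => .imp fun d =>
    let val (k w : Term) : Term := K .sumInd (P k) (Q k) (Lam fun _ => Two) (Lam fun _ => K .ff)
        (Lam fun _ => K .tt) w
    let s : Term := Lam fun k => val k (d.tm k)
    Pf.elim (A := Pi N fun n => Id Two (s n) (K .ff)) (B := Ex N fun n => Id Two (s n) (K .tt))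
      (Pf.cast (A := Sum (Pi N fun n => Id Two (s n) (K .ff)) (Ex N fun n => Id Two (s n) (K .tt)))
          ⟨lpo.tm s⟩)
      (fun h => .inl <| .lam fun k => .mp (A := Id Two (val k (d.tm k)) (K .ff))
        (.sumInd (A := P k) (B := Q k) (fun w => Arr (Id Two (val k w) (K .ff)) (P k))
          (fun a => .imp fun _ => ⟨a⟩)
          (fun _ => .imp fun e => ffNeTt (Pf.symm (A := Two) e.cast)) (d.tm k)) (h k).cast)
      (fun h => .inr <| h.exElim fun k e => .exI k <| .mp (A := Id Two (val k (d.tm k)) (K .tt))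
        (.sumInd (A := P k) (B := Q k) (fun w => Arr (Id Two (val k w) (K .tt)) (Q k))
          (fun _ => .imp fun e => ffNeTt e.cast)
          (fun b => .imp fun _ => ⟨b⟩) (d.tm k)) e.cast)

def allOrExCtx : List Tm := allOrExType.form 48 :: sumPropCtx

theorem allOrEx_realized : Realized allOrExCtx :=
  sumProp_realized.extend 0 (allOrExProof.tm.form 48) _ (by decide +kernel)

def allOrExConst : Pf allOrExType := ⟨.bound 48⟩

def allOrEx (lpo : Pf LPO) {P Q : Term → Term} (h : ∀ k, Pf (Sum (P k) (Q k))) : Pf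
    (Sum (Pi N P) (Ex N Q)) := allOrExConst lpo (Lam P) (Lam Q) (.lam fun k => (h k).cast) |>.cast

instance {x y : Term} : IsProp (Sum (le x y) (lt y x)) :=
  sumProp fun p q => ltIrrefl (q.leTrans p)

abbrev leOrLtType : Term :=
  Arr LPO <| Pi Brw fun x => Pi Brw fun y => Sum (le x y) (lt y x)

/-- The alternatives are incompatible, so their sum is a proposition and double induction applies;
LPO decides the limit cases. -/
def leOrLtProof : Pf leOrLtType :=
  .imp fun lpo => .lam <| .brwInd (fun x => Pi Brw fun y => Sum (le x y) (lt y x))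
    (.lam fun y => .inl (.leZero y))
    (fun x ih => .lam <| .brwInd (fun y => Sum (le (bsucc x) y) (lt y (bsucc x)))
      (.inr (.leSuccMono (.leZero x)))
      (fun y _ => (ih.app y).elim (fun h => .inl (.leSuccMono h)) (fun h => .inr (.leSuccMono h)))
      -- The roles are exchanged: a single member above `succ x` puts the limit above it, whereas
      -- the opposite case needs all members.
      (fun G ih => (allOrEx lpo (P := fun k => lt (fn G k) (bsucc x)) (Q := fun k =>
          le (bsucc x) (fn G k))
          fun k => (ih k).elim .inr .inl).elim
        (fun h => .inr (.leSuccMono (.leLimiting fun k => leOfLtSucc (h k))))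
        (fun h => h.exElim fun k h => .inl (.leCocone k h))))
    (fun F ih => .lam fun y => (allOrEx lpo (P := fun k => le (fn F k) y) (Q := fun k =>
        lt y (fn F k))
          fun k => (ih k).app y).elim
        (fun h => .inl (.leLimiting h.app))
        (fun h => h.exElim fun k h => .inr (.leCocone k h)))

def leOrLtCtx : List Tm := leOrLtType.form 49 :: allOrExCtx

theorem leOrLt_realized : Realized leOrLtCtx :=
  allOrEx_realized.extend 0 (leOrLtProof.tm.form 49) _ (by decide +kernel)

def leOrLtConst : Pf leOrLtType := ⟨.bound 49⟩

def leOrLt (lpo : Pf LPO) (x y : Term) : Pf (Sum (le x y) (lt y x)) :=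
    leOrLtConst lpo |>.app x |>.app y

/-- The type of differences of `b` and `a`. -/
abbrev Diff (b a : Term) : Term := Sig Brw fun c => Id Brw (add a c) b

instance {a b : Term} : IsProp (Diff b a) := ⟨differencePropConst a b⟩

/-! ### Differences of limits -/

abbrev diffIncrType : Term :=
  Pi Brw fun a => Pi BSeq fun F => Pi (Arr N Brw) fun c =>
    Arr (Pi N fun n => Id Brw (add a (c n)) (fn F n)) <| Pi N fun n => lt (c n) (c (S n))

/-- `a + succ (c n) = succ (F n) ≤ F (n + 1) = a + c (n + 1)`, and addition reflects the order. -/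
def diffIncrProof : Pf diffIncrType :=
  .lam fun a => .lam fun F => .lam fun c => .imp fun h => .lam fun n => addReflect <|
    (Pf.leOfEq (.trans (addSucc a (c n)) (.congr bsucc (h n)))).leTrans <|
    (Pf.seqIncr F n).leTrans (Pf.leOfEq (h.app (S n)).symm)

def diffIncrCtx : List Tm := diffIncrType.form 50 :: leOrLtCtx

theorem diffIncr_realized : Realized diffIncrCtx :=
  leOrLt_realized.extend 0 (diffIncrProof.tm.form 50) _ (by decide +kernel)

def diffIncrConst : Pf diffIncrType := ⟨.bound 50⟩

abbrev diffLimitType : Term :=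
  Pi Brw fun a => Pi BSeq fun F => Pi (Arr N Brw) fun c =>
    Arr (Pi N fun n => Id Brw (add a (c n)) (fn F n)) (Diff (blimit F) a)

def diffLimitProof : Pf diffLimitType :=
  .lam fun a => .lam fun F => .lam fun c => .imp fun h =>
    let C := Pf.seq (fun n => c n) (diffIncrConst a F c h).app
    let eq (n : Term) : Pf (Id Brw (add a (fn C n)) (fn F n)) := (h n).cast
    .pair (blimit C) <| leAntisymm
      (addLimitLe fun n => (Pf.leOfEq (eq n)).leTrans (.memLe F n))
      (.leLimiting fun n => (Pf.leOfEq (eq n).symm).leTrans (addMono a (.memLe C n)))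

def diffLimitCtx : List Tm := diffLimitType.form 51 :: diffIncrCtx

theorem diffLimit_realized : Realized diffLimitCtx :=
  diffIncr_realized.extend 0 (diffLimitProof.tm.form 51) _ (by decide +kernel)

def diffLimitConst : Pf diffLimitType := ⟨.bound 51⟩

abbrev diffOfZeroType : Term :=
  Pi BSeq fun F => Pi Brw fun a => Arr (le a (fn F (K .zero))) <|
    Arr (Pi N fun n => Arr (le a (fn F n)) (Diff (fn F n) a)) (Diff (blimit F) a)

/-- All members lie above `a`. Differences are given without truncation, so they form a sequence
without any choice. -/
def diffOfZeroProof : Pf diffOfZeroType :=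
  .lam fun F => .lam fun a => .imp fun h => .imp fun d =>
    let hle (n : Term) : Pf (le a (fn F n)) :=
      .natInd (fun n => le a (fn F n)) h (fun n h => h.leTrans (Pf.leOfLt (.seqIncr F n))) n
    let D (n : Term) : Pf (Diff (fn F n) a) := d n (hle n)
    diffLimitConst a F (Lam fun n => (D n).fst) (.lam fun n => (D n).snd.cast)

def diffOfZeroCtx : List Tm := diffOfZeroType.form 52 :: diffLimitCtx

theorem diffOfZero_realized : Realized diffOfZeroCtx :=
  diffLimit_realized.extend 0 (diffOfZeroProof.tm.form 52) _ (by decide +kernel)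

def diffOfZeroConst : Pf diffOfZeroType := ⟨.bound 52⟩

/-- The sequence `F` without its first member. -/
def tail (F : Term) : Term := Pf.seq (fun n => fn F (S n)) fun n => Pf.seqIncr F (S n)

abbrev limitTailType : Term :=
  Pi BSeq fun F => Id Brw (blimit (tail F)) (blimit F)

def limitTailProof : Pf limitTailType :=
  .lam fun F => leAntisymm (.leLimiting fun n => .cast (Pf.memLe F (S n)))
    (.leLimiting fun n => (Pf.leOfLt (.seqIncr F n)).leTrans
        (.cast (B := le (fn F (S n)) (blimit (tail F))) (.memLe (tail F) n)))

def limitTailCtx : List Tm := limitTailType.form 53 :: diffOfZeroCtx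

theorem limitTail_realized : Realized limitTailCtx :=
  diffOfZero_realized.extend 0 (limitTailProof.tm.form 53) _ (by decide +kernel)

def limitTailConst : Pf limitTailType := ⟨.bound 53⟩

abbrev diffOfLeType : Term :=
  Pi Brw fun a => Pi N fun k => Pi BSeq fun F => Arr (le a (fn F k)) <|
    Arr (Pi N fun n => Arr (le a (fn F n)) (Diff (fn F n) a)) (Diff (blimit F) a)

/-- Induction on `k` for all `F` at once: dropping the first member lowers the index by one and does
not change the limit. -/
def diffOfLeProof : Pf diffOfLeType :=
  .lam fun a => .lam <| .natInd (fun k => Pi BSeq fun F => Arr (le a (fn F k)) <|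
      Arr (Pi N fun n => Arr (le a (fn F n)) (Diff (fn F n) a)) (Diff (blimit F) a))
    (.lam fun F => diffOfZeroConst F a)
    (fun _ ih => .lam fun F => .imp fun h => .imp fun d => (limitTailConst F).rw (fun b => Diff b a)
      (ih.app (tail F) |>.mp h.cast |>.mp (.cast (A := Pi N fun n =>
          Arr (le a (fn F (S n))) (Diff (fn F (S n)) a))
        (.lam fun n => d.app (S n)))))

def diffOfLeCtx : List Tm := diffOfLeType.form 54 :: limitTailCtx

theorem diffOfLe_realized : Realized diffOfLeCtx :=
  limitTail_realized.extend 0 (diffOfLeProof.tm.form 54) _ (by decide +kernel)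

def diffOfLeConst : Pf diffOfLeType := ⟨.bound 54⟩

abbrev hasDiffType : Term :=
  Arr LPO <| Pi Brw fun b => Pi Brw fun a => Arr (le a b) (Diff b a)

def hasDiffProof : Pf hasDiffType :=
  .imp fun lpo =>
    let ofEq {a b : Term} (h : Pf (Id Brw a b)) : Pf (Diff b a) := .pair (K .bzero)
        ((addZero a).trans h)
    .lam <| .brwInd (fun b => Pi Brw fun a => Arr (le a b) (Diff b a))
    (.lam fun a => .imp fun h => ofEq (leAntisymm h (.leZero a)))
    (fun b ih => .lam fun a => .imp fun h => (leOrLt lpo a b).elim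
      (fun h => let d : Pf (Diff b a) := ih.app a |>.mp h
        .pair (bsucc d.fst) (.trans (addSucc a d.fst) (.congr bsucc d.snd)))
      -- Here `b < a ≤ succ b`, so `a` is `succ b` and the difference is zero.
      (fun k => ofEq (leAntisymm h k)))
    (fun F ih => .lam fun a => .imp fun h => (leOrLt lpo (blimit F) a).elim
      (fun k => ofEq (leAntisymm h k))
      -- The index `k` merely exists; it may be used since the type of differences is a proposition.
      (fun k => (ltLimit k).exElim fun k h => diffOfLeConst a k F |>.mp (Pf.leOfLt h) |>.mp
          (.lam fun n => (ih n).app a)))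

def hasDiffCtx : List Tm := hasDiffType.form 55 :: diffOfLeCtx

theorem hasDiff_realized : Realized hasDiffCtx :=
  diffOfLe_realized.extend 0 (hasDiffProof.tm.form 55) _ (by decide +kernel)

def hasDiffConst : Pf hasDiffType := ⟨.bound 55⟩

/-- The subtraction function that is obtained from the limited principle of omniscience. -/
def minusTerm : Term :=
  Lam fun lpo => Lam fun b => Lam fun a => Lam fun p =>
      (Pf.fst (A := Brw) (B := fun c => Id Brw (add a c) b) ⟨hasDiffConst.tm lpo b a p⟩)

def minusType : Term :=
  Arr LPO <| Pi Brw fun b => Pi Brw fun a => Arr (le a b) Brw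

def minus : Term := .bound 56

abbrev addMinusType (minus : Term) : Term :=
  Pi LPO fun lpo => Pi Brw fun b => Pi Brw fun a => Pi (le a b) fun p =>
      Id Brw (add a (minus lpo b a p)) b

def addMinusProof : Pf (addMinusType minusTerm) :=
  .lam fun lpo => .lam fun b => .lam fun a => .lam fun p => .cast <|
      Pf.snd (A := Brw) (B := fun c => Id Brw (add a c) b) ⟨hasDiffConst.tm lpo b a p⟩

def addMinusCtx : List Tm := (addMinusType minus).form 57 :: minusType.form 56 :: hasDiffCtx

theorem addMinus_realized : Realized addMinusCtx :=
  hasDiff_realized.define 0 (minusTerm.form 56) _ (addMinusProof.tm.form 56) _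
    (by decide +kernel) (by decide +kernel) (by decide +kernel)

def addMinusConst : Pf (addMinusType minus) := ⟨.bound 57⟩

abbrev hasSubtractionOfLPOType : Term :=
  Arr LPO (hasSubtraction Brw lt le)

def hasSubtractionOfLPOProof : Pf hasSubtractionOfLPOType :=
  .imp fun lpo => .pair additionPair <| .cast <|
      .pair (A := Pi Brw fun b => Pi Brw fun a => Arr (le a b) Brw)
        (B := fun m => Pi Brw fun b => Pi Brw fun a => Pi (le a b) fun p =>
          Id Brw (add a (m b a p)) b)
        (minus lpo.tm) (addMinusConst lpo.tm)

def hasSubtractionOfLPOCtx : List Tm := hasSubtractionOfLPOType.form 58 :: addMinusCtx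

theorem hasSubtractionOfLPO_realized : Realized hasSubtractionOfLPOCtx :=
  addMinus_realized.extend 0 (hasSubtractionOfLPOProof.tm.form 58) _ (by decide +kernel)

def hasSubtractionOfLPOConst : Pf hasSubtractionOfLPOType := ⟨.bound 58⟩

/-! ### The limited principle of omniscience from subtraction -/

abbrev leAddRightType : Term :=
  Pi Brw fun c => Pi Brw fun x => le x (add c x)

def leAddRightProof : Pf leAddRightType :=
  .lam fun c => .lam <| .brwInd (fun x => le x (add c x)) (.leZero _)
    (fun x h => h.leSuccMono.leTrans (.leOfEq (addSucc c x).symm))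
    (fun F h => .leLimiting fun k => (h k).leTrans (addMono c (.memLe F k)))

def leAddRightCtx : List Tm := leAddRightType.form 59 :: hasSubtractionOfLPOCtx

theorem leAddRight_realized : Realized leAddRightCtx :=
  hasSubtractionOfLPO_realized.extend 0 (leAddRightProof.tm.form 59) _ (by decide +kernel)

def leAddRightConst : Pf leAddRightType := ⟨.bound 59⟩

/-- The finite Brouwer trees. -/
def finTerm : Term :=
  Lam fun n => K .natInd (Lam fun _ => Brw) (K .bzero) (Lam fun _ => Lam fun x => bsucc x) n

def finType : Term :=
  Arr N Brw

def fin : Term := .bound 60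

abbrev finSpecType (fin : Term) : Term :=
  Prod (Id Brw (fin (K .zero)) (K .bzero)) (Pi N fun n => Id Brw (fin (S n)) (bsucc (fin n)))

def finSpecProof : Pf (finSpecType finTerm) :=
  .cast <| .and (A := Id Brw (K .bzero) (K .bzero)) (B := Pi N fun n =>
      Id Brw (bsucc (finTerm n)) (bsucc (finTerm n)))
    (.refl _) (.lam fun _ => .refl _)

def finSpecCtx : List Tm := (finSpecType fin).form 61 :: finType.form 60 :: leAddRightCtx

theorem finSpec_realized : Realized finSpecCtx :=
  leAddRight_realized.define 0 (finTerm.form 60) _ (finSpecProof.tm.form 60) _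
    (by decide +kernel) (by decide +kernel) (by decide +kernel)

def finSpecConst : Pf (finSpecType fin) := ⟨.bound 61⟩

abbrev finIncrType : Term :=
  Pi N fun n => lt (fin n) (fin (S n))

def finIncrProof : Pf finIncrType :=
  .lam fun n => .leOfEq (finSpecConst.right n).symm

def finIncrCtx : List Tm := finIncrType.form 62 :: finSpecCtx

theorem finIncr_realized : Realized finIncrCtx :=
  finSpec_realized.extend 0 (finIncrProof.tm.form 62) _ (by decide +kernel)

def finIncrConst : Pf finIncrType := ⟨.bound 62⟩

/-- The smallest infinite Brouwer tree. -/
def omega : Term := blimit (Pf.seq (fun n => fin n) finIncrConst.app)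

/-- The step function of the sequence `jump`. -/
def step (b y : Term) : Term := K .boolInd (Lam fun _ => Brw) (bsucc y) (add omega (bsucc y)) b

abbrev stepLtType : Term :=
  Pi Two fun b => Pi Brw fun y => lt y (step b y)

def stepLtProof : Pf stepLtType :=
  .lam fun b => .lam fun y => .boolInd (fun b => lt y (step b y)) (Pf.cast (leRefl (bsucc y)))
    (Pf.cast (leAddRightConst omega (bsucc y))) b

def stepLtCtx : List Tm := stepLtType.form 63 :: finIncrCtx

theorem stepLt_realized : Realized stepLtCtx :=
  finIncr_realized.extend 0 (stepLtProof.tm.form 63) _ (by decide +kernel)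

def stepLtConst : Pf stepLtType := ⟨.bound 63⟩

abbrev stepLtOmegaType : Term :=
  Pi Two fun b => Pi Brw fun y => Arr (lt (step b y) omega) (Id Two b (K .ff))

def stepLtOmegaProof : Pf stepLtOmegaType :=
  .lam fun b => .lam fun y => .boolInd (fun b => Arr (lt (step b y) omega) (Id Two b (K .ff)))
    (.imp fun _ => .refl _)
    (.imp fun h => ltIrrefl (Pf.leTrans (y := bsucc (add omega (bsucc y)))
        (.leSuccMono (leAdd omega (bsucc y))) h.cast)) b

def stepLtOmegaCtx : List Tm := stepLtOmegaType.form 64 :: stepLtCtx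

theorem stepLtOmega_realized : Realized stepLtOmegaCtx :=
  stepLt_realized.extend 0 (stepLtOmegaProof.tm.form 64) _ (by decide +kernel)

def stepLtOmegaConst : Pf stepLtOmegaType := ⟨.bound 64⟩

abbrev omegaLeStepType : Term :=
  Pi Two fun b => Pi Brw fun y => Arr (le omega (step b y)) (Sum (le omega y) (Id Two b (K .tt)))

/-- Since `ω` is a limit, it lies below `succ y` only if it lies below `y`: a step for `ff` cannot
reach it. -/
def omegaLeStepProof : Pf omegaLeStepType :=
  .lam fun b => .lam fun y =>
      .boolInd (fun b => Arr (le omega (step b y)) (Sum (le omega y) (Id Two b (K .tt))))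
    (.imp fun h => .inl (limitLeOfLeSucc h.cast)) (.imp fun _ => .inr (.refl _)) b

def omegaLeStepCtx : List Tm := omegaLeStepType.form 65 :: stepLtOmegaCtx

theorem omegaLeStep_realized : Realized omegaLeStepCtx :=
  stepLtOmega_realized.extend 0 (omegaLeStepProof.tm.form 65) _ (by decide +kernel)

def omegaLeStepConst : Pf omegaLeStepType := ⟨.bound 65⟩

/-- A sequence that exceeds `omega` if `s` takes the value `tt`. -/
def jumpTerm : Term :=
  Lam fun s => Lam fun n => K .natInd (Lam fun _ => Brw) (K .bzero) (Lam fun n => Lam fun x =>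
      step (s n) x) n

def jumpType : Term :=
  Arr (Arr N Two) (Arr N Brw)

def jump : Term := .bound 66

abbrev jumpSpecType (jump : Term) : Term :=
  Pi (Arr N Two) fun s => Prod (Id Brw (jump s (K .zero)) (K .bzero)) (Pi N fun n =>
      Id Brw (jump s (S n)) (step (s n) (jump s n)))

def jumpSpecProof : Pf (jumpSpecType jumpTerm) :=
  .lam fun s => .cast <| .and (A := Id Brw (K .bzero) (K .bzero)) (B := Pi N fun n =>
      Id Brw (step (s n) (jumpTerm s n)) (step (s n) (jumpTerm s n)))
    (.refl _) (.lam fun _ => .refl _)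

def jumpSpecCtx : List Tm := (jumpSpecType jump).form 67 :: jumpType.form 66 :: omegaLeStepCtx

theorem jumpSpec_realized : Realized jumpSpecCtx :=
  omegaLeStep_realized.define 0 (jumpTerm.form 66) _ (jumpSpecProof.tm.form 66) _
    (by decide +kernel) (by decide +kernel) (by decide +kernel)

def jumpSpecConst : Pf (jumpSpecType jump) := ⟨.bound 67⟩

abbrev jumpIncrType : Term :=
  Pi (Arr N Two) fun s => Pi N fun n => lt (jump s n) (jump s (S n))

def jumpIncrProof : Pf jumpIncrType :=
  .lam fun s => .lam fun n => (stepLtConst (s n) |>.app (jump s n)).leTrans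
      (.leOfEq ((jumpSpecConst s).right n).symm)

def jumpIncrCtx : List Tm := jumpIncrType.form 68 :: jumpSpecCtx

theorem jumpIncr_realized : Realized jumpIncrCtx :=
  jumpSpec_realized.extend 0 (jumpIncrProof.tm.form 68) _ (by decide +kernel)

def jumpIncrConst : Pf jumpIncrType := ⟨.bound 68⟩

def jumpSeq (s : Term) : Term := Pf.seq (fun n => jump s n) (jumpIncrConst s).app

abbrev finLeJumpType : Term :=
  Pi (Arr N Two) fun s => Pi N fun n => le (fin n) (jump s n)

def finLeJumpProof : Pf finLeJumpType :=
  .lam fun s => .lam <| .natInd (fun n => le (fin n) (jump s n))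
    ((Pf.leOfEq finSpecConst.left).leTrans (.leZero _))
    (fun n h => (Pf.leOfEq (finSpecConst.right n)).leTrans ((Pf.leSuccMono h).leTrans
        (jumpIncrConst s |>.app n)))

def finLeJumpCtx : List Tm := finLeJumpType.form 69 :: jumpIncrCtx

theorem finLeJump_realized : Realized finLeJumpCtx :=
  jumpIncr_realized.extend 0 (finLeJumpProof.tm.form 69) _ (by decide +kernel)

def finLeJumpConst : Pf finLeJumpType := ⟨.bound 69⟩

abbrev omegaLeJumpType : Term :=
  Pi (Arr N Two) fun s => le omega (blimit (jumpSeq s))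

def omegaLeJumpProof : Pf omegaLeJumpType :=
  .lam fun s => .leLimiting fun n => .cast <| Pf.leTrans (z := blimit (jumpSeq s))
      (finLeJumpConst s |>.app n) (.cast (.memLe (jumpSeq s) n))

def omegaLeJumpCtx : List Tm := omegaLeJumpType.form 70 :: finLeJumpCtx

theorem omegaLeJump_realized : Realized omegaLeJumpCtx :=
  finLeJump_realized.extend 0 (omegaLeJumpProof.tm.form 70) _ (by decide +kernel)

def omegaLeJumpConst : Pf omegaLeJumpType := ⟨.bound 70⟩

abbrev eqFfOfLeType : Term :=
  Pi (Arr N Two) fun s => Arr (le (blimit (jumpSeq s)) omega) (Pi N fun n => Id Two (s n) (K .ff))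

/-- The member `n + 1` is the step for `s n` and lies strictly below `ω`, which excludes `tt`. -/
def eqFfOfLeProof : Pf eqFfOfLeType :=
  .lam fun s => .imp fun h => .lam fun n => stepLtOmegaConst (s n) |>.app (jump s n) |>.mp <|
    ((jumpSpecConst s).right n).rw (fun y => lt y omega)
        (.leTrans (.cast (.memLt (jumpSeq s) (S n))) h)

def eqFfOfLeCtx : List Tm := eqFfOfLeType.form 71 :: omegaLeJumpCtx

theorem eqFfOfLe_realized : Realized eqFfOfLeCtx :=
  omegaLeJump_realized.extend 0 (eqFfOfLeProof.tm.form 71) _ (by decide +kernel)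

def eqFfOfLeConst : Pf eqFfOfLeType := ⟨.bound 71⟩

abbrev existsOfOmegaLeType : Term :=
  Pi (Arr N Two) fun s => Pi N fun k => Arr (le omega (jump s k)) (Ex N fun n =>
      Id Two (s n) (K .tt))

/-- Induction on `k`: `ω` is not below the initial zero, and otherwise it was either reached before
or is reached by a step for `tt`. -/
def existsOfOmegaLeProof : Pf existsOfOmegaLeType :=
  .lam fun s => .lam <| .natInd (fun k => Arr (le omega (jump s k)) (Ex N fun n =>
      Id Two (s n) (K .tt)))
    (.imp fun h => notLtZero ((Pf.memLt (Pf.seq (fun n => fin n) finIncrConst.app)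
        (K .zero)).leTrans (h.leTrans (.leOfEq (jumpSpecConst s).left))))
    (fun k ih => .imp fun h =>
        (omegaLeStepConst (s k) |>.app (jump s k) |>.mp
          (h.leTrans (.leOfEq ((jumpSpecConst s).right k)))).elim
      (fun h => ih h) (fun h => .exI k h))

def existsOfOmegaLeCtx : List Tm := existsOfOmegaLeType.form 72 :: eqFfOfLeCtx

theorem existsOfOmegaLe_realized : Realized existsOfOmegaLeCtx :=
  eqFfOfLe_realized.extend 0 (existsOfOmegaLeProof.tm.form 72) _ (by decide +kernel)

def existsOfOmegaLeConst : Pf existsOfOmegaLeType := ⟨.bound 72⟩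

instance {x : Term} : IsProp (Sum (Id Brw x (K .bzero)) (le (bsucc (K .bzero)) x)) :=
  sumProp fun p q => notLtZero (Pf.leTrans q (.leOfEq p))

abbrev zeroOrPosType : Term :=
  Pi Brw fun x => Sum (Id Brw x (K .bzero)) (le (bsucc (K .bzero)) x)

def zeroOrPosProof : Pf zeroOrPosType :=
  .lam <| .brwInd (fun x => Sum (Id Brw x (K .bzero)) (le (bsucc (K .bzero)) x)) (.inl (.refl _))
    (fun x _ => .inr (.leSuccMono (.leZero x)))
    (fun F _ => .inr (.leTrans (.leSuccMono (.leZero _)) (.memLt F (K .zero))))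

def zeroOrPosCtx : List Tm := zeroOrPosType.form 73 :: existsOfOmegaLeCtx

theorem zeroOrPos_realized : Realized zeroOrPosCtx :=
  existsOfOmegaLe_realized.extend 0 (zeroOrPosProof.tm.form 73) _ (by decide +kernel)

def zeroOrPosConst : Pf zeroOrPosType := ⟨.bound 73⟩

abbrev lpoOfDiffType : Term :=
  Arr (Pi Brw fun b => Pi Brw fun a => Arr (le a b) (Diff b a)) LPO

/-- With `x = J - ω`, the question about `s` becomes whether `x` is zero, which is decidable for
every tree (`zeroOrPosConst`). -/
def lpoOfDiffProof : Pf lpoOfDiffType :=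
  .imp fun d => .lam fun s =>
    let J := blimit (jumpSeq s)
    let x : Pf (Diff J omega) := d.app J |>.app omega |>.mp (omegaLeJumpConst s)
    .elim (zeroOrPosConst x.fst)
      (fun h => .inl <| eqFfOfLeConst s |>.mp <| .leOfEq <| x.snd.symm.trans <|
          .trans (.congr (add omega) h) (addZero omega))
      -- Here `1 ≤ x`, so `succ ω = ω + 1 ≤ ω + x = J`.
      (fun h => .inr <| .exElim (ltLimit (z := omega) (F := jumpSeq s) <|
          .leTrans (.leOfEq <| .symm <|
          (addSucc omega (K .bzero)).trans (.congr bsucc (addZero omega))) <|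
          (addMono omega h).leTrans (.leOfEq x.snd)) fun k h =>
        existsOfOmegaLeConst s |>.app k |>.mp (.cast (Pf.leOfLt h)))

def lpoOfDiffCtx : List Tm := lpoOfDiffType.form 74 :: zeroOrPosCtx

theorem lpoOfDiff_realized : Realized lpoOfDiffCtx :=
  zeroOrPos_realized.extend 0 (lpoOfDiffProof.tm.form 74) _ (by decide +kernel)

def lpoOfDiffConst : Pf lpoOfDiffType := ⟨.bound 74⟩

abbrev lpoOfHasSubtractionType : Term :=
  Arr (hasSubtraction Brw lt le) LPO

def lpoOfHasSubtractionProof : Pf lpoOfHasSubtractionType :=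
  .imp fun s =>
    let sub : Pf (Sig (Pi Brw fun b => Pi Brw fun a => Arr (le a b) Brw) fun m =>
      Pi Brw fun b => Pi Brw fun a => Pi (le a b) fun p =>
          Id Brw (add a (m b a p)) b) := (subtractionForAddConst s).cast
    lpoOfDiffConst <| .lam fun b => .lam fun a => .lamPf fun p =>
      .pair (sub.fst b a p.tm) (sub.snd.app b |>.app a |>.app p.tm)

def lpoOfHasSubtractionCtx : List Tm := lpoOfHasSubtractionType.form 75 :: lpoOfDiffCtx

theorem lpoOfHasSubtraction_realized : Realized lpoOfHasSubtractionCtx :=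
  lpoOfDiff_realized.extend 0 (lpoOfHasSubtractionProof.tm.form 75) _ (by decide +kernel)

def lpoOfHasSubtractionConst : Pf lpoOfHasSubtractionType := ⟨.bound 75⟩

abbrev hasSubtractionIffLPOType : Term :=
  Prod (Arr (hasSubtraction Brw lt le) LPO) (Arr LPO (hasSubtraction Brw lt le))

def hasSubtractionIffLPOProof : Pf hasSubtractionIffLPOType :=
  .and lpoOfHasSubtractionConst hasSubtractionOfLPOConst

def hasSubtractionIffLPOCtx : List Tm := hasSubtractionIffLPOType.form 76 :: lpoOfHasSubtractionCtx

theorem hasSubtractionIffLPO_realized : Realized hasSubtractionIffLPOCtx :=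
  lpoOfHasSubtraction_realized.extend 0 (hasSubtractionIffLPOProof.tm.form 76) _ (by decide +kernel)

end HoTT

theorem theorem45 :
    HoTT.Provable
      (HoTT.Arr (HoTT.hasSubtraction HoTT.Brw HoTT.lt HoTT.le)
        (HoTT.hasUniqueSubtraction HoTT.Brw HoTT.lt HoTT.le)) ∧
    HoTT.Provable
      (HoTT.Prod
        (HoTT.Arr (HoTT.hasSubtraction HoTT.Brw HoTT.lt HoTT.le) HoTT.LPO)
        (HoTT.Arr HoTT.LPO (HoTT.hasSubtraction HoTT.Brw HoTT.lt HoTT.le))) := by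
  -- Each statement is the head of its context. The remaining evaluations confirm that it is a type
  -- in the lowest universe and closed.
  exact ⟨HoTT.uniqueOfHasSubtraction_realized.provable (n := 0) rfl (by decide +kernel)
      (by decide +kernel),
    HoTT.hasSubtractionIffLPO_realized.provable (n := 0) rfl (by decide +kernel)
      (by decide +kernel)⟩
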